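/- Conventions. Let $k$ be a commutative ring. A $k$-linear monoidal category is a monoidal category enriched in $k$-modules whose tensor product is $k$-bilinear on morphisms; monoidal functors are strong and unital; associativity and unit isomorphisms are suppressed. A braider of a monoidal category $\mathcal T$ is a pair $(C,R_C)$ of an object $C$ and morphisms $R_C(X)\colon C\otimes X\to X\otimes C$ (not necessarily isomorphisms), functorial in $X$, with $R_C(X\otimes Y)=(X\otimes R_C(Y))\circ(R_C(X)\otimes Y)$ and with $R_C(\mathbf 1)$ the canonical isomorphism. A family $(C_i,R_{C_i})_{i\in I}$ of braiders in a $k$-linear monoidal category is a real commuting family if $R_{C_i}(C_i)\in k^\times\,\mathrm{id}$ and $R_{C_j}(C_i)\circ R_{C_i}(C_j)\in k^\times\,\mathrm{id}$ for all $i,j\in I$. An object $Z$ is invertible if the functors $-\otimes Z$ and $Z\otimes -$ are equivalences. Theorem 2.6. Let $(C_i,R_{C_i})_{i\in I}$ be a real commuting family of braiders in a $k$-linear monoidal category $\mathcal T$. There exist a $k$-linear monoidal category $\widetilde{\mathcal T}$ and a $k$-linear monoidal functor $\Upsilon\colon\mathcal T\to\widetilde{\mathcal T}$ such that (i) $\Upsilon(C_i)$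 is invertible in $\widetilde{\mathcal T}$ for every $i\in I$; (ii) $\Upsilon(R_{C_i}(X))$ is an isomorphism for all $i\in I$ and $X\in\mathcal T$; (iii) if $\mathcal T'$ is a monoidal category and $\Upsilon'\colon\mathcal T\to\mathcal T'$ is a monoidal functor such that (i) and (ii) hold for $\Upsilon'$, then there are a monoidal functor $F\colon\widetilde{\mathcal T}\to\mathcal T'$ and a monoidal isomorphism $\theta\colon F\circ\Upsilon\simeq\Upsilon'$, and for any two such pairs $(F,\theta)$, $(G,\kappa)$ there is a unique monoidal isomorphism $\varphi\colon F\simeq G$ with $\kappa\circ(\varphi\Upsilon)=\theta$. If moreover $\mathcal T'$ and $\Upsilon'$ are $k$-linear, then every such $F$ is $k$-linear. (iv) $\widetilde{\mathcal T}$ and $\Upsilon$ can be taken of the following form. There are units $\eta_{ij}\in k^\times$ $(i,j\in I)$ with $R_{C_i}(C_i)=\eta_{ii}\,\mathrm{id}$ and $R_{C_j}(C_i)\circ R_{C_i}(C_j)=\eta_{ij}\eta_{ji}\,\mathrm{id}$, braiders $(C^a,R_{C^a})$ for $a\in\mathbb Z_{\ge0}^{\oplus I}$, and isomorphisms $\xi_{a,b}\colon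 C^a\otimes C^b\simeq C^{a+b}$, compatible with the braider structures and associative, such that $C^0\simeq\mathbf 1$ (compatibly with $\xi_{0,0}$) and $C^{e_i}\simeq C_i$ as braiders, and $\xi_{e_j,e_i}\circ R_{C^{e_i}}(C^{e_j})=\eta_{ij}\,\xi_{e_i,e_j}$, where $(e_i)$ is the standard basis. Put $\eta(\alpha,\beta)=\prod_{i,j}\eta_{ij}^{\alpha_i\beta_j}$ for $\alpha,\beta\in\mathbb Z^{\oplus I}$. The objects of $\widetilde{\mathcal T}$ are the pairs $(X,\alpha)$ with $X\in\mathcal T$, $\alpha\in\mathbb Z^{\oplus I}$, and, as $k$-modules, $$\mathrm{Hom}_{\widetilde{\mathcal T}}((X,\alpha),(Y,\beta))=\varinjlim_{\delta}H_\delta((X,\alpha),(Y,\beta)),\qquad H_\delta((X,\alpha),(Y,\beta))=\mathrm{Hom}_{\mathcal T}(C^{\delta+\alpha}\otimes X,\;Y\otimes C^{\delta+\beta}),$$ over those $\delta\in\mathbb Z^{\oplus I}$ for which all entries of $\delta+\alpha$ and $\delta+\beta$ are $\ge0$, ordered by $\delta\preceq\delta'$ if $\delta'-\delta\in\mathbb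 Z_{\ge0}^{\oplus I}$. The transition map $H_\delta\to H_{\delta'}$ sends $f$ to the map induced, through the isomorphisms $\xi$, by $(R_{C^{\delta'-\delta}}(Y)\otimes C^{\delta+\beta})\circ(C^{\delta'-\delta}\otimes f)$. The identity of $(X,\alpha)$ is the class of $\mathrm{id}_X$ in $H_{-\alpha}$. The composite of the classes of $f\in H_\delta((X,\alpha),(Y,\beta))$ and $g\in H_\epsilon((Y,\beta),(Z,\gamma))$ is the class in $H_{\delta+\epsilon+\beta}$ of $\eta(\delta+\beta,\beta-\gamma)$ times the map induced, through $\xi$, by $(g\otimes C^{\delta+\beta})\circ(C^{\epsilon+\beta}\otimes f)$. The unit object is $(\mathbf 1,0)$, $(X,\alpha)\otimes(Y,\beta)=(X\otimes Y,\alpha+\beta)$, and the tensor product of the classes of $f\in H_\delta((X,\alpha),(X',\alpha'))$ and $g\in H_\epsilon((Y,\beta),(Y',\beta'))$ is the class in $H_{\delta+\epsilon}$ of $\eta(\epsilon,\alpha-\alpha')$ times the map induced, through $\xi$, by $(X'\otimes R_{C^{\delta+\alpha'}}(Y')\otimes C^{\epsilon+\beta'})\circ(f\otimes g)\circ(C^{\delta+\alpha}\otimes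 R_{C^{\epsilon+\beta}}(X)\otimes Y)$. Finally $\Upsilon(X)=(X,0)$, and $\Upsilon(f)$ is the class of $f\in H_0((X,0),(Y,0))\simeq\mathrm{Hom}_{\mathcal T}(X,Y)$. -/

import Mathlib

open CategoryTheory MonoidalCategory

universe u v u' v' w x

namespace BraiderLocalization

/-- A (left) braider of a monoidal category: an object `pt` with morphisms
`R X : pt ⊗ X ⟶ X ⊗ pt`, functorial in `X` and compatible with tensor products and the unit.
The morphisms `R X` are not required to be isomorphisms. -/
structure Braider (T : Type u) [Category.{v} T] [MonoidalCategory T] where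
  pt : T
  R : ∀ X : T, pt ⊗ X ⟶ X ⊗ pt
  naturality : ∀ {X Y : T} (f : X ⟶ Y), (pt ◁ f) ≫ R Y = R X ≫ (f ▷ pt)
  tensor : ∀ X Y : T,
    R (X ⊗ Y) =
      (α_ pt X Y).inv ≫ (R X ▷ Y) ≫ (α_ X pt Y).hom ≫ (X ◁ R Y) ≫ (α_ X Y pt).inv
  unit : R (𝟙_ T) ≫ (λ_ pt).hom = (ρ_ pt).hom

/-- A family of braiders of a `k`-linear monoidal category is a real commuting family if
`R_{C_i}(C_i)` and all `R_{C_j}(C_i) ∘ R_{C_i}(C_j)` are identities up to a unit of `k`. -/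
structure IsRealCommutingFamily (k : Type x) [CommRing k] {T : Type u} [Category.{v} T]
    [MonoidalCategory T] [Preadditive T] [Linear k T] {I : Type w} (C : I → Braider T) :
    Prop where
  self : ∀ i, ∃ c : kˣ, (C i).R (C i).pt = (c : k) • 𝟙 ((C i).pt ⊗ (C i).pt)
  pair : ∀ i j, ∃ c : kˣ,
    (C i).R (C j).pt ≫ (C j).R (C i).pt = (c : k) • 𝟙 ((C i).pt ⊗ (C j).pt)

/-- An object is invertible if tensoring with it, on either side, is an equivalence. -/
def IsInvertibleObj {T : Type u} [Category.{v} T] [MonoidalCategory T] (X : T) : Prop :=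
  (tensorRight X).IsEquivalence ∧ (tensorLeft X).IsEquivalence

/-- The two conditions imposed on a functor `Υ` out of `T`: every `Υ(C_i)` is invertible and every
`Υ(R_{C_i}(X))` is an isomorphism. -/
def InvertsFamily {T : Type u} [Category.{v} T] [MonoidalCategory T] {I : Type w}
    (C : I → Braider T) {L : Type u'} [Category.{v'} L] [MonoidalCategory L] (Υ : T ⥤ L) : Prop :=
  (∀ i, IsInvertibleObj (Υ.obj (C i).pt)) ∧ (∀ i (X : T), IsIso (Υ.map ((C i).R X)))

section Exponents

variable {I : Type w}

/-- The inclusion of `ℤ_{≥0}^{⊕I}` into `ℤ^{⊕I}`. -/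
noncomputable def toInt (a : I →₀ ℕ) : I →₀ ℤ :=
  a.mapRange (fun n : ℕ => (n : ℤ)) Nat.cast_zero

/-- The bimultiplicative extension `η(α, β) = ∏ η_{ij} ^ (α_i β_j)`. -/
noncomputable def biChar {k : Type x} [CommRing k] (η : I → I → kˣ) (α β : I →₀ ℤ) : kˣ :=
  α.prod fun i m => β.prod fun j n => η i j ^ (m * n)

end Exponents

section Powers

variable {k : Type x} [CommRing k] {T : Type u} [Category.{v} T] [MonoidalCategory T]
  [Preadditive T] [Linear k T] {I : Type w}

/-- The tensor powers `C^a` (`a ∈ ℤ_{≥0}^{⊕I}`) of a family of braiders `C`, relative to units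
`η_{ij}` with `R_{C_i}(C_i) = η_{ii} id` and `R_{C_j}(C_i) ∘ R_{C_i}(C_j) = η_{ij} η_{ji} id`:
braiders `C^a` with isomorphisms `ξ_{a,b} : C^a ⊗ C^b ≅ C^{a+b}` of braiders, associative, such that
`C^0` is the unit, `C^{e_i}` is `C_i` (as braiders), and `ξ_{e_j,e_i} ∘ R(C^{e_j}) = η_{ij} ξ_{e_i,e_j}`
on `C^{e_i} ⊗ C^{e_j}`.  The exponent `a + b` enters `ξ` through a variable `c` with `a + b = c`. -/
structure Powers (C : I → Braider T) (η : I → I → kˣ) where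
  self_eq : ∀ i, (C i).R (C i).pt = ((η i i : kˣ) : k) • 𝟙 ((C i).pt ⊗ (C i).pt)
  pair_eq : ∀ i j, (C i).R (C j).pt ≫ (C j).R (C i).pt =
    ((η i j * η j i : kˣ) : k) • 𝟙 ((C i).pt ⊗ (C j).pt)
  pow : (I →₀ ℕ) → Braider T
  ξ : ∀ {a b c : I →₀ ℕ}, a + b = c → ((pow a).pt ⊗ (pow b).pt ≅ (pow c).pt)
  zeroIso : (pow 0).pt ≅ 𝟙_ T
  singleIso : ∀ i, (pow (Finsupp.single i 1)).pt ≅ (C i).pt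
  zeroIso_braider : ∀ X : T,
    (pow 0).R X ≫ (X ◁ zeroIso.hom) = (zeroIso.hom ▷ X) ≫ (λ_ X).hom ≫ (ρ_ X).inv
  singleIso_braider : ∀ i (X : T),
    (pow (Finsupp.single i 1)).R X ≫ (X ◁ (singleIso i).hom) =
      ((singleIso i).hom ▷ X) ≫ (C i).R X
  ξ_braider : ∀ {a b c : I →₀ ℕ} (h : a + b = c) (X : T),
    ((ξ h).hom ▷ X) ≫ (pow c).R X =
      (α_ _ _ _).hom ≫ ((pow a).pt ◁ (pow b).R X) ≫ (α_ _ _ _).inv ≫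
        ((pow a).R X ▷ (pow b).pt) ≫ (α_ _ _ _).hom ≫ (X ◁ (ξ h).hom)
  ξ_assoc : ∀ {a b c ab bc abc : I →₀ ℕ} (h₁ : a + b = ab) (h₂ : ab + c = abc)
    (h₃ : b + c = bc) (h₄ : a + bc = abc),
    ((ξ h₁).hom ▷ (pow c).pt) ≫ (ξ h₂).hom =
      (α_ _ _ _).hom ≫ ((pow a).pt ◁ (ξ h₃).hom) ≫ (ξ h₄).hom
  ξ_zero : (ξ (add_zero (0 : I →₀ ℕ))).hom ≫ zeroIso.hom =
    (zeroIso.hom ⊗ₘ zeroIso.hom) ≫ (λ_ (𝟙_ T)).hom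
  ξ_comm : ∀ (i j : I) {s : I →₀ ℕ}
    (h : Finsupp.single i 1 + Finsupp.single j 1 = s)
    (h' : Finsupp.single j 1 + Finsupp.single i 1 = s),
    (pow (Finsupp.single i 1)).R (pow (Finsupp.single j 1)).pt ≫ (ξ h').hom =
      ((η i j : kˣ) : k) • (ξ h).hom

namespace Powers

variable {C : I → Braider T} {η : I → I → kˣ} (P : Powers C η)

/-- `H_δ((X,α),(Y,β)) = Hom_T(C^{δ+α} ⊗ X, Y ⊗ C^{δ+β})`, with `a = δ + α` and `b = δ + β`. -/
abbrev Rep (X : T) (a : I →₀ ℕ) (Y : T) (b : I →₀ ℕ) : Type v :=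
  (P.pow a).pt ⊗ X ⟶ Y ⊗ (P.pow b).pt

/-- The transition map `ζ_{δ',δ}`, with `c = δ' - δ`, `a = δ + α`, `a' = δ' + α`, `b = δ + β`,
`b' = δ' + β`. -/
noncomputable def zeta {X Y : T} {a b a' b' c : I →₀ ℕ} (ha : c + a = a') (hb : c + b = b')
    (f : P.Rep X a Y b) : P.Rep X a' Y b' :=
  ((P.ξ ha).inv ▷ X) ⊗≫ ((P.pow c).pt ◁ f) ⊗≫
    ((P.pow c).R Y ▷ (P.pow b).pt) ⊗≫ (Y ◁ (P.ξ hb).hom)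

/-- A morphism of `T` seen in `H_{-α}((X,α),(Y,α)) = Hom_T(C^0 ⊗ X, Y ⊗ C^0)`. -/
noncomputable def ofHom {X Y : T} (f : X ⟶ Y) : P.Rep X 0 Y 0 :=
  (P.zeroIso.hom ▷ X) ≫ (λ_ X).hom ≫ f ≫ (ρ_ Y).inv ≫ (Y ◁ P.zeroIso.inv)

/-- The composition before rescaling: for `f ∈ H_δ((X,α),(Y,β))` and `g ∈ H_ε((Y,β),(Z,γ))`, where
`a = δ + α`, `b = δ + β`, `c = ε + β`, `d = ε + γ`. -/
noncomputable def preComp {X Y Z : T} {a b c d s t : I →₀ ℕ} (hs : c + a = s) (ht : d + b = t)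
    (f : P.Rep X a Y b) (g : P.Rep Y c Z d) : P.Rep X s Z t :=
  ((P.ξ hs).inv ▷ X) ⊗≫ ((P.pow c).pt ◁ f) ⊗≫ (g ▷ (P.pow b).pt) ⊗≫ (Z ◁ (P.ξ ht).hom)

/-- The tensor product before rescaling: for `f ∈ H_δ((X,α),(X',α'))` and
`g ∈ H_ε((Y,β),(Y',β'))`, where `a = δ + α`, `a' = δ + α'`, `b = ε + β`, `b' = ε + β'`. -/
noncomputable def preTensor {X X' Y Y' : T} {a a' b b' s s' : I →₀ ℕ} (hs : a + b = s)
    (hs' : a' + b' = s') (f : P.Rep X a X' a') (g : P.Rep Y b Y' b') :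
    P.Rep (X ⊗ Y) s (X' ⊗ Y') s' :=
  ((P.ξ hs).inv ▷ (X ⊗ Y)) ⊗≫ ((P.pow a).pt ◁ (P.pow b).R X ▷ Y) ⊗≫ (f ⊗ₘ g) ⊗≫
    (X' ◁ (P.pow a').R Y' ▷ (P.pow b').pt) ⊗≫ ((X' ⊗ Y') ◁ (P.ξ hs').hom)

end Powers

/-- `L`, with `Υ : T ⥤ L`, is the explicit localization attached to the powers `P`: its objects are
the pairs `(X, α) = obj X α` with `X ∈ T` and `α ∈ ℤ^{⊕I}`, its morphisms from `(X, α)` to `(Y, β)`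
are the inductive limit of the `k`-modules `H_δ = Hom_T(C^{δ+α} ⊗ X, Y ⊗ C^{δ+β})` over
`δ ∈ ℤ^{⊕I}` with `δ + α, δ + β ≥ 0`, the canonical map from `H_δ` being `ι δ`, and identities,
composition, tensor product and `Υ` are given on representatives.  In `ι δ` the exponents
`a = δ + α` and `b = δ + β` are elements of `ℤ_{≥0}^{⊕I}`. -/
structure IsExplicitModel {C : I → Braider T} {η : I → I → kˣ} (P : Powers C η)
    {L : Type u'} [Category.{v'} L] [MonoidalCategory L] [Preadditive L] [Linear k L]
    (Υ : T ⥤ L) (obj : T → (I →₀ ℤ) → L)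
    (ι : ∀ {X Y : T} {α β : I →₀ ℤ} (δ : I →₀ ℤ) {a b : I →₀ ℕ},
      toInt a = δ + α → toInt b = δ + β → P.Rep X a Y b → (obj X α ⟶ obj Y β)) : Prop where
  obj_bijective : Function.Bijective (fun p : T × (I →₀ ℤ) => obj p.1 p.2)
  ι_add : ∀ {X Y : T} {α β δ : I →₀ ℤ} {a b : I →₀ ℕ} (ha : toInt a = δ + α)
    (hb : toInt b = δ + β) (f g : P.Rep X a Y b), ι δ ha hb (f + g) = ι δ ha hb f + ι δ ha hb g
  ι_smul : ∀ {X Y : T} {α β δ : I →₀ ℤ} {a b : I →₀ ℕ} (ha : toInt a = δ + α)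
    (hb : toInt b = δ + β) (r : k) (f : P.Rep X a Y b), ι δ ha hb (r • f) = r • ι δ ha hb f
  ι_surjective : ∀ {X Y : T} {α β : I →₀ ℤ} (φ : obj X α ⟶ obj Y β),
    ∃ (δ : I →₀ ℤ) (a b : I →₀ ℕ) (ha : toInt a = δ + α) (hb : toInt b = δ + β)
      (f : P.Rep X a Y b), ι δ ha hb f = φ
  ι_eq_iff : ∀ {X Y : T} {α β δ₁ δ₂ : I →₀ ℤ} {a₁ b₁ a₂ b₂ : I →₀ ℕ}
    (ha₁ : toInt a₁ = δ₁ + α) (hb₁ : toInt b₁ = δ₁ + β)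
    (ha₂ : toInt a₂ = δ₂ + α) (hb₂ : toInt b₂ = δ₂ + β)
    (f₁ : P.Rep X a₁ Y b₁) (f₂ : P.Rep X a₂ Y b₂),
    ι δ₁ ha₁ hb₁ f₁ = ι δ₂ ha₂ hb₂ f₂ ↔
      ∃ (c₁ c₂ a b : I →₀ ℕ) (h₁ : c₁ + a₁ = a) (h₁' : c₁ + b₁ = b) (h₂ : c₂ + a₂ = a)
        (h₂' : c₂ + b₂ = b), toInt c₁ + δ₁ = toInt c₂ + δ₂ ∧
        P.zeta h₁ h₁' f₁ = P.zeta h₂ h₂' f₂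
  ι_id : ∀ (X : T) (α : I →₀ ℤ) (h : toInt (0 : I →₀ ℕ) = -α + α),
    𝟙 (obj X α) = ι (-α) h h (P.ofHom (𝟙 X))
  ι_comp : ∀ {X Y Z : T} {α β γ δ ε : I →₀ ℤ} {a b c d s t : I →₀ ℕ}
    (ha : toInt a = δ + α) (hb : toInt b = δ + β) (hc : toInt c = ε + β) (hd : toInt d = ε + γ)
    (hs : c + a = s) (ht : d + b = t)
    (hs' : toInt s = (δ + ε + β) + α) (ht' : toInt t = (δ + ε + β) + γ)
    (f : P.Rep X a Y b) (g : P.Rep Y c Z d),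
    ι δ ha hb f ≫ ι ε hc hd g =
      ι (δ + ε + β) hs' ht' (((biChar η (δ + β) (β - γ) : kˣ) : k) • P.preComp hs ht f g)
  obj_unit : 𝟙_ L = obj (𝟙_ T) 0
  obj_tensor : ∀ (X Y : T) (α β : I →₀ ℤ), obj X α ⊗ obj Y β = obj (X ⊗ Y) (α + β)
  ι_tensor : ∀ {X X' Y Y' : T} {α α' β β' δ ε : I →₀ ℤ} {a a' b b' s s' : I →₀ ℕ}
    (ha : toInt a = δ + α) (ha' : toInt a' = δ + α') (hb : toInt b = ε + β)
    (hb' : toInt b' = ε + β') (hs : a + b = s) (hs' : a' + b' = s')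
    (ht : toInt s = (δ + ε) + (α + β)) (ht' : toInt s' = (δ + ε) + (α' + β'))
    (f : P.Rep X a X' a') (g : P.Rep Y b Y' b'),
    ι δ ha ha' f ⊗ₘ ι ε hb hb' g =
      eqToHom (obj_tensor X Y α β) ≫
        ι (δ + ε) ht ht' (((biChar η ε (α - α') : kˣ) : k) • P.preTensor hs hs' f g) ≫
        eqToHom (obj_tensor X' Y' α' β').symm
  Υ_obj : ∀ X : T, Υ.obj X = obj X 0
  Υ_map : ∀ {X Y : T} (h : toInt (0 : I →₀ ℕ) = 0 + 0) (f : X ⟶ Y),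
    Υ.map f = eqToHom (Υ_obj X) ≫ ι 0 h h (P.ofHom f) ≫ eqToHom (Υ_obj Y).symm

end Powers

end BraiderLocalization

set_option linter.unusedSectionVars false

/-! The localization is a calculus of fractions in which the braidings `R_{C^c}(X)` become
representatives of identities. A morphism `(X,α) → (Y,β)` is represented by some `C^a ⊗ X ⟶ Y ⊗ C^b`
with `a + β = b + α`, which determines the index `δ = a - α`. Representatives compose associatively
without scalars (`CentralPowers.comp_assoc`), and the transition maps are composition with
`R_{C^c}(Y)` at the target. Enlarging the second factor of a composite is therefore harmless.
Enlarging the first forces `R_{C^c}` past the second factor, which costs a value of `κ` depending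
only on weights (`r_comp`, `zeta_comp`). The factors `η` in the composition and tensor laws
compensate exactly for this. Then `R_{C^a}(X)`, read in degree `(0,a)`, is an isomorphism `(C^a ⊗ X,
α) ≅ (X, a + α)` (`isoShiftLeft`). Hence `C^a` becomes `(1, a)`, with inverse `(1, -a)`, and every
`R_{C^a}(X)` becomes invertible.

The powers `C^a` are tensor products of words in the `C_i`, compared through the normalized
braidings `η_{ij}⁻¹ R_{C_i}(C_j)`. These are involutive, satisfy the Yang-Baxter equation and are
trivial on equal letters. Consequently insertion sort is compatible with every rearrangement of
letters (`pre_normalForm`), and two rearrangements with the same source and target agree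
(`perm_unique`). All coherence of the `ξ` follows.

Uniqueness of the factorization: every object of the localization comes from `T` after tensoring
with some `C^b`, which is invertible, so a monoidal isomorphism given on `T` has forced components.
The property `IsGood` singles them out and yields naturality and monoidality.

Existence: let `H : T ⥤ S` satisfy the two conditions. Objects of `S` need not commute with
`H(C^a)`, and `S` need not be linear. Let `Z` be the category of objects of `S` with half braidings
against all `H(C^a)`. The functor `H` lifts to `Z`, and there the `H(C^a)` are again a system of
powers. By functoriality of the construction `Loc P` maps to the localization of `Z`. Since the
powers are already invertible in `Z` with invertible braidings, `Z` is equivalent to its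
localization (`isEquivalence_functor`), and one returns to `Z` and forgets to `S`. The category `Z`
only carries an action of `k^×` through endomorphisms of the unit, which is why the construction is
made for a group `K` of scalars acting on morphisms; addition is treated separately. -/

namespace BraiderLocalization

/-! ### Systems of powers and composition of representatives -/

/-- An action of a group of scalars on the morphisms of a monoidal category, compatible with
composition and tensor products. -/
class ScalarCat (K : Type x) [CommGroup K] (T : Type u) [Category.{v} T] [MonoidalCategory T]
    [∀ X Y : T, MulAction K (X ⟶ Y)] : Prop where
  smul_comp : ∀ {X Y Z : T} (r : K) (f : X ⟶ Y) (g : Y ⟶ Z), (r • f) ≫ g = r • (f ≫ g)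
  comp_smul : ∀ {X Y Z : T} (f : X ⟶ Y) (r : K) (g : Y ⟶ Z), f ≫ (r • g) = r • (f ≫ g)
  whiskerLeft_smul : ∀ (X : T) {Y Z : T} (r : K) (f : Y ⟶ Z), X ◁ (r • f) = r • (X ◁ f)
  smul_whiskerRight : ∀ (X : T) {Y Z : T} (r : K) (f : Y ⟶ Z), (r • f) ▷ X = r • (f ▷ X)

/-- A system of braiders `C^a`, indexed by a commutative monoid `M` embedded in a group `G` that it
generates, multiplicative in `a` and commuting with each other up to a bimultiplicative `κ`. -/
structure CentralPowers (K : Type x) [CommGroup K] (T : Type u) [Category.{v} T]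
    [MonoidalCategory T] [∀ X Y : T, MulAction K (X ⟶ Y)]
    (M : Type w) [AddCommMonoid M] (G : Type w) [AddCommGroup G] where
  deg : M →+ G
  deg_injective : Function.Injective deg
  exists_deg_eq : ∀ γ : G, ∃ a b : M, deg a = deg b + γ
  κ : G → G → K
  κ_add_left : ∀ α β γ, κ (α + β) γ = κ α γ * κ β γ
  κ_add_right : ∀ α β γ, κ α (β + γ) = κ α β * κ α γ
  pow : M → Braider T
  ξ : ∀ {a b c : M}, a + b = c → ((pow a).pt ⊗ (pow b).pt ≅ (pow c).pt)
  zeroIso : (pow 0).pt ≅ 𝟙_ T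
  zeroIso_braider : ∀ X : T,
    (pow 0).R X ≫ (X ◁ zeroIso.hom) = (zeroIso.hom ▷ X) ≫ (λ_ X).hom ≫ (ρ_ X).inv
  ξ_braider : ∀ {a b c : M} (h : a + b = c) (X : T),
    ((ξ h).hom ▷ X) ≫ (pow c).R X =
      (α_ _ _ _).hom ≫ ((pow a).pt ◁ (pow b).R X) ≫ (α_ _ _ _).inv ≫
        ((pow a).R X ▷ (pow b).pt) ≫ (α_ _ _ _).hom ≫ (X ◁ (ξ h).hom)
  ξ_assoc : ∀ {a b c ab bc abc : M} (h₁ : a + b = ab) (h₂ : ab + c = abc)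
    (h₃ : b + c = bc) (h₄ : a + bc = abc),
    ((ξ h₁).hom ▷ (pow c).pt) ≫ (ξ h₂).hom =
      (α_ _ _ _).hom ≫ ((pow a).pt ◁ (ξ h₃).hom) ≫ (ξ h₄).hom
  ξ_zero : (ξ (add_zero (0 : M))).hom ≫ zeroIso.hom =
    (zeroIso.hom ⊗ₘ zeroIso.hom) ≫ (λ_ (𝟙_ T)).hom
  comm : ∀ {a b c : M} (h : a + b = c) (h' : b + a = c),
    (pow a).R (pow b).pt ≫ (ξ h').hom = κ (deg a) (deg b) • (ξ h).hom

namespace CentralPowers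

variable {K : Type x} [CommGroup K] {T : Type u} [Category.{v} T] [MonoidalCategory T]
  [∀ X Y : T, MulAction K (X ⟶ Y)] {M : Type w} [AddCommMonoid M] {G : Type w} [AddCommGroup G]
  (P : CentralPowers K T M G)

/-- The object `C^a`. -/
abbrev C (a : M) : T := (P.pow a).pt

/-- The morphisms `C^a ⊗ X ⟶ Y ⊗ C^b`. -/
abbrev Rep (X : T) (a : M) (Y : T) (b : M) : Type v := P.C a ⊗ X ⟶ Y ⊗ P.C b

lemma ξ_assoc_inv {a b c ab bc abc : M} (h₁ : a + b = ab) (h₂ : ab + c = abc)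
    (h₃ : b + c = bc) (h₄ : a + bc = abc) :
    (P.ξ h₂).inv ≫ ((P.ξ h₁).inv ▷ P.C c) =
      (P.ξ h₄).inv ≫ (P.C a ◁ (P.ξ h₃).inv) ≫ (α_ _ _ _).inv := by
  have : whiskerRightIso (P.ξ h₁) _ ≪≫ P.ξ h₂ =
      α_ _ _ _ ≪≫ whiskerLeftIso _ (P.ξ h₃) ≪≫ P.ξ h₄ := Iso.ext (P.ξ_assoc h₁ h₂ h₃ h₄)
  simpa using congrArg Iso.inv this

/-- The composite of representatives. -/
def comp {X Y Z : T} {a b c d s t : M} (hs : c + a = s) (ht : d + b = t)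
    (f : P.Rep X a Y b) (g : P.Rep Y c Z d) : P.Rep X s Z t :=
  ((P.ξ hs).inv ▷ X) ⊗≫ (P.C c ◁ f) ⊗≫ (g ▷ P.C b) ⊗≫ (Z ◁ (P.ξ ht).hom)

/-- Only interchange and the associativity of `ξ` intervene: no two powers are exchanged, so no
scalar appears. -/
lemma comp_assoc {X Y Z W : T} {a b c d p q s t s' t' m n : M}
    (hs : c + a = s) (ht : d + b = t) (hs' : p + c = s') (ht' : q + d = t')
    (hm : p + s = m) (hn : q + t = n) (hm' : s' + a = m) (hn' : t' + b = n)
    (f : P.Rep X a Y b) (g : P.Rep Y c Z d) (h : P.Rep Z p W q) :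
    P.comp hm hn (P.comp hs ht f g) h = P.comp hm' hn' f (P.comp hs' ht' g h) := by
  calc P.comp hm hn (P.comp hs ht f g) h
      = ((P.ξ hm).inv ▷ X) ⊗≫ (P.C p ◁ (P.ξ hs).inv ▷ X) ⊗≫ (P.C p ◁ P.C c ◁ f) ⊗≫
          (P.C p ◁ g ▷ P.C b) ⊗≫ ((P.C p ⊗ Z) ◁ (P.ξ ht).hom ≫ h ▷ P.C t) ⊗≫
            W ◁ (P.ξ hn).hom := by
        simp only [comp]; monoidal
    _ = ((P.ξ hm).inv ▷ X) ⊗≫ (P.C p ◁ (P.ξ hs).inv ▷ X) ⊗≫ (P.C p ◁ P.C c ◁ f) ⊗≫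
          (P.C p ◁ g ▷ P.C b) ⊗≫ (h ▷ (P.C d ⊗ P.C b) ≫ (W ⊗ P.C q) ◁ (P.ξ ht).hom) ⊗≫
            W ◁ (P.ξ hn).hom := by
        rw [whisker_exchange]
    _ = ((P.ξ hm).inv ≫ (P.C p ◁ (P.ξ hs).inv) ≫ (α_ _ _ _).inv) ▷ X ⊗≫
          ((P.C p ⊗ P.C c) ◁ f) ⊗≫
          (P.C p ◁ g ▷ P.C b) ⊗≫ h ▷ (P.C d ⊗ P.C b) ⊗≫ W ◁ ((α_ _ _ _).hom ≫ (P.C q ◁ (P.ξ ht).hom) ≫ (P.ξ hn).hom) := by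
        monoidal
    _ = ((P.ξ hm').inv ≫ ((P.ξ hs').inv ▷ P.C a)) ▷ X ⊗≫
          ((P.C p ⊗ P.C c) ◁ f) ⊗≫
          (P.C p ◁ g ▷ P.C b) ⊗≫ h ▷ (P.C d ⊗ P.C b) ⊗≫ W ◁ (((P.ξ ht').hom ▷ P.C b) ≫ (P.ξ hn').hom) := by
        rw [P.ξ_assoc_inv hs' hm' hs hm, P.ξ_assoc ht' hn' ht hn]
    _ = (P.ξ hm').inv ▷ X ⊗≫ ((P.ξ hs').inv ▷ (P.C a ⊗ X) ≫
          ((P.C p ⊗ P.C c) ◁ f)) ⊗≫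
          (P.C p ◁ g ▷ P.C b) ⊗≫ h ▷ (P.C d ⊗ P.C b) ⊗≫ W ◁ (((P.ξ ht').hom ▷ P.C b) ≫ (P.ξ hn').hom) := by
        monoidal
    _ = _ := by
        rw [← whisker_exchange]
        simp only [comp]; monoidal

end CentralPowers
end BraiderLocalization

/-! ### Units, braidings, whiskering and exchange scalars for representatives -/

namespace BraiderLocalization

/-- Serves to check identities about `ξ_{0,a}` after tensoring with `C^0 ≅ 1`. -/
lemma whiskerLeft_injective_of_iso {T : Type u} [Category.{v} T] [MonoidalCategory T] {A : T}
    (e : A ≅ 𝟙_ T) {X Y : T} {f g : X ⟶ Y} (h : A ◁ f = A ◁ g) : f = g := by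
  have : 𝟙_ T ◁ f = 𝟙_ T ◁ g := by
    rw [← cancel_epi (e.hom ▷ X), ← whisker_exchange, h, whisker_exchange]
  simpa using this

lemma whiskerRight_injective_of_iso {T : Type u} [Category.{v} T] [MonoidalCategory T] {A : T}
    (e : A ≅ 𝟙_ T) {X Y : T} {f g : X ⟶ Y} (h : f ▷ A = g ▷ A) : f = g := by
  have : f ▷ 𝟙_ T = g ▷ 𝟙_ T := by
    rw [← cancel_epi (X ◁ e.hom), whisker_exchange, h, whisker_exchange]
  simpa using this

namespace CentralPowers

variable {K : Type x} [CommGroup K] {T : Type u} [Category.{v} T] [MonoidalCategory T]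
  [∀ X Y : T, MulAction K (X ⟶ Y)] {M : Type w} [AddCommMonoid M] {G : Type w} [AddCommGroup G]
  (P : CentralPowers K T M G)

lemma ξ_zero_zero (h : (0 : M) + 0 = 0) :
    (P.ξ h).hom = P.C 0 ◁ P.zeroIso.hom ≫ (ρ_ _).hom := by
  rw [← cancel_mono P.zeroIso.hom, P.ξ_zero, Category.assoc, ← rightUnitor_naturality,
    tensorHom_def']
  simp [unitors_equal]

/-- The usual unit argument: in the associativity of `ξ` on `C^0 ⊗ C^0 ⊗ C^a` the isomorphism
`ξ_{0,a}` cancels, and `ξ_{0,0}` is known. -/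
lemma ξ_zero_left {a : M} (h : 0 + a = a) :
    (P.ξ h).hom = P.zeroIso.hom ▷ P.C a ≫ (λ_ _).hom := by
  apply whiskerLeft_injective_of_iso P.zeroIso
  have := P.ξ_assoc (add_zero (0 : M)) h h h
  rw [← Category.assoc, cancel_mono, ξ_zero_zero] at this
  rw [← cancel_epi (α_ _ _ _).hom, ← this]
  simp

lemma ξ_zero_right {a : M} (h : a + 0 = a) :
    (P.ξ h).hom = P.C a ◁ P.zeroIso.hom ≫ (ρ_ _).hom := by
  apply whiskerRight_injective_of_iso P.zeroIso
  have := P.ξ_assoc h h (add_zero (0 : M)) h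
  rw [← Category.assoc, cancel_mono, ξ_zero_zero] at this
  have e : (P.C 0 ◁ P.zeroIso.hom ≫ (ρ_ _).hom) = P.zeroIso.hom ▷ P.C 0 ≫ (λ_ _).hom := by
    rw [← cancel_mono P.zeroIso.hom, Category.assoc, Category.assoc, ← rightUnitor_naturality,
      ← leftUnitor_naturality, whisker_exchange_assoc, unitors_equal]
  rw [this, e]
  simp

lemma ξ_zero_left_inv {a : M} (h : 0 + a = a) :
    (P.ξ h).inv = (λ_ _).inv ≫ P.zeroIso.inv ▷ P.C a := by
  rw [← cancel_epi (P.ξ h).hom, Iso.hom_inv_id, ξ_zero_left]; simp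

lemma ξ_zero_right_inv {a : M} (h : a + 0 = a) :
    (P.ξ h).inv = (ρ_ _).inv ≫ P.C a ◁ P.zeroIso.inv := by
  rw [← cancel_epi (P.ξ h).hom, Iso.hom_inv_id, ξ_zero_right]; simp

/-- A morphism of `T` as a representative of degree zero. -/
def ofHom {X Y : T} (f : X ⟶ Y) : P.Rep X 0 Y 0 :=
  (P.zeroIso.hom ▷ X) ≫ (λ_ X).hom ≫ f ≫ (ρ_ Y).inv ≫ (Y ◁ P.zeroIso.inv)

lemma ofHom_comp_rep {X Y Z : T} {c d : M} (hs : c + 0 = c) (ht : d + 0 = d) (u : X ⟶ Y)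
    (g : P.Rep Y c Z d) : P.comp hs ht (P.ofHom u) g = P.C c ◁ u ≫ g := by
  calc P.comp hs ht (P.ofHom u) g
      = 𝟙 (P.C c ⊗ X) ⊗≫ (P.C c ◁ (P.zeroIso.inv ≫ P.zeroIso.hom)) ▷ X ⊗≫ P.C c ◁ u ⊗≫
          ((P.C c ⊗ Y) ◁ P.zeroIso.inv ≫ g ▷ P.C 0) ⊗≫ Z ◁ (P.C d ◁ P.zeroIso.hom) ⊗≫ 𝟙 (Z ⊗ P.C d) := by
        simp only [comp, ofHom, ξ_zero_right, ξ_zero_right_inv]; monoidal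
    _ = 𝟙 (P.C c ⊗ X) ⊗≫ (P.C c ◁ (P.zeroIso.inv ≫ P.zeroIso.hom)) ▷ X ⊗≫ P.C c ◁ u ⊗≫ g ⊗≫
          Z ◁ (P.C d ◁ (P.zeroIso.inv ≫ P.zeroIso.hom)) ⊗≫ 𝟙 (Z ⊗ P.C d) := by
        rw [whisker_exchange]; monoidal
    _ = _ := by rw [Iso.inv_hom_id]; monoidal

lemma rep_comp_ofHom {X Y Z : T} {a b : M} (hs : 0 + a = a) (ht : 0 + b = b)
    (f : P.Rep X a Y b) (u : Y ⟶ Z) : P.comp hs ht f (P.ofHom u) = f ≫ u ▷ P.C b := by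
  calc P.comp hs ht f (P.ofHom u)
      = 𝟙 _ ⊗≫ P.zeroIso.inv ▷ (P.C a ⊗ X) ⊗≫ (P.C 0 ◁ f ≫ P.zeroIso.hom ▷ (Y ⊗ P.C b)) ⊗≫
          u ▷ P.C b ⊗≫
          Z ◁ ((P.zeroIso.inv ≫ P.zeroIso.hom) ▷ P.C b) ⊗≫ 𝟙 _ := by
        simp only [comp, ofHom, ξ_zero_left, ξ_zero_left_inv]; monoidal
    _ = 𝟙 _ ⊗≫ (P.zeroIso.inv ≫ P.zeroIso.hom) ▷ (P.C a ⊗ X) ⊗≫ f ⊗≫ u ▷ P.C b ⊗≫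
          Z ◁ ((P.zeroIso.inv ≫ P.zeroIso.hom) ▷ P.C b) ⊗≫ 𝟙 _ := by
        rw [whisker_exchange]; monoidal
    _ = _ := by rw [Iso.inv_hom_id]; monoidal

/-- The braiding `R_{C^c}(X)` as a representative of degree `(c, c)`. -/
abbrev r (c : M) (X : T) : P.Rep X c X c := (P.pow c).R X

lemma r_zero (X : T) : P.r 0 X = P.ofHom (𝟙 X) := by
  rw [← cancel_mono (X ◁ P.zeroIso.hom), zeroIso_braider]
  simp [ofHom]

/-- With `r_zero`, the braidings of `X` form a multiplicative system of representatives, indexed by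
`M`; this is the system turned into identities. -/
lemma r_comp_r {a c s : M} (hs : c + a = s) (X : T) :
    P.comp hs hs (P.r a X) (P.r c X) = P.r s X := by
  rw [← cancel_epi ((P.ξ hs).hom ▷ X), r, P.ξ_braider hs]
  simp [comp, monoidalComp]

/-- Left whiskering of representatives. -/
def whiskerL (X : T) {Y Y' : T} {b b' : M} (g : P.Rep Y b Y' b') :
    P.Rep (X ⊗ Y) b (X ⊗ Y') b' :=
  (α_ _ _ _).inv ≫ (P.r b X ▷ Y) ≫ (α_ _ _ _).hom ≫ X ◁ g ≫ (α_ _ _ _).inv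

/-- Right whiskering of representatives. -/
def whiskerR {X X' : T} {a a' : M} (f : P.Rep X a X' a') (Y : T) :
    P.Rep (X ⊗ Y) a (X' ⊗ Y) a' :=
  (α_ _ _ _).inv ≫ f ▷ Y ≫ (α_ _ _ _).hom ≫ X' ◁ P.r a' Y ≫ (α_ _ _ _).inv

/-- The tensor axiom of a braider, read as: whiskering preserves representatives of identities. This
is why whiskering passes to classes. -/
lemma whiskerL_r (X Y : T) (c : M) : P.whiskerL X (P.r c Y) = P.r c (X ⊗ Y) :=
  ((P.pow c).tensor X Y).symm

lemma whiskerR_r (X Y : T) (c : M) : P.whiskerR (P.r c X) Y = P.r c (X ⊗ Y) :=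
  ((P.pow c).tensor X Y).symm

lemma whiskerL_ofHom (X : T) {Y Y' : T} (g : Y ⟶ Y') :
    P.whiskerL X (P.ofHom g) = P.ofHom (X ◁ g) := by
  simp [whiskerL, r_zero, ofHom]

lemma whiskerR_ofHom {X X' : T} (f : X ⟶ X') (Y : T) :
    P.whiskerR (P.ofHom f) Y = P.ofHom (f ▷ Y) := by
  simp [whiskerR, r_zero, ofHom]

lemma r_comp_ξ_inv {a b c : M} (h : a + b = c) (X : T) :
    P.r c X ≫ X ◁ (P.ξ h).inv = (P.ξ h).inv ▷ X ≫ (α_ _ _ _).hom ≫ (P.C a ◁ P.r b X) ≫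
      (α_ _ _ _).inv ≫ (P.r a X ▷ P.C b) ≫ (α_ _ _ _).hom := by
  rw [← cancel_epi ((P.ξ h).hom ▷ X), reassoc_of% P.ξ_braider h X]
  simp

/-- By multiplicativity of the braiding in the exponent, `C^a` and `C^c` cross `X` separately;
interchange then lets `f` act before `C^c` crosses. -/
lemma whiskerL_comp (X : T) {Y Y' Y'' : T} {a b c d s t : M} (hs : c + a = s) (ht : d + b = t)
    (f : P.Rep Y a Y' b) (g : P.Rep Y' c Y'' d) :
    P.whiskerL X (P.comp hs ht f g) = P.comp hs ht (P.whiskerL X f) (P.whiskerL X g) := by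
  calc P.whiskerL X (P.comp hs ht f g)
      = 𝟙 _ ⊗≫ (P.r s X ≫ X ◁ (P.ξ hs).inv) ▷ Y ⊗≫ X ◁ P.C c ◁ f ⊗≫ X ◁ g ▷ P.C b ⊗≫
          (X ⊗ Y'') ◁ (P.ξ ht).hom := by
        simp only [whiskerL, comp]; monoidal
    _ = (P.ξ hs).inv ▷ (X ⊗ Y) ⊗≫ P.C c ◁ P.r a X ▷ Y ⊗≫
          (P.r c X ▷ (P.C a ⊗ Y) ≫ (X ⊗ P.C c) ◁ f) ⊗≫ X ◁ g ▷ P.C b ⊗≫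
          (X ⊗ Y'') ◁ (P.ξ ht).hom := by
        rw [r_comp_ξ_inv]; monoidal
    _ = _ := by
        rw [← whisker_exchange]; simp only [whiskerL, comp]; monoidal

lemma whiskerR_comp {X X' X'' : T} {a b c d s t : M} (hs : c + a = s) (ht : d + b = t)
    (f : P.Rep X a X' b) (g : P.Rep X' c X'' d) (Y : T) :
    P.whiskerR (P.comp hs ht f g) Y = P.comp hs ht (P.whiskerR f Y) (P.whiskerR g Y) := by
  calc P.whiskerR (P.comp hs ht f g) Y
      = (P.ξ hs).inv ▷ (X ⊗ Y) ⊗≫ P.C c ◁ f ▷ Y ⊗≫ g ▷ P.C b ▷ Y ⊗≫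
          X'' ◁ ((P.ξ ht).hom ▷ Y ≫ P.r t Y) ⊗≫ 𝟙 _ := by
        simp only [whiskerR, comp]; monoidal
    _ = (P.ξ hs).inv ▷ (X ⊗ Y) ⊗≫ P.C c ◁ f ▷ Y ⊗≫ (g ▷ (P.C b ⊗ Y) ≫
          (X'' ⊗ P.C d) ◁ P.r b Y) ⊗≫ X'' ◁ P.r d Y ▷ P.C b ⊗≫ X'' ◁ Y ◁ (P.ξ ht).hom ⊗≫ 𝟙 _ := by
        rw [r, P.ξ_braider ht]; monoidal
    _ = _ := by
        rw [← whisker_exchange]; simp only [whiskerR, comp]; monoidal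

lemma whiskerL_tensor (X Y : T) {Z Z' : T} {a b : M} (f : P.Rep Z a Z' b) :
    P.whiskerL (X ⊗ Y) f ≫ (α_ X Y Z').hom ▷ P.C b =
      P.C a ◁ (α_ X Y Z).hom ≫ P.whiskerL X (P.whiskerL Y f) := by
  have := (P.pow a).tensor X Y
  simp only [whiskerL, r, this]; monoidal

lemma whiskerR_tensor {X X' : T} (Y Z : T) {a b : M} (f : P.Rep X a X' b) :
    P.whiskerR (P.whiskerR f Y) Z ≫ (α_ X' Y Z).hom ▷ P.C b =
      P.C a ◁ (α_ X Y Z).hom ≫ P.whiskerR f (Y ⊗ Z) := by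
  have := (P.pow b).tensor Y Z
  simp only [whiskerR, r, this]; monoidal

lemma whiskerR_whiskerL (X : T) {Y Y' : T} (Z : T) {a b : M} (f : P.Rep Y a Y' b) :
    P.whiskerR (P.whiskerL X f) Z ≫ (α_ X Y' Z).hom ▷ P.C b =
      P.C a ◁ (α_ X Y Z).hom ≫ P.whiskerL X (P.whiskerR f Z) := by
  simp only [whiskerR, whiskerL]; monoidal

lemma r_unit (c : M) : P.r c (𝟙_ T) = (ρ_ _).hom ≫ (λ_ _).inv := by
  rw [← (P.pow c).unit]; simp

lemma whiskerL_unit {X Y : T} {a b : M} (f : P.Rep X a Y b) :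
    P.whiskerL (𝟙_ T) f ≫ (λ_ Y).hom ▷ P.C b = P.C a ◁ (λ_ X).hom ≫ f := by
  simp only [whiskerL, r_unit]; monoidal

lemma whiskerR_unit {X Y : T} {a b : M} (f : P.Rep X a Y b) :
    P.whiskerR f (𝟙_ T) ≫ (ρ_ Y).hom ▷ P.C b = P.C a ◁ (ρ_ X).hom ≫ f := by
  simp only [whiskerR, r_unit]; monoidal

variable [ScalarCat K T]

lemma smul_comp_rep {X Y Z : T} {a b c d s t : M} (hs : c + a = s) (ht : d + b = t) (l : K)
    (f : P.Rep X a Y b) (g : P.Rep Y c Z d) :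
    P.comp hs ht (l • f) g = l • P.comp hs ht f g := by
  simp only [comp, monoidalComp, ScalarCat.smul_comp, ScalarCat.comp_smul,
    ScalarCat.whiskerLeft_smul]

lemma rep_comp_smul {X Y Z : T} {a b c d s t : M} (hs : c + a = s) (ht : d + b = t) (l : K)
    (f : P.Rep X a Y b) (g : P.Rep Y c Z d) :
    P.comp hs ht f (l • g) = l • P.comp hs ht f g := by
  simp only [comp, monoidalComp, ScalarCat.smul_comp, ScalarCat.comp_smul,
    ScalarCat.smul_whiskerRight]

lemma whiskerL_smul (X : T) {Y Y' : T} {b b' : M} (l : K) (g : P.Rep Y b Y' b') :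
    P.whiskerL X (l • g) = l • P.whiskerL X g := by
  simp only [whiskerL, ScalarCat.smul_comp, ScalarCat.comp_smul, ScalarCat.whiskerLeft_smul]

lemma whiskerR_smul {X X' : T} {a a' : M} (l : K) (f : P.Rep X a X' a') (Y : T) :
    P.whiskerR (l • f) Y = l • P.whiskerR f Y := by
  simp only [whiskerR, ScalarCat.smul_comp, ScalarCat.comp_smul, ScalarCat.smul_whiskerRight]

/-- The scalar by which `C^a` and `C^b` commute. -/
def k (a b : M) : K := P.κ (P.deg a) (P.deg b)

lemma ξ_inv_comp_R {a b c : M} (h : a + b = c) (h' : b + a = c) :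
    (P.ξ h).inv ≫ (P.pow a).R (P.C b) = P.k a b • (P.ξ h').inv := by
  rw [← cancel_mono (P.ξ h').hom, Category.assoc, P.comm h h', ScalarCat.comp_smul,
    ScalarCat.smul_comp]
  simp [k]

/-- Up to a scalar, each braiding is the passage between the two factorizations `ξ_{a,b}` and
`ξ_{b,a}` of one power, so the two braidings undo each other up to the product of the scalars. -/
lemma R_comp_R (a b : M) :
    (P.pow a).R (P.C b) ≫ (P.pow b).R (P.C a) = (P.k a b * P.k b a) • 𝟙 (P.C a ⊗ P.C b) := by
  rw [← cancel_epi (P.ξ rfl).inv, ← Category.assoc, P.ξ_inv_comp_R rfl (add_comm b a),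
    ScalarCat.smul_comp, P.ξ_inv_comp_R (add_comm b a) rfl, ScalarCat.comp_smul, smul_smul]
  simp

/-- Representatives commute with the braiding up to a scalar. -/
lemma comp_r {X Y : T} {a b c s t : M} (hs : c + a = s) (ht : c + b = t) (hs' : a + c = s)
    (ht' : b + c = t) (f : P.Rep X a Y b) :
    P.k c b • P.comp hs ht f (P.r c Y) = P.k c a • P.comp hs' ht' (P.r c X) f := by
  have e : P.comp hs ht f (P.r c Y) = (P.ξ hs).inv ▷ X ⊗≫ P.C c ◁ f ⊗≫
      P.r c Y ▷ P.C b ⊗≫ Y ◁ (P.ξ ht).hom := rfl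
  have e' : P.k c b • P.comp hs ht f (P.r c Y) = (P.ξ hs).inv ▷ X ⊗≫ P.C c ◁ f ⊗≫
      P.r c Y ▷ P.C b ⊗≫ Y ◁ (P.k c b • (P.ξ ht).hom) := by
    simp only [comp, monoidalComp, ScalarCat.comp_smul, ScalarCat.whiskerLeft_smul]
  rw [e', k, ← P.comm ht ht']
  -- `R_{C^c}` is natural with respect to `f` itself. By the tensor axiom both sides split off
  -- `R_{C^c}(C^a)` or `R_{C^c}(C^b)`, which are scalars modulo `ξ`.
  have n := (P.pow c).naturality f
  rw [(P.pow c).tensor, (P.pow c).tensor] at n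
  calc _ = (P.ξ hs).inv ▷ X ⊗≫ (P.C c ◁ f ≫ (α_ _ _ _).inv ≫ ((P.pow c).R Y ▷ P.C b) ≫
            (α_ _ _ _).hom ≫ (Y ◁ (P.pow c).R (P.C b)) ≫ (α_ _ _ _).inv) ⊗≫
            Y ◁ (P.ξ ht').hom := by monoidal
    _ = ((P.ξ hs).inv ≫ (P.pow c).R (P.C a)) ▷ X ⊗≫ P.C a ◁ (P.pow c).R X ⊗≫ f ▷ P.C c ⊗≫
            Y ◁ (P.ξ ht').hom := by rw [n]; monoidal
    _ = _ := by
      rw [P.ξ_inv_comp_R hs hs']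
      simp only [comp, monoidalComp, ScalarCat.smul_comp, ScalarCat.smul_whiskerRight]

/-- The two composites of a left and a right whiskering agree up to a scalar. -/
lemma whisker_exchange_rep {X X' Y Y' : T} {a a' b b' s t : M} (hs : b + a = s) (ht : b' + a' = t)
    (hs' : a + b = s) (ht' : a' + b' = t) (f : P.Rep X a X' a') (g : P.Rep Y b Y' b') :
    (P.k b a' * P.k a' b) • P.comp hs ht (P.whiskerR f Y) (P.whiskerL X' g) =
      (P.k b a * P.k a' b') • P.comp hs' ht' (P.whiskerL X g) (P.whiskerR f Y') := by
  have n := (P.pow b).naturality f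
  rw [(P.pow b).tensor, (P.pow b).tensor] at n
  have n' := (P.pow a').naturality g
  rw [(P.pow a').tensor, (P.pow a').tensor] at n'
  calc (P.k b a' * P.k a' b) • P.comp hs ht (P.whiskerR f Y) (P.whiskerL X' g)
      = (P.k b a' * P.k a' b) • ((P.ξ hs).inv ▷ (X ⊗ Y) ⊗≫ P.C b ◁ f ▷ Y ⊗≫
          (P.C b ◁ X' ◁ P.r a' Y ⊗≫ P.r b X' ▷ (Y ⊗ P.C a')) ⊗≫
          X' ◁ g ▷ P.C a' ⊗≫ (X' ⊗ Y') ◁ (P.ξ ht).hom) := by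
        congr 1
        simp only [comp, whiskerL, whiskerR]; monoidal
    _ = (P.k b a' * P.k a' b) • ((P.ξ hs).inv ▷ (X ⊗ Y) ⊗≫ P.C b ◁ f ▷ Y ⊗≫
          ((P.C b ⊗ X') ◁ P.r a' Y ≫ P.r b X' ▷ (Y ⊗ P.C a')) ⊗≫
          X' ◁ g ▷ P.C a' ⊗≫ (X' ⊗ Y') ◁ (P.ξ ht).hom) := by
        congr 1; monoidal
    _ = (P.k b a' * P.k a' b) • ((P.ξ hs).inv ▷ (X ⊗ Y) ⊗≫ P.C b ◁ f ▷ Y ⊗≫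
          P.r b X' ▷ (P.C a' ⊗ Y) ⊗≫ X' ◁ (𝟙 (P.C b ⊗ P.C a')) ▷ Y ⊗≫
          X' ◁ P.C b ◁ P.r a' Y ⊗≫
          X' ◁ g ▷ P.C a' ⊗≫ (X' ⊗ Y') ◁ (P.ξ ht).hom) := by
        rw [whisker_exchange]; congr 1; monoidal
    _ = (P.ξ hs).inv ▷ (X ⊗ Y) ⊗≫ P.C b ◁ f ▷ Y ⊗≫
          P.r b X' ▷ (P.C a' ⊗ Y) ⊗≫
          X' ◁ ((P.pow b).R (P.C a') ≫ (P.pow a').R (P.C b)) ▷ Y ⊗≫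
          X' ◁ P.C b ◁ P.r a' Y ⊗≫
          X' ◁ g ▷ P.C a' ⊗≫ (X' ⊗ Y') ◁ (P.ξ ht).hom := by
        -- The scalar is traded for a double braiding of `C^b` with `C^{a'}`: one half lets
        -- `R_{C^b}` pass `f` by naturality, the other lets `R_{C^{a'}}` pass `g`.
        rw [R_comp_R]
        simp only [monoidalComp, ScalarCat.smul_comp, ScalarCat.comp_smul,
          ScalarCat.smul_whiskerRight, ScalarCat.whiskerLeft_smul]
    _ = (P.ξ hs).inv ▷ (X ⊗ Y) ⊗≫ (P.C b ◁ f ≫ (α_ _ _ _).inv ≫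
          (P.r b X' ▷ P.C a') ≫ (α_ _ _ _).hom ≫
          (X' ◁ (P.pow b).R (P.C a')) ≫ (α_ _ _ _).inv) ▷ Y ⊗≫
          X' ◁ (((α_ _ _ _).inv ≫ (P.pow a').R (P.C b) ▷ Y ≫ (α_ _ _ _).hom ≫
            P.C b ◁ P.r a' Y ≫ (α_ _ _ _).inv) ≫ g ▷ P.C a') ⊗≫
          (X' ⊗ Y') ◁ (P.ξ ht).hom := by monoidal
    _ = ((P.ξ hs).inv ≫ (P.pow b).R (P.C a)) ▷ (X ⊗ Y) ⊗≫ P.C a ◁ P.r b X ▷ Y ⊗≫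
          (f ▷ (P.C b ⊗ Y) ≫ (X' ⊗ P.C a') ◁ g) ⊗≫ X' ◁ P.r a' Y' ▷ P.C b' ⊗≫
          (X' ⊗ Y') ◁ ((P.pow a').R (P.C b') ≫ (P.ξ ht).hom) := by
        rw [n, ← n']; monoidal
    _ = (P.k b a * P.k a' b') • ((P.ξ hs').inv ▷ (X ⊗ Y) ⊗≫ P.C a ◁ P.r b X ▷ Y ⊗≫
          ((P.C a ⊗ X) ◁ g ≫ f ▷ (Y' ⊗ P.C b')) ⊗≫ X' ◁ P.r a' Y' ▷ P.C b' ⊗≫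
          (X' ⊗ Y') ◁ (P.ξ ht').hom) := by
        rw [← whisker_exchange, P.ξ_inv_comp_R hs hs', P.comm ht' ht]
        simp only [monoidalComp, ScalarCat.smul_comp, ScalarCat.comp_smul,
          ScalarCat.smul_whiskerRight, ScalarCat.whiskerLeft_smul, smul_smul, k]
        rw [mul_comm]
    _ = _ := by
        congr 1
        simp only [comp, whiskerL, whiskerR]; monoidal

end CentralPowers
end BraiderLocalization

/-! ### Transition maps and the localized category -/

namespace BraiderLocalization

namespace CentralPowers

variable {K : Type x} [CommGroup K] {T : Type u} [Category.{v} T] [MonoidalCategory T]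
  [∀ X Y : T, MulAction K (X ⟶ Y)] {M : Type w} [AddCommMonoid M] {G : Type w} [AddCommGroup G]
  (P : CentralPowers K T M G)

lemma κ_zero_left (β : G) : P.κ 0 β = 1 := by
  have := P.κ_add_left 0 0 β
  simpa using this

lemma κ_zero_right (α : G) : P.κ α 0 = 1 := by
  have := P.κ_add_right α 0 0
  simpa using this

lemma κ_neg_left (α β : G) : P.κ (-α) β = (P.κ α β)⁻¹ := by
  rw [eq_inv_iff_mul_eq_one, ← κ_add_left, neg_add_cancel, κ_zero_left]

lemma κ_neg_right (α β : G) : P.κ α (-β) = (P.κ α β)⁻¹ := by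
  rw [eq_inv_iff_mul_eq_one, ← κ_add_right, neg_add_cancel, κ_zero_right]

/-- The transition maps between representatives. -/
def zeta {X Y : T} {a b a' b' c : M} (ha : c + a = a') (hb : c + b = b')
    (f : P.Rep X a Y b) : P.Rep X a' Y b' :=
  P.comp ha hb f (P.r c Y)

lemma zeta_zeta {X Y : T} {a b s t s' t' c d e : M} (ha : c + a = s) (hb : c + b = t)
    (ha' : d + s = s') (hb' : d + t = t') (he : d + c = e) (ha'' : e + a = s') (hb'' : e + b = t')
    (f : P.Rep X a Y b) : P.zeta ha' hb' (P.zeta ha hb f) = P.zeta ha'' hb'' f := by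
  rw [zeta, zeta, P.comp_assoc ha hb he he ha' hb' ha'' hb'', r_comp_r, zeta]

lemma zeta_zero {X Y : T} {a b : M} (ha : 0 + a = a) (hb : 0 + b = b) (f : P.Rep X a Y b) :
    P.zeta ha hb f = f := by
  rw [zeta, r_zero, rep_comp_ofHom]; simp

/-- Pure associativity: a transition composes at the target, so it leaves the second factor without
a scalar. -/
lemma comp_zeta {X Y Z : T} {a b c d s t e c' d' s' t' : M} (hs : c + a = s) (ht : d + b = t)
    (hc : e + c = c') (hd : e + d = d') (hs' : c' + a = s') (ht' : d' + b = t')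
    (hs'' : e + s = s') (ht'' : e + t = t') (f : P.Rep X a Y b) (g : P.Rep Y c Z d) :
    P.comp hs' ht' f (P.zeta hc hd g) = P.zeta hs'' ht'' (P.comp hs ht f g) := by
  rw [zeta, zeta, P.comp_assoc hs ht hc hd hs'' ht'' hs' ht']

lemma whiskerL_zeta (X : T) {Y Y' : T} {a b s t c : M} (hs : c + a = s) (ht : c + b = t)
    (f : P.Rep Y a Y' b) : P.whiskerL X (P.zeta hs ht f) = P.zeta hs ht (P.whiskerL X f) := by
  rw [zeta, whiskerL_comp, whiskerL_r, zeta]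

lemma whiskerR_zeta {X X' : T} (Y : T) {a b s t c : M} (hs : c + a = s) (ht : c + b = t)
    (f : P.Rep X a X' b) : P.whiskerR (P.zeta hs ht f) Y = P.zeta hs ht (P.whiskerR f Y) := by
  rw [zeta, whiskerR_comp, whiskerR_r, zeta]

section

variable [ScalarCat K T]

lemma zeta_smul {X Y : T} {a b a' b' c : M} (ha : c + a = a') (hb : c + b = b') (l : K)
    (f : P.Rep X a Y b) : P.zeta ha hb (l • f) = l • P.zeta ha hb f := by
  rw [zeta, smul_comp_rep, zeta]

/-- The braiding is placed at the source instead of the target. The discrepancy involves the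
exponents of `f` only through their difference `γ`, a difference of weights, so it can be absorbed
by a rescaling of the composition. -/
lemma r_comp {X Y : T} {a b c s t : M} {γ : G} (hγ : P.deg a = P.deg b + γ)
    (hs : a + c = s) (ht : b + c = t) (hs' : c + a = s) (ht' : c + b = t) (f : P.Rep X a Y b) :
    P.κ (P.deg c) γ • P.comp hs ht (P.r c X) f = P.zeta hs' ht' f := by
  have := P.comp_r hs' ht' hs ht f
  rw [k, k, hγ, κ_add_right, mul_smul] at this
  exact (smul_left_cancel _ this).symm

/-- A braiding inserted between `f` and `g` has to be carried past `g`. This is the origin of the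
factor in the composition law. -/
lemma zeta_comp {X Y Z : T} {a b c d s t e a' b' s' t' : M} {γ : G}
    (hγ : P.deg c = P.deg d + γ) (hs : c + a = s) (ht : d + b = t)
    (ha : e + a = a') (hb : e + b = b') (hs' : c + a' = s') (ht' : d + b' = t')
    (hs'' : e + s = s') (ht'' : e + t = t') (f : P.Rep X a Y b) (g : P.Rep Y c Z d) :
    P.κ (P.deg e) γ • P.comp hs' ht' (P.zeta ha hb f) g = P.zeta hs'' ht'' (P.comp hs ht f g) := by
  have h₁ : c + e + a = s' := by rw [add_assoc, ha, hs']
  have h₂ : d + e + b = t' := by rw [add_assoc, hb, ht']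
  rw [zeta, P.comp_assoc ha hb rfl rfl hs' ht' h₁ h₂, ← rep_comp_smul,
    P.r_comp hγ rfl rfl (add_comm e c) (add_comm e d),
    P.comp_zeta hs ht _ _ h₁ h₂ hs'' ht'']

end

end CentralPowers

/-- The objects of the localization: pairs of an object and a weight. -/
structure Loc {K : Type x} [CommGroup K] {T : Type u} [Category.{v} T] [MonoidalCategory T]
    [∀ X Y : T, MulAction K (X ⟶ Y)] {M : Type w} [AddCommMonoid M] {G : Type w} [AddCommGroup G]
    (P : CentralPowers K T M G) where ofPair ::
  pt : T
  wt : G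

namespace Loc

variable {K : Type x} [CommGroup K] {T : Type u} [Category.{v} T] [MonoidalCategory T]
  [∀ X Y : T, MulAction K (X ⟶ Y)] {M : Type w} [AddCommMonoid M] {G : Type w} [AddCommGroup G]
  {P : CentralPowers K T M G}

/-- Representatives of morphisms of the localization. -/
structure PreHom (x y : Loc P) where
  {a b : M}
  deg_eq : P.deg a + y.wt = P.deg b + x.wt
  f : P.Rep x.pt a y.pt b

/-- Two representatives are related if they agree after a transition. -/
def PreHom.Rel {x y : Loc P} (p q : PreHom x y) : Prop :=
  ∃ (c₁ c₂ a b : M) (h₁ : c₁ + p.a = a) (h₁' : c₁ + p.b = b) (h₂ : c₂ + q.a = a)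
    (h₂' : c₂ + q.b = b), P.zeta h₁ h₁' p.f = P.zeta h₂ h₂' q.f

lemma PreHom.rel_equivalence (x y : Loc P) : Equivalence (PreHom.Rel (x := x) (y := y)) where
  refl p := ⟨0, 0, _, _, rfl, rfl, rfl, rfl, rfl⟩
  symm := by
    rintro p q ⟨c₁, c₂, a, b, h₁, h₁', h₂, h₂', h⟩
    exact ⟨c₂, c₁, a, b, h₂, h₂', h₁, h₁', h.symm⟩
  trans := by
    rintro p q r ⟨c₁, c₂, a, b, h₁, h₁', h₂, h₂', h⟩ ⟨d₁, d₂, a', b', k₁, k₁', k₂, k₂', k⟩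
    -- The two enlargements of the middle representative, by `c₂` and by `d₁`, are completed to the
    -- common enlargement by `c₂ + d₁`.
    have e : c₂ + a' = d₁ + a := by rw [← k₁, ← h₂]; abel
    have e' : c₂ + b' = d₁ + b := by rw [← k₁', ← h₂']; abel
    refine ⟨d₁ + c₁, c₂ + d₂, d₁ + a, d₁ + b, by rw [add_assoc, h₁], by rw [add_assoc, h₁'],
      by rw [add_assoc, k₂, e], by rw [add_assoc, k₂', e'], ?_⟩
    rw [← P.zeta_zeta h₁ h₁' rfl rfl rfl, h, ← P.zeta_zeta k₂ k₂' e e' rfl, ← k,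
      P.zeta_zeta h₂ h₂' rfl rfl rfl (by rw [add_assoc, h₂]) (by rw [add_assoc, h₂']),
      P.zeta_zeta k₁ k₁' e e' (add_comm _ _)]

/-- The setoid of representatives. -/
def preHomSetoid (x y : Loc P) : Setoid (PreHom x y) := ⟨PreHom.Rel, PreHom.rel_equivalence x y⟩

/-- Morphisms of the localization. -/
def Hom (x y : Loc P) : Type (max v w) := _root_.Quotient (preHomSetoid x y)

/-- The class of a representative. -/
def homMk {x y : Loc P} {a b : M} (h : P.deg a + y.wt = P.deg b + x.wt)
    (f : P.Rep x.pt a y.pt b) : Hom x y := Quotient.mk (preHomSetoid x y) ⟨h, f⟩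

lemma homMk_eq_iff {x y : Loc P} {a₁ b₁ a₂ b₂ : M} (h₁ : P.deg a₁ + y.wt = P.deg b₁ + x.wt)
    (h₂ : P.deg a₂ + y.wt = P.deg b₂ + x.wt) (f₁ : P.Rep x.pt a₁ y.pt b₁)
    (f₂ : P.Rep x.pt a₂ y.pt b₂) :
    homMk h₁ f₁ = homMk h₂ f₂ ↔ ∃ (c₁ c₂ a b : M) (h₁ : c₁ + a₁ = a) (h₁' : c₁ + b₁ = b)
      (h₂ : c₂ + a₂ = a) (h₂' : c₂ + b₂ = b), P.zeta h₁ h₁' f₁ = P.zeta h₂ h₂' f₂ :=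
  Quotient.eq (r := preHomSetoid x y)

lemma deg_zeta {x y : Loc P} {a b a' b' c : M} (h : P.deg a + y.wt = P.deg b + x.wt)
    (ha : c + a = a') (hb : c + b = b') : P.deg a' + y.wt = P.deg b' + x.wt := by
  rw [← ha, ← hb, map_add, map_add, add_assoc, h, add_assoc]

lemma homMk_zeta {x y : Loc P} {a b a' b' c : M} (h : P.deg a + y.wt = P.deg b + x.wt)
    (h' : P.deg a' + y.wt = P.deg b' + x.wt)
    (ha : c + a = a') (hb : c + b = b') (f : P.Rep x.pt a y.pt b) :
    homMk h' (P.zeta ha hb f) = homMk h f :=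
  (homMk_eq_iff _ _ _ _).2 ⟨0, c, a', b', zero_add _, zero_add _, ha, hb, P.zeta_zero _ _ _⟩

lemma Hom.ind {x y : Loc P} {p : Hom x y → Prop}
    (h : ∀ {a b : M} (h : P.deg a + y.wt = P.deg b + x.wt) (f : P.Rep x.pt a y.pt b),
      p (homMk h f)) (φ : Hom x y) : p φ :=
  Quotient.ind (s := preHomSetoid x y) (fun q => h q.deg_eq q.f) φ

/-- Functions out of the morphisms of the localization. -/
def Hom.lift {x y : Loc P} {β : Type*}
    (Φ : ∀ {a b : M}, P.deg a + y.wt = P.deg b + x.wt → P.Rep x.pt a y.pt b → β)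
    (H : ∀ {a b a' b' c : M} (h : P.deg a + y.wt = P.deg b + x.wt)
      (h' : P.deg a' + y.wt = P.deg b' + x.wt) (ha : c + a = a') (hb : c + b = b')
      (f : P.Rep x.pt a y.pt b), Φ h' (P.zeta ha hb f) = Φ h f) (φ : Hom x y) : β :=
  Quotient.lift (fun q : PreHom x y => Φ q.deg_eq q.f) (by
    rintro p q ⟨c₁, c₂, a, b, h₁, h₁', h₂, h₂', h⟩
    have e := deg_zeta p.deg_eq h₁ h₁'
    rw [← H p.deg_eq e h₁ h₁', h, H q.deg_eq e h₂ h₂']) φ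

@[simp]
lemma Hom.lift_homMk {x y : Loc P} {β : Type*}
    (Φ : ∀ {a b : M}, P.deg a + y.wt = P.deg b + x.wt → P.Rep x.pt a y.pt b → β)
    (H : ∀ {a b a' b' c : M} (h : P.deg a + y.wt = P.deg b + x.wt)
      (h' : P.deg a' + y.wt = P.deg b' + x.wt) (ha : c + a = a') (hb : c + b = b')
      (f : P.Rep x.pt a y.pt b), Φ h' (P.zeta ha hb f) = Φ h f)
    {a b : M} (h : P.deg a + y.wt = P.deg b + x.wt) (f : P.Rep x.pt a y.pt b) :
    Hom.lift Φ H (homMk h f) = Φ h f := rfl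

lemma deg_comp {x y z : Loc P} {a b c d s t : M} (h : P.deg a + y.wt = P.deg b + x.wt)
    (h' : P.deg c + z.wt = P.deg d + y.wt) (hs : c + a = s) (ht : d + b = t) :
    P.deg s + z.wt = P.deg t + x.wt := by
  rw [← hs, ← ht, map_add, map_add, add_right_comm, h', add_assoc (P.deg d), add_assoc, ← h]
  abel

lemma deg_sub {x y : Loc P} {a b : M} (h : P.deg a + y.wt = P.deg b + x.wt) :
    P.deg a = P.deg b + (x.wt - y.wt) := by
  rw [← add_sub_assoc, ← h, add_sub_cancel_right]

/-- Parallel morphisms have representatives with the same difference of exponents, so enlarging one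
by `c` and the other by `a` brings them to the same degree. This uses the injectivity of `deg`. -/
lemma deg_common {x y : Loc P} {a b c d : M} (h : P.deg a + y.wt = P.deg b + x.wt)
    (h' : P.deg c + y.wt = P.deg d + x.wt) : a + d = c + b := by
  apply P.deg_injective
  rw [map_add, map_add, ← add_left_inj (x.wt), add_assoc, ← h', add_assoc (P.deg c), ← h]
  abel

lemma Hom.exists_common {x y : Loc P} (φ ψ : Hom x y) :
    ∃ (a b : M) (h : P.deg a + y.wt = P.deg b + x.wt) (f g : P.Rep x.pt a y.pt b),
      homMk h f = φ ∧ homMk h g = ψ := by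
  induction φ using Hom.ind with | h h f =>
  induction ψ using Hom.ind with | h h' g =>
  exact ⟨_, _, deg_zeta h rfl rfl, P.zeta rfl rfl f, P.zeta (add_comm _ _) (deg_common h h') g,
    homMk_zeta _ _ _ _ _, homMk_zeta _ _ _ _ _⟩

variable [ScalarCat K T]

/-- Composition in the localization. -/
def Hom.comp {x y z : Loc P} (φ : Hom x y) (ψ : Hom y z) : Hom x z :=
  φ.lift (fun {_ b} h f => ψ.lift (fun {_ _} h' g =>
    homMk (deg_comp h h' rfl rfl) (P.κ (P.deg b) (y.wt - z.wt) • P.comp rfl rfl f g))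
    (by
      intro c d c' d' e h' h'' hc hd g
      rw [P.comp_zeta rfl rfl hc hd rfl rfl (by rw [← add_assoc, hc]) (by rw [← add_assoc, hd]),
        ← P.zeta_smul, homMk_zeta]))
    (by
      intro a b a' b' e h h' ha hb f
      induction ψ using Hom.ind with | h k g =>
      have hγ := deg_sub k
      simp only [Hom.lift_homMk]
      have e : P.deg b' = P.deg b + P.deg e := by rw [← hb, map_add, add_comm]
      -- Enlarging `b` by `e` multiplies the prescribed scalar by `κ(e, y.wt - z.wt)`, precisely the
      -- cost of the transition in the first factor.
      rw [e, P.κ_add_left, mul_smul, P.zeta_comp hγ rfl rfl ha hb rfl rfl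
        (by rw [← ha]; abel) (by rw [← hb]; abel), ← P.zeta_smul, homMk_zeta])

lemma homMk_comp {x y z : Loc P} {a b c d s t : M} (h : P.deg a + y.wt = P.deg b + x.wt)
    (h' : P.deg c + z.wt = P.deg d + y.wt) (hs : c + a = s) (ht : d + b = t)
    (h'' : P.deg s + z.wt = P.deg t + x.wt) (f : P.Rep x.pt a y.pt b) (g : P.Rep y.pt c z.pt d) :
    (homMk h f).comp (homMk h' g) =
      homMk h'' (P.κ (P.deg b) (y.wt - z.wt) • P.comp hs ht f g) := by
  subst hs ht
  rfl

/-- The morphism of the localization defined by a morphism of `T`. -/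
def Hom.of {x y : Loc P} (h : x.wt = y.wt) (f : x.pt ⟶ y.pt) : Hom x y :=
  homMk (a := 0) (b := 0) (by rw [h]) (P.ofHom f)

lemma Hom.of_comp_homMk {x y z : Loc P} {c d : M} (h : x.wt = y.wt) (u : x.pt ⟶ y.pt)
    (h' : P.deg c + z.wt = P.deg d + y.wt) (g : P.Rep y.pt c z.pt d) :
    (Hom.of h u).comp (homMk h' g) =
      homMk (x := x) (by rw [h', h]) ((P.C c ◁ u ≫ g : P.Rep x.pt c z.pt d)) := by
  rw [Hom.of, homMk_comp _ _ (add_zero _) (add_zero _) (by rw [h', h]), map_zero, P.κ_zero_left,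
    one_smul, P.ofHom_comp_rep]

lemma Hom.homMk_comp_of {x y z : Loc P} {a b : M} (h : P.deg a + y.wt = P.deg b + x.wt)
    (f : P.Rep x.pt a y.pt b) (h' : y.wt = z.wt) (u : y.pt ⟶ z.pt) :
    (homMk h f).comp (Hom.of h' u) =
      homMk (y := z) (by rw [← h, h']) ((f ≫ u ▷ P.C b : P.Rep x.pt a z.pt b)) := by
  rw [Hom.of, homMk_comp _ _ (zero_add _) (zero_add _) (by rw [← h, h']),
    sub_eq_zero.2 h', P.κ_zero_right, one_smul, P.rep_comp_ofHom]

instance : Category (Loc P) where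
  Hom := Hom
  id x := Hom.of rfl (𝟙 _)
  comp := Hom.comp
  id_comp {x y} φ := by
    induction φ using Hom.ind with | h h f =>
    rw [Hom.of_comp_homMk]; simp
  comp_id {x y} φ := by
    induction φ using Hom.ind with | h h f =>
    rw [Hom.homMk_comp_of]; simp
  assoc {x y z w} φ ψ χ := by
    induction φ using Hom.ind with | @h a b h f =>
    induction ψ using Hom.ind with | @h c d h' g =>
    induction χ using Hom.ind with | @h p q h'' k =>
    rw [homMk_comp h h' rfl rfl (deg_comp h h' rfl rfl),
      homMk_comp _ h'' rfl rfl (deg_comp (deg_comp h h' rfl rfl) h'' rfl rfl),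
      homMk_comp h' h'' rfl rfl (deg_comp h' h'' rfl rfl),
      homMk_comp h _ (add_assoc _ _ _) (add_assoc _ _ _)
        (deg_comp (deg_comp h h' rfl rfl) h'' rfl rfl),
      P.smul_comp_rep, P.rep_comp_smul, smul_smul, smul_smul,
      P.comp_assoc rfl rfl rfl rfl rfl rfl (add_assoc _ _ _) (add_assoc _ _ _)]
    congr 2
    -- The cocycle identity `κ(b, y-z) κ(d+b, z-w) = κ(d, z-w) κ(b, y-w)`, in terms of weights.
    rw [map_add, P.κ_add_left, ← sub_add_sub_cancel y.wt z.wt w.wt, P.κ_add_right]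
    ac_rfl

/-- The morphism of the localization given by a representative. -/
def mk {x y : Loc P} {a b : M} (h : P.deg a + y.wt = P.deg b + x.wt)
    (f : P.Rep x.pt a y.pt b) : x ⟶ y := homMk h f

/-- The morphism of the localization defined by a morphism of `T`. -/
def of {x y : Loc P} (h : x.wt = y.wt) (f : x.pt ⟶ y.pt) : x ⟶ y :=
  mk (a := 0) (b := 0) (by rw [h]) (P.ofHom f)

lemma ind {x y : Loc P} {p : (x ⟶ y) → Prop}
    (h : ∀ {a b : M} (h : P.deg a + y.wt = P.deg b + x.wt) (f : P.Rep x.pt a y.pt b),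
      p (mk h f)) (φ : x ⟶ y) : p φ :=
  Hom.ind h φ

lemma exists_common {x y : Loc P} (φ ψ : x ⟶ y) :
    ∃ (a b : M) (h : P.deg a + y.wt = P.deg b + x.wt) (f g : P.Rep x.pt a y.pt b),
      mk h f = φ ∧ mk h g = ψ :=
  Hom.exists_common φ ψ

lemma mk_eq_iff {x y : Loc P} {a₁ b₁ a₂ b₂ : M} (h₁ : P.deg a₁ + y.wt = P.deg b₁ + x.wt)
    (h₂ : P.deg a₂ + y.wt = P.deg b₂ + x.wt) (f₁ : P.Rep x.pt a₁ y.pt b₁)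
    (f₂ : P.Rep x.pt a₂ y.pt b₂) :
    mk h₁ f₁ = mk h₂ f₂ ↔ ∃ (c₁ c₂ a b : M) (h₁ : c₁ + a₁ = a) (h₁' : c₁ + b₁ = b)
      (h₂ : c₂ + a₂ = a) (h₂' : c₂ + b₂ = b), P.zeta h₁ h₁' f₁ = P.zeta h₂ h₂' f₂ :=
  homMk_eq_iff _ _ _ _

lemma mk_zeta {x y : Loc P} {a b a' b' c : M} (h : P.deg a + y.wt = P.deg b + x.wt)
    (h' : P.deg a' + y.wt = P.deg b' + x.wt)
    (ha : c + a = a') (hb : c + b = b') (f : P.Rep x.pt a y.pt b) :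
    mk h' (P.zeta ha hb f) = mk h f :=
  homMk_zeta _ _ _ _ _

lemma mk_comp {x y z : Loc P} {a b c d s t : M} (h : P.deg a + y.wt = P.deg b + x.wt)
    (h' : P.deg c + z.wt = P.deg d + y.wt) (hs : c + a = s) (ht : d + b = t)
    (h'' : P.deg s + z.wt = P.deg t + x.wt) (f : P.Rep x.pt a y.pt b) (g : P.Rep y.pt c z.pt d) :
    mk h f ≫ mk h' g = mk h'' (P.κ (P.deg b) (y.wt - z.wt) • P.comp hs ht f g) :=
  homMk_comp _ _ _ _ _ _ _

lemma of_comp_mk {x y z : Loc P} {c d : M} (h : x.wt = y.wt) (u : x.pt ⟶ y.pt)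
    (h' : P.deg c + z.wt = P.deg d + y.wt) (g : P.Rep y.pt c z.pt d) :
    of h u ≫ mk h' g =
      mk (x := x) (by rw [h', h]) ((P.C c ◁ u ≫ g : P.Rep x.pt c z.pt d)) :=
  Hom.of_comp_homMk h _ _ _

lemma mk_comp_of {x y z : Loc P} {a b : M} (h : P.deg a + y.wt = P.deg b + x.wt)
    (f : P.Rep x.pt a y.pt b) (h' : y.wt = z.wt) (u : y.pt ⟶ z.pt) :
    mk h f ≫ of h' u =
      mk (y := z) (by rw [← h, h']) ((f ≫ u ▷ P.C b : P.Rep x.pt a z.pt b)) :=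
  Hom.homMk_comp_of _ _ h' _

lemma id_eq_of (x : Loc P) : 𝟙 x = of rfl (𝟙 x.pt) := rfl

lemma of_comp_of {x y z : Loc P} (h : x.wt = y.wt) (u : x.pt ⟶ y.pt)
    (h' : y.wt = z.wt) (v : y.pt ⟶ z.pt) : of h u ≫ of h' v = of (h.trans h') (u ≫ v) := by
  rw [of, mk_comp_of]
  simp [of, CentralPowers.ofHom, whisker_exchange]

/-- The braiding represents the identity. -/
lemma mk_r (x : Loc P) (c : M) (h : P.deg c + x.wt = P.deg c + x.wt) :
    mk h (P.r c x.pt) = 𝟙 x := by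
  rw [id_eq_of, of, ← mk_zeta (c := c) _ h (add_zero c) (add_zero c), CentralPowers.zeta,
    P.ofHom_comp_rep]
  simp

/-- The isomorphism of the localization defined by an isomorphism of `T`. -/
@[simps]
def isoOf {x y : Loc P} (h : x.wt = y.wt) (u : x.pt ≅ y.pt) : x ≅ y where
  hom := of h u.hom
  inv := of h.symm u.inv
  hom_inv_id := by rw [of_comp_of, u.hom_inv_id]; rfl
  inv_hom_id := by rw [of_comp_of, u.inv_hom_id]; rfl

/-! ### The monoidal structure of the localization -/

/-- Left whiskering in the localization. -/
def whiskerLeft (x : Loc P) {y y' : Loc P} (φ : y ⟶ y') :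
    (ofPair (x.pt ⊗ y.pt) (x.wt + y.wt) : Loc P) ⟶ ofPair (x.pt ⊗ y'.pt) (x.wt + y'.wt) :=
  Hom.lift (fun {a b} h f => mk (a := a) (b := b) (by
      change P.deg a + (x.wt + y'.wt) = P.deg b + (x.wt + y.wt)
      rw [add_left_comm, h, add_left_comm]) (P.whiskerL x.pt f)) (by
    intro a b a' b' c h h' ha hb f
    rw [P.whiskerL_zeta, mk_zeta]) φ

/-- Right whiskering in the localization. -/
def whiskerRight {x x' : Loc P} (φ : x ⟶ x') (y : Loc P) :
    (ofPair (x.pt ⊗ y.pt) (x.wt + y.wt) : Loc P) ⟶ ofPair (x'.pt ⊗ y.pt) (x'.wt + y.wt) :=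
  Hom.lift (fun {a b} h f => mk (a := a) (b := b) (by
      change P.deg a + (x'.wt + y.wt) = P.deg b + (x.wt + y.wt)
      rw [← add_assoc, h, add_assoc])
      -- The factor `η(ε, α - α')` of the tensor product at `ε = -y.wt`, the index in which the
      -- identity of `y` lives. For left whiskering `α = α'`, so no factor occurs.
      (P.κ (-y.wt) (x.wt - x'.wt) • P.whiskerR f y.pt)) (by
    intro a b a' b' c h h' ha hb f
    rw [P.whiskerR_zeta, ← P.zeta_smul, mk_zeta]) φ

instance : MonoidalCategoryStruct (Loc P) where
  tensorObj x y := ofPair (x.pt ⊗ y.pt) (x.wt + y.wt)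
  whiskerLeft x _ _ φ := whiskerLeft x φ
  whiskerRight φ y := whiskerRight φ y
  tensorUnit := ofPair (𝟙_ T) 0
  associator x y z := isoOf (add_assoc _ _ _) (α_ x.pt y.pt z.pt)
  leftUnitor x := isoOf (zero_add _) (λ_ x.pt)
  rightUnitor x := isoOf (add_zero _) (ρ_ x.pt)

lemma tensor_pt (x y : Loc P) : (x ⊗ y).pt = x.pt ⊗ y.pt := rfl
lemma tensor_wt (x y : Loc P) : (x ⊗ y).wt = x.wt + y.wt := rfl
lemma unit_pt : (𝟙_ (Loc P)).pt = 𝟙_ T := rfl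
lemma unit_wt : (𝟙_ (Loc P)).wt = 0 := rfl

lemma whiskerLeft_mk (x : Loc P) {y y' : Loc P} {a b : M} (h : P.deg a + y'.wt = P.deg b + y.wt)
    (h' : P.deg a + (x ⊗ y').wt = P.deg b + (x ⊗ y).wt) (f : P.Rep y.pt a y'.pt b) :
    x ◁ (mk h f) = mk (x := x ⊗ y) (y := x ⊗ y') h' (P.whiskerL x.pt f) := rfl

lemma mk_whiskerRight {x x' : Loc P} (y : Loc P) {a b : M}
    (h : P.deg a + x'.wt = P.deg b + x.wt)
    (h' : P.deg a + (x' ⊗ y).wt = P.deg b + (x ⊗ y).wt) (f : P.Rep x.pt a x'.pt b) :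
    (mk h f) ▷ y = mk (x := x ⊗ y) (y := x' ⊗ y) h'
      (P.κ (-y.wt) (x.wt - x'.wt) • P.whiskerR f y.pt) := rfl

lemma deg_whiskerLeft (x : Loc P) {y y' : Loc P} {a b : M}
    (h : P.deg a + y'.wt = P.deg b + y.wt) :
    P.deg a + (x ⊗ y').wt = P.deg b + (x ⊗ y).wt := by
  rw [tensor_wt, tensor_wt, add_left_comm, h, add_left_comm]

lemma deg_whiskerRight {x x' : Loc P} (y : Loc P) {a b : M}
    (h : P.deg a + x'.wt = P.deg b + x.wt) :
    P.deg a + (x' ⊗ y).wt = P.deg b + (x ⊗ y).wt := by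
  rw [tensor_wt, tensor_wt, ← add_assoc, h, add_assoc]

lemma whiskerLeft_of (x : Loc P) {y y' : Loc P} (h : y.wt = y'.wt) (f : y.pt ⟶ y'.pt) :
    x ◁ (of h f) = of (x := x ⊗ y) (y := x ⊗ y') (by simp only [tensor_wt, h]) (x.pt ◁ f) := by
  rw [of, whiskerLeft_mk _ _ (by simp only [tensor_wt, h]), P.whiskerL_ofHom, of]

lemma of_whiskerRight {x x' : Loc P} (y : Loc P) (h : x.wt = x'.wt) (f : x.pt ⟶ x'.pt) :
    (of h f) ▷ y = of (x := x ⊗ y) (y := x' ⊗ y) (by simp only [tensor_wt, h]) (f ▷ y.pt) := by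
  rw [of, mk_whiskerRight _ _ (by simp only [tensor_wt, h]), P.whiskerR_ofHom, of,
    sub_eq_zero.2 h, P.κ_zero_right, one_smul]

lemma associator_eq (x y z : Loc P) :
    (α_ x y z) = isoOf (x := (x ⊗ y) ⊗ z) (y := x ⊗ y ⊗ z) (add_assoc _ _ _)
      (α_ x.pt y.pt z.pt) := rfl

lemma leftUnitor_eq (x : Loc P) : λ_ x = isoOf (x := 𝟙_ _ ⊗ x) (zero_add _) (λ_ x.pt) := rfl

lemma rightUnitor_eq (x : Loc P) : ρ_ x = isoOf (x := x ⊗ 𝟙_ _) (add_zero _) (ρ_ x.pt) := rfl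

lemma whiskerLeft_comp' (x : Loc P) {y y' y'' : Loc P} (φ : y ⟶ y') (ψ : y' ⟶ y'') :
    x ◁ (φ ≫ ψ) = x ◁ φ ≫ x ◁ ψ := by
  induction φ using ind with | @h a b h f =>
  induction ψ using ind with | @h c d h' g =>
  have e := deg_comp h h' rfl rfl
  rw [mk_comp h h' rfl rfl e, whiskerLeft_mk x h (deg_whiskerLeft x h),
    whiskerLeft_mk x h' (deg_whiskerLeft x h'), whiskerLeft_mk x e (deg_whiskerLeft x e),
    mk_comp _ _ rfl rfl (deg_whiskerLeft x e), P.whiskerL_smul, P.whiskerL_comp,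
    tensor_wt, tensor_wt, add_sub_add_left_eq_sub]

lemma comp_whiskerRight' {x x' x'' : Loc P} (φ : x ⟶ x') (ψ : x' ⟶ x'') (y : Loc P) :
    (φ ≫ ψ) ▷ y = φ ▷ y ≫ ψ ▷ y := by
  induction φ using ind with | @h a b h f =>
  induction ψ using ind with | @h c d h' g =>
  have e := deg_comp h h' rfl rfl
  rw [mk_comp h h' rfl rfl e, mk_whiskerRight y h (deg_whiskerRight y h),
    mk_whiskerRight y h' (deg_whiskerRight y h'), mk_whiskerRight y e (deg_whiskerRight y e),
    mk_comp _ _ rfl rfl (deg_whiskerRight y e), P.whiskerR_smul, P.whiskerR_comp,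
    tensor_wt, tensor_wt, add_sub_add_right_eq_sub, P.smul_comp_rep, P.rep_comp_smul]
  simp only [smul_smul]
  rw [← sub_add_sub_cancel x.wt x'.wt x''.wt, P.κ_add_right (-y.wt)]
  congr 2
  ac_rfl

/-- For representatives the two orders differ by the scalars of `whisker_exchange_rep`; the factors
in composition and right whiskering cancel them. -/
lemma whisker_exchange' {x x' y y' : Loc P} (φ : x ⟶ x') (ψ : y ⟶ y') :
    x ◁ ψ ≫ φ ▷ y' = φ ▷ y ≫ x' ◁ ψ := by
  induction φ using ind with | @h a a' h f =>
  induction ψ using ind with | @h b b' h' g =>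
  have e : P.deg (a + b) + (x' ⊗ y').wt = P.deg (a' + b') + (x ⊗ y).wt := by
    rw [map_add, map_add, tensor_wt, tensor_wt, add_add_add_comm, h, h', add_add_add_comm]
  rw [mk_whiskerRight y h (deg_whiskerRight y h), mk_whiskerRight y' h (deg_whiskerRight y' h),
    whiskerLeft_mk x h' (deg_whiskerLeft x h'), whiskerLeft_mk x' h' (deg_whiskerLeft x' h'),
    mk_comp _ _ rfl rfl e, mk_comp _ _ (add_comm b a) (add_comm b' a') e]
  congr 1
  rw [P.smul_comp_rep, P.rep_comp_smul, smul_smul, smul_smul, tensor_wt, tensor_wt, tensor_wt,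
    add_sub_add_right_eq_sub, add_sub_add_left_eq_sub]
  have w := P.whisker_exchange_rep (add_comm b a) (add_comm b' a') rfl rfl f g
  simp only [tensor_pt]
  -- Multiplying by the scalar that stands on the left in the exchange rule makes that rule
  -- applicable.
  rw [← smul_left_cancel_iff (P.k b a' * P.k a' b), smul_smul, smul_smul,
    mul_comm _ (P.κ (P.deg a') _ * _), mul_smul _ (P.k b a' * P.k a' b), w, smul_smul]
  congr 1
  have hx := deg_sub h
  have hy := deg_sub h'
  have hy' : y'.wt = P.deg b' + y.wt - P.deg b := by rw [← h']; abel
  simp only [CentralPowers.k]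
  rw [hx, hy]
  simp only [P.κ_add_left, P.κ_add_right, sub_eq_add_neg, P.κ_neg_left, P.κ_neg_right, hy']
  -- Once the weights are eliminated through the degree equations, an identity between products of
  -- values of `κ` remains; it is checked in additive notation.
  apply Additive.ofMul.injective
  simp only [ofMul_mul, ofMul_inv]
  abel

lemma associator_naturality_left' {x x' : Loc P} (φ : x ⟶ x') (y z : Loc P) :
    φ ▷ y ▷ z ≫ (α_ x' y z).hom = (α_ x y z).hom ≫ φ ▷ (y ⊗ z) := by
  induction φ using ind with | @h a b h f =>
  have h₁ := deg_whiskerRight y h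
  have h₂ := deg_whiskerRight z h₁
  have h₃ := deg_whiskerRight (y ⊗ z) h
  rw [mk_whiskerRight y h h₁, mk_whiskerRight z h₁ h₂, mk_whiskerRight _ h h₃, associator_eq,
    associator_eq, isoOf_hom, isoOf_hom, mk_comp_of, of_comp_mk]
  congr 1
  rw [P.whiskerR_smul, smul_smul, ScalarCat.smul_comp, ScalarCat.comp_smul]
  congr 1
  · rw [tensor_wt, tensor_wt, tensor_wt, add_sub_add_right_eq_sub, ← P.κ_add_left, neg_add_rev]
  · exact P.whiskerR_tensor y.pt z.pt f

lemma associator_naturality_middle' (x : Loc P) {y y' : Loc P} (φ : y ⟶ y') (z : Loc P) :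
    (x ◁ φ) ▷ z ≫ (α_ x y' z).hom = (α_ x y z).hom ≫ x ◁ φ ▷ z := by
  induction φ using ind with | @h a b h f =>
  have h₁ := deg_whiskerLeft x h
  have h₂ := deg_whiskerRight z h₁
  have h₃ := deg_whiskerRight z h
  have h₄ := deg_whiskerLeft x h₃
  rw [whiskerLeft_mk x h h₁, mk_whiskerRight z h₁ h₂, mk_whiskerRight _ h h₃,
    whiskerLeft_mk x h₃ h₄, associator_eq,
    associator_eq, isoOf_hom, isoOf_hom, mk_comp_of, of_comp_mk]
  congr 1
  rw [P.whiskerL_smul, ScalarCat.smul_comp, ScalarCat.comp_smul, tensor_wt, tensor_wt,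
    add_sub_add_left_eq_sub]
  congr 1
  exact P.whiskerR_whiskerL x.pt z.pt f

lemma associator_naturality_right' (x y : Loc P) {z z' : Loc P} (φ : z ⟶ z') :
    (x ⊗ y) ◁ φ ≫ (α_ x y z').hom = (α_ x y z).hom ≫ x ◁ y ◁ φ := by
  induction φ using ind with | @h a b h f =>
  have h₁ := deg_whiskerLeft y h
  have h₂ := deg_whiskerLeft x h₁
  have h₃ := deg_whiskerLeft (x ⊗ y) h
  rw [whiskerLeft_mk y h h₁, whiskerLeft_mk x h₁ h₂, whiskerLeft_mk (x ⊗ y) h h₃,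
    associator_eq, associator_eq, isoOf_hom, isoOf_hom, mk_comp_of, of_comp_mk]
  congr 1
  exact P.whiskerL_tensor x.pt y.pt f

instance : MonoidalCategory (Loc P) where
  whiskerLeft_id x y := by
    rw [id_eq_of, whiskerLeft_of]; simp; rfl
  id_whiskerRight x y := by
    rw [id_eq_of, of_whiskerRight]; simp; rfl
  tensorHom_comp_tensorHom {x₁ y₁ z₁ x₂ y₂ z₂} f₁ f₂ g₁ g₂ := by
    change (f₁ ▷ _ ≫ _ ◁ f₂) ≫ (g₁ ▷ _ ≫ _ ◁ g₂) = (f₁ ≫ g₁) ▷ _ ≫ _ ◁ (f₂ ≫ g₂)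
    rw [comp_whiskerRight', whiskerLeft_comp']
    simp only [Category.assoc]
    rw [reassoc_of% whisker_exchange' g₁ f₂]
  id_tensorHom_id x y := by
    change 𝟙 x ▷ y ≫ x ◁ 𝟙 y = _
    rw [id_eq_of, of_whiskerRight, id_eq_of, whiskerLeft_of, of_comp_of]
    simp only [MonoidalCategory.id_whiskerRight, MonoidalCategory.whiskerLeft_id]
    exact congrArg (of rfl) (Category.comp_id (𝟙 (x.pt ⊗ y.pt)))
  associator_naturality {x₁ x₂ x₃ y₁ y₂ y₃} f₁ f₂ f₃ := by
    change ((f₁ ▷ x₂ ≫ y₁ ◁ f₂) ▷ x₃ ≫ (y₁ ⊗ y₂) ◁ f₃) ≫ _ =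
      _ ≫ f₁ ▷ (x₂ ⊗ x₃) ≫ y₁ ◁ (f₂ ▷ x₃ ≫ y₂ ◁ f₃)
    rw [comp_whiskerRight', whiskerLeft_comp', Category.assoc, Category.assoc,
      associator_naturality_right', reassoc_of% associator_naturality_middle', reassoc_of% associator_naturality_left']
  leftUnitor_naturality {x y} φ := by
    induction φ using ind with | @h a b h f =>
    rw [whiskerLeft_mk _ h (deg_whiskerLeft _ h), leftUnitor_eq, leftUnitor_eq, isoOf_hom,
      isoOf_hom, mk_comp_of, of_comp_mk]
    congr 1
    exact P.whiskerL_unit f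
  rightUnitor_naturality {x y} φ := by
    induction φ using ind with | @h a b h f =>
    rw [mk_whiskerRight _ h (deg_whiskerRight _ h), rightUnitor_eq, rightUnitor_eq, isoOf_hom,
      isoOf_hom, mk_comp_of, of_comp_mk, unit_wt, neg_zero, P.κ_zero_left, one_smul]
    congr 1
    exact P.whiskerR_unit f
  pentagon x y z w := by
    simp only [associator_eq, isoOf_hom]
    rw [of_whiskerRight, whiskerLeft_of, of_comp_of, of_comp_of, of_comp_of]
    exact congrArg _ (MonoidalCategory.pentagon _ _ _ _)
  triangle x y := by
    simp only [associator_eq, leftUnitor_eq, rightUnitor_eq, isoOf_hom]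
    rw [of_whiskerRight, whiskerLeft_of, of_comp_of]
    exact congrArg _ (MonoidalCategory.triangle _ _)

end Loc
end BraiderLocalization

/-! ### Invertibility of the powers and of their braidings in the localization -/

namespace BraiderLocalization

section Invertible

variable {L : Type u} [Category.{v} L] [MonoidalCategory L]

lemma IsInvertibleObj.of_inverse {X Y : L} (e : X ⊗ Y ≅ 𝟙_ L) (e' : Y ⊗ X ≅ 𝟙_ L) :
    IsInvertibleObj X := by
  let r {X Y : L} (e : X ⊗ Y ≅ 𝟙_ L) : tensorRight X ⋙ tensorRight Y ≅ 𝟭 L :=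
    (tensorRightTensor X Y).symm ≪≫ (curriedTensor L).flip.mapIso e ≪≫
      NatIso.ofComponents (fun Z => ρ_ Z)
  let l {X Y : L} (e : X ⊗ Y ≅ 𝟙_ L) : tensorLeft Y ⋙ tensorLeft X ≅ 𝟭 L :=
    (tensorLeftTensor X Y).symm ≪≫ (curriedTensor L).mapIso e ≪≫
      NatIso.ofComponents (fun Z => λ_ Z)
  exact ⟨(CategoryTheory.Equivalence.mk _ _ (r e).symm (r e')).isEquivalence_functor,
    (CategoryTheory.Equivalence.mk _ _ (l e').symm (l e)).isEquivalence_functor⟩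

lemma IsInvertibleObj.of_iso {X Y : L} (e : X ≅ Y) (h : IsInvertibleObj X) :
    IsInvertibleObj Y :=
  ⟨have := h.1; Functor.isEquivalence_of_iso ((curriedTensor L).flip.mapIso e),
    have := h.2; Functor.isEquivalence_of_iso ((curriedTensor L).mapIso e)⟩

lemma IsInvertibleObj.unit : IsInvertibleObj (𝟙_ L) := .of_inverse (λ_ _) (λ_ _)

lemma IsInvertibleObj.tensor {X Y : L} (hX : IsInvertibleObj X) (hY : IsInvertibleObj Y) :
    IsInvertibleObj (X ⊗ Y) := by
  obtain ⟨_, _⟩ := hX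
  obtain ⟨_, _⟩ := hY
  exact ⟨Functor.isEquivalence_of_iso (tensorRightTensor X Y).symm,
    Functor.isEquivalence_of_iso (tensorLeftTensor X Y).symm⟩

end Invertible

namespace CentralPowers

variable {K : Type x} [CommGroup K] {T : Type u} [Category.{v} T] [MonoidalCategory T]
  [∀ X Y : T, MulAction K (X ⟶ Y)] {M : Type w} [AddCommMonoid M] {G : Type w} [AddCommGroup G]
  (P : CentralPowers K T M G)

/-- A morphism `C^a ⊗ X ⟶ Y` as a representative of degree `(a, 0)`. -/
def repLeft {X Y : T} {a : M} (f : P.C a ⊗ X ⟶ Y) : P.Rep X a Y 0 :=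
  f ≫ (ρ_ _).inv ≫ Y ◁ P.zeroIso.inv

/-- A morphism `X ⟶ Y ⊗ C^b` as a representative of degree `(0, b)`. -/
def repRight {X Y : T} {b : M} (g : X ⟶ Y ⊗ P.C b) : P.Rep X 0 Y b :=
  P.zeroIso.hom ▷ X ≫ (λ_ _).hom ≫ g

lemma repLeft_comp_repRight {X Y Z : T} {a b : M} (hs : 0 + a = a) (ht : b + 0 = b)
    (f : P.C a ⊗ X ⟶ Y) (g : Y ⟶ Z ⊗ P.C b) :
    P.comp hs ht (P.repLeft f) (P.repRight g) = f ≫ g := by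
  calc P.comp hs ht (P.repLeft f) (P.repRight g)
      = 𝟙 _ ⊗≫ P.zeroIso.inv ▷ (P.C a ⊗ X) ⊗≫
          (P.C 0 ◁ (f ≫ (ρ_ _).inv ≫ Y ◁ P.zeroIso.inv) ≫ P.zeroIso.hom ▷ (Y ⊗ P.C 0)) ⊗≫
          g ▷ P.C 0 ⊗≫ Z ◁ P.C b ◁ P.zeroIso.hom ⊗≫ 𝟙 (Z ⊗ P.C b) := by
        simp only [comp, repLeft, repRight, ξ_zero_left_inv, ξ_zero_right]; monoidal
    _ = 𝟙 _ ⊗≫ (P.zeroIso.inv ≫ P.zeroIso.hom) ▷ (P.C a ⊗ X) ⊗≫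
          f ⊗≫ (Y ◁ P.zeroIso.inv ≫ g ▷ P.C 0) ⊗≫ Z ◁ P.C b ◁ P.zeroIso.hom ⊗≫
          𝟙 (Z ⊗ P.C b) := by
        rw [whisker_exchange]; monoidal
    _ = 𝟙 _ ⊗≫ (P.zeroIso.inv ≫ P.zeroIso.hom) ▷ (P.C a ⊗ X) ⊗≫
          f ⊗≫ g ⊗≫ Z ◁ P.C b ◁ (P.zeroIso.inv ≫ P.zeroIso.hom) ⊗≫
          𝟙 (Z ⊗ P.C b) := by
        rw [whisker_exchange]; monoidal
    _ = _ := by rw [Iso.inv_hom_id]; monoidal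

/-- In contrast with `repLeft_comp_repRight`, the factor `C^b` is created before `C^a` is consumed,
so both are present at once. -/
lemma repRight_comp_repLeft {X Y Z : T} {a b : M} (hs : a + 0 = a) (ht : 0 + b = b)
    (g : X ⟶ Y ⊗ P.C b) (f : P.C a ⊗ Y ⟶ Z) :
    P.comp hs ht (P.repRight g) (P.repLeft f) =
      P.C a ◁ g ≫ (α_ _ _ _).inv ≫ f ▷ P.C b := by
  calc P.comp hs ht (P.repRight g) (P.repLeft f)
      = 𝟙 _ ⊗≫ (P.C a ◁ (P.zeroIso.inv ≫ P.zeroIso.hom)) ▷ X ⊗≫ P.C a ◁ g ⊗≫ f ▷ P.C b ⊗≫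
          Z ◁ (P.zeroIso.inv ≫ P.zeroIso.hom) ▷ P.C b ⊗≫ 𝟙 (Z ⊗ P.C b) := by
        simp only [comp, repLeft, repRight, ξ_zero_right_inv, ξ_zero_left]; monoidal
    _ = _ := by rw [Iso.inv_hom_id]; monoidal

/-- For `b = a` both factorizations in the commutation rule are the same `ξ_{a,a}`, which cancels.
-/
lemma R_self [ScalarCat K T] (a : M) : (P.pow a).R (P.C a) = P.k a a • 𝟙 (P.C a ⊗ P.C a) := by
  rw [← cancel_mono (P.ξ rfl).hom, P.comm rfl rfl, ScalarCat.smul_comp, Category.id_comp, k]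

end CentralPowers

namespace Loc

variable {K : Type x} [CommGroup K] {T : Type u} [Category.{v} T] [MonoidalCategory T]
  [∀ X Y : T, MulAction K (X ⟶ Y)] {M : Type w} [AddCommMonoid M] {G : Type w} [AddCommGroup G]
  (P : CentralPowers K T M G)

/-- The object `(X, α)` of the localization. -/
abbrev pair (X : T) (α : G) : Loc P := ofPair X α

variable [ScalarCat K T]

/-- The functor from `T` to its localization. -/
def functor : T ⥤ Loc P where
  obj X := pair P X 0
  map {X Y} f := of (x := pair P X 0) (y := pair P Y 0) rfl f
  map_id _ := rfl
  map_comp {X Y Z} f g :=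
    (of_comp_of (x := pair P X 0) (y := pair P Y 0) (z := pair P Z 0) rfl f rfl g).symm

lemma functor_obj (X : T) : (functor P).obj X = pair P X 0 := rfl

lemma functor_map {X Y : T} (f : X ⟶ Y) :
    (functor P).map f = of (x := pair P X 0) (y := pair P Y 0) rfl f := rfl

variable {P}

lemma of_congr {x y : Loc P} (h : x.wt = y.wt) {f g : x.pt ⟶ y.pt} (e : f = g) :
    of h f = of h g := by rw [e]

variable (P)

instance : (functor P).Monoidal := Functor.CoreMonoidal.toMonoidal
  { εIso := Iso.refl _
    μIso X Y := isoOf (x := pair P X 0 ⊗ pair P Y 0) (y := pair P (X ⊗ Y) 0) (add_zero _)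
      (Iso.refl _)
    μIso_hom_natural_left {X Y} f Z := by
      simp only [functor_map, functor_obj, of_whiskerRight, isoOf_hom, of_comp_of]
      apply of_congr
      simp [tensor_pt]
    μIso_hom_natural_right {X Y} f Z := by
      simp only [functor_map, functor_obj, whiskerLeft_of, isoOf_hom, of_comp_of]
      apply of_congr
      simp [tensor_pt]
    associativity X Y Z := by
      simp only [functor_map, functor_obj, whiskerLeft_of, of_whiskerRight, isoOf_hom, of_comp_of,
        associator_eq]
      apply of_congr
      simp [tensor_pt]
    left_unitality X := by
      simp only [functor_map, functor_obj, isoOf_hom, leftUnitor_eq, Iso.refl_hom, id_eq_of,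
        of_whiskerRight, of_comp_of]
      apply of_congr
      simp [tensor_pt, unit_pt]
    right_unitality X := by
      simp only [functor_map, functor_obj, isoOf_hom, rightUnitor_eq, Iso.refl_hom, id_eq_of,
        whiskerLeft_of, of_comp_of]
      apply of_congr
      simp [tensor_pt, unit_pt] }

open Functor.LaxMonoidal Functor.OplaxMonoidal

lemma functor_μ (X Y : T) : μ (functor P) X Y =
    of (x := pair P X 0 ⊗ pair P Y 0) (y := pair P (X ⊗ Y) 0) (add_zero _) (𝟙 (X ⊗ Y)) := rfl

lemma functor_ε : ε (functor P) = 𝟙 (𝟙_ (Loc P)) := rfl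

/-- The isomorphism `(C^a ⊗ X, α) ≅ (X, deg a + α)`. -/
def isoShiftLeft (a : M) (X : T) {α β : G} (h : P.deg a + α = β) :
    pair P (P.C a ⊗ X) α ≅ pair P X β where
  hom := mk (x := pair P (P.C a ⊗ X) α) (y := pair P X β) (by simp [h])
    (P.repRight (P.r a X))
  inv := mk (x := pair P X β) (y := pair P (P.C a ⊗ X) α) (by simp [h])
    (P.repLeft (𝟙 (P.C a ⊗ X)))
  hom_inv_id := by
    rw [mk_comp _ _ (add_zero a) (zero_add a) (by simp), P.repRight_comp_repLeft,
      ← mk_r (pair P (P.C a ⊗ X) α) a rfl, ← h, add_sub_cancel_right]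
    congr 1
    change _ = (P.pow a).R (P.C a ⊗ X)
    -- The representative of the identity contains the scalar `R_{C^a}(C^a)`, which matches the
    -- factor `κ(deg a, deg a)` of the composition law.
    rw [(P.pow a).tensor, P.R_self]
    simp [ScalarCat.smul_comp, ScalarCat.comp_smul, ScalarCat.smul_whiskerRight,
      CentralPowers.k]
  inv_hom_id := by
    rw [mk_comp _ _ (zero_add a) (add_zero a) (by simp), ← mk_r (pair P X β) a rfl,
      P.repLeft_comp_repRight, map_zero, P.κ_zero_left, one_smul, Category.id_comp]

/-- The isomorphism `(X ⊗ C^a, α) ≅ (X, deg a + α)`. -/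
def isoShiftRight (a : M) (X : T) {α β : G} (h : P.deg a + α = β) :
    pair P (X ⊗ P.C a) α ≅ pair P X β where
  hom := mk (x := pair P (X ⊗ P.C a) α) (y := pair P X β) (by simp [h])
    (P.repRight (𝟙 (X ⊗ P.C a)))
  inv := mk (x := pair P X β) (y := pair P (X ⊗ P.C a) α) (by simp [h])
    (P.repLeft (P.r a X))
  hom_inv_id := by
    rw [mk_comp _ _ (add_zero a) (zero_add a) (by simp), P.repRight_comp_repLeft,
      ← mk_r (pair P (X ⊗ P.C a) α) a rfl, ← h, add_sub_cancel_right]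
    congr 1
    change _ = (P.pow a).R (X ⊗ P.C a)
    rw [(P.pow a).tensor, P.R_self]
    simp [ScalarCat.smul_comp, ScalarCat.comp_smul, ScalarCat.whiskerLeft_smul,
      CentralPowers.k]
  inv_hom_id := by
    rw [mk_comp _ _ (zero_add a) (add_zero a) (by simp), ← mk_r (pair P X β) a rfl,
      P.repLeft_comp_repRight, map_zero, P.κ_zero_left, one_smul, Category.comp_id]

/-- The braiding compares two isomorphisms onto the same object `(X, deg a + α)`; hence it becomes
invertible. -/
lemma of_R_comp_isoShiftRight (a : M) (X : T) {α β : G} (h : P.deg a + α = β) :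
    of (x := pair P (P.C a ⊗ X) α) (y := pair P (X ⊗ P.C a) α) rfl (P.r a X) ≫
      (isoShiftRight P a X h).hom = (isoShiftLeft P a X h).hom := by
  rw [isoShiftRight, of_comp_mk, isoShiftLeft]
  congr 1
  simp only [CentralPowers.repRight]
  rw [whisker_exchange_assoc, leftUnitor_naturality_assoc]
  simp

instance isIso_map_r (a : M) (X : T) : IsIso ((functor P).map (P.r a X)) := by
  have e : of (x := pair P (P.C a ⊗ X) 0) (y := pair P (X ⊗ P.C a) 0) rfl (P.r a X) =
      (isoShiftLeft P a X (add_zero (P.deg a)) ≪≫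
        (isoShiftRight P a X (add_zero (P.deg a))).symm).hom :=
    (Iso.eq_comp_inv _).2 (of_R_comp_isoShiftRight P a X (add_zero _))
  have : IsIso (of (x := pair P (P.C a ⊗ X) 0) (y := pair P (X ⊗ P.C a) 0) rfl (P.r a X)) := by
    rw [e]; infer_instance
  exact this

/-- The image of `C^a` is isomorphic to `(1, deg a)`, which has the inverse `(1, -deg a)`. -/
lemma isInvertibleObj_functor_obj (a : M) : IsInvertibleObj ((functor P).obj (P.C a)) := by
  have e : (functor P).obj (P.C a) ≅ pair P (𝟙_ T) (P.deg a) :=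
    (isoOf (x := pair P (P.C a) 0) (y := pair P (P.C a ⊗ 𝟙_ T) 0) rfl (ρ_ _).symm) ≪≫
      isoShiftLeft P a (𝟙_ T) (add_zero (P.deg a))
  have h (α β : G) (hαβ : α + β = 0) :
      Nonempty (pair P (𝟙_ T) α ⊗ pair P (𝟙_ T) β ≅ 𝟙_ (Loc P)) :=
    ⟨isoOf (x := pair P (𝟙_ T) α ⊗ pair P (𝟙_ T) β) (y := 𝟙_ (Loc P)) hαβ (λ_ _)⟩
  exact .of_iso e.symm (.of_inverse (h _ _ (add_neg_cancel _)).some (h _ _ (neg_add_cancel _)).some)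

/-- Every object becomes an object of `T` after tensoring with some `C^b`. -/
lemma exists_iso_functor_obj (z : Loc P) :
    ∃ (b : M) (X : T), Nonempty ((functor P).obj (P.C b) ⊗ z ≅ (functor P).obj X) := by
  obtain ⟨a, b, h⟩ := P.exists_deg_eq z.wt
  -- Tensoring with `C^b` raises the weight of `z` to `deg a`, which is then absorbed into the
  -- object as a factor `C^a`.
  refine ⟨b, P.C a ⊗ z.pt, ⟨?_⟩⟩
  exact isoOf (x := pair P (P.C b) 0 ⊗ z) (y := pair P (P.C b ⊗ z.pt) z.wt) (zero_add _)
      (Iso.refl _) ≪≫ isoShiftLeft P b z.pt h.symm ≪≫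
    (isoShiftLeft P a z.pt (add_zero _)).symm

/-- Every morphism between objects of `T` in the localization has a representative in `T`. -/
lemma exists_rep {X Y : T} (φ : (functor P).obj X ⟶ (functor P).obj Y) :
    ∃ (a : M) (f : P.C a ⊗ X ⟶ Y ⊗ P.C a) (h : P.deg a + 0 = P.deg a + 0),
      φ = mk (x := pair P X 0) (y := pair P Y 0) h f := by
  induction φ using ind with | @h a b h f =>
  obtain rfl : a = b := P.deg_injective (add_right_cancel h)
  exact ⟨a, f, h, rfl⟩

/-- Since `R_{C^a}(Y)` becomes invertible and `C^a` can be cancelled, this characterizes the class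
of `f` by morphisms coming from `T`, in a form that any monoidal functor preserves. The scalar
`R_{C^a}(C^a)` occurs on both sides. -/
lemma functor_map_rep {X Y : T} {a : M} (f : P.C a ⊗ X ⟶ Y ⊗ P.C a)
    (h : P.deg a + 0 = P.deg a + 0) :
    μ (functor P) _ _ ≫ (functor P).map f = (functor P).obj (P.C a) ◁
        mk (x := pair P X 0) (y := pair P Y 0) h f ≫
      μ (functor P) _ _ ≫ (functor P).map (P.r a Y) := by
  change of (x := pair P (P.C a) 0 ⊗ pair P X 0) (y := pair P (P.C a ⊗ X) 0) (add_zero _)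
      (𝟙 (P.C a ⊗ X)) ≫ of (x := pair P (P.C a ⊗ X) 0) (y := pair P (Y ⊗ P.C a) 0) rfl f =
    pair P (P.C a) 0 ◁ mk (x := pair P X 0) (y := pair P Y 0) h f ≫
      of (x := pair P (P.C a) 0 ⊗ pair P Y 0) (y := pair P (P.C a ⊗ Y) 0) (add_zero _)
        (𝟙 (P.C a ⊗ Y)) ≫
      of (x := pair P (P.C a ⊗ Y) 0) (y := pair P (Y ⊗ P.C a) 0) rfl (P.r a Y)
  rw [of_comp_of, of_comp_of, whiskerLeft_mk _ h (deg_whiskerLeft _ h), mk_comp_of,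
    of, ← mk_zeta (c := a) _ (by simp [tensor_wt]) (add_zero a) (add_zero a)]
  congr 1
  rw [CentralPowers.zeta, P.ofHom_comp_rep]
  change P.C a ◁ (𝟙 (P.C a ⊗ X) ≫ f) ≫ (P.pow a).R (Y ⊗ P.C a) =
    ((α_ _ _ _).inv ≫ ((P.pow a).R (P.C a) ▷ X) ≫ (α_ _ _ _).hom ≫ P.C a ◁ f ≫ (α_ _ _ _).inv) ≫
      (𝟙 (P.C a ⊗ Y) ≫ P.r a Y) ▷ P.C a
  rw [(P.pow a).tensor, P.R_self]
  simp [ScalarCat.smul_comp, ScalarCat.comp_smul, ScalarCat.whiskerLeft_smul,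
    ScalarCat.smul_whiskerRight]

lemma exists_map_eq {X Y : T} (φ : (functor P).obj X ⟶ (functor P).obj Y) :
    ∃ (a : M) (f : P.C a ⊗ X ⟶ Y ⊗ P.C a),
      μ (functor P) _ _ ≫ (functor P).map f = (functor P).obj (P.C a) ◁ φ ≫
        μ (functor P) _ _ ≫ (functor P).map (P.r a Y) := by
  obtain ⟨a, f, h, rfl⟩ := exists_rep P φ
  exact ⟨a, f, functor_map_rep P f h⟩

end Loc
end BraiderLocalization

/-! ### The `k`-linear structure of the localization -/

namespace BraiderLocalization

section

variable {k : Type x} [CommRing k] {T : Type u} [Category.{v} T] [MonoidalCategory T]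
  [Preadditive T] [Linear k T] [MonoidalPreadditive T] [MonoidalLinear k T]

instance : ScalarCat kˣ T where
  smul_comp r f g := by simp [Units.smul_def]
  comp_smul f r g := by simp [Units.smul_def]
  whiskerLeft_smul X _ _ r f := by simp [Units.smul_def]
  smul_whiskerRight X _ _ r f := by simp [Units.smul_def]

variable {M : Type w} [AddCommMonoid M] {G : Type w} [AddCommGroup G]
  (P : CentralPowers kˣ T M G)

namespace CentralPowers

lemma add_comp_rep {X Y Z : T} {a b c d s t : M} (hs : c + a = s) (ht : d + b = t)
    (f f' : P.Rep X a Y b) (g : P.Rep Y c Z d) :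
    P.comp hs ht (f + f') g = P.comp hs ht f g + P.comp hs ht f' g := by
  simp [comp, monoidalComp]

lemma rep_comp_add {X Y Z : T} {a b c d s t : M} (hs : c + a = s) (ht : d + b = t)
    (f : P.Rep X a Y b) (g g' : P.Rep Y c Z d) :
    P.comp hs ht f (g + g') = P.comp hs ht f g + P.comp hs ht f g' := by
  simp [comp, monoidalComp]

lemma smul_comp_rep' {X Y Z : T} {a b c d s t : M} (hs : c + a = s) (ht : d + b = t) (l : k)
    (f : P.Rep X a Y b) (g : P.Rep Y c Z d) :
    P.comp hs ht (l • f) g = l • P.comp hs ht f g := by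
  simp [comp, monoidalComp]

lemma rep_comp_smul' {X Y Z : T} {a b c d s t : M} (hs : c + a = s) (ht : d + b = t) (l : k)
    (f : P.Rep X a Y b) (g : P.Rep Y c Z d) :
    P.comp hs ht f (l • g) = l • P.comp hs ht f g := by
  simp [comp, monoidalComp]

lemma zeta_add {X Y : T} {a b a' b' c : M} (ha : c + a = a') (hb : c + b = b')
    (f g : P.Rep X a Y b) : P.zeta ha hb (f + g) = P.zeta ha hb f + P.zeta ha hb g :=
  P.add_comp_rep _ _ _ _ _

lemma zeta_smul' {X Y : T} {a b a' b' c : M} (ha : c + a = a') (hb : c + b = b') (l : k)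
    (f : P.Rep X a Y b) : P.zeta ha hb (l • f) = l • P.zeta ha hb f :=
  P.smul_comp_rep' _ _ _ _ _

lemma whiskerL_add (X : T) {Y Y' : T} {b b' : M} (g g' : P.Rep Y b Y' b') :
    P.whiskerL X (g + g') = P.whiskerL X g + P.whiskerL X g' := by
  simp [whiskerL]

lemma whiskerL_smul' (X : T) {Y Y' : T} {b b' : M} (l : k) (g : P.Rep Y b Y' b') :
    P.whiskerL X (l • g) = l • P.whiskerL X g := by
  simp [whiskerL]

lemma whiskerR_add {X X' : T} {a a' : M} (f f' : P.Rep X a X' a') (Y : T) :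
    P.whiskerR (f + f') Y = P.whiskerR f Y + P.whiskerR f' Y := by
  simp [whiskerR]

lemma whiskerR_smul' {X X' : T} {a a' : M} (l : k) (f : P.Rep X a X' a') (Y : T) :
    P.whiskerR (l • f) Y = l • P.whiskerR f Y := by
  simp [whiskerR]

end CentralPowers

namespace Loc

variable {P}

/-- Addition of morphisms of the localization. -/
def Hom.add {x y : Loc P} (φ ψ : Hom x y) : Hom x y :=
  φ.lift (fun {a b} h f => ψ.lift (fun {c d} h' g =>
    homMk (deg_zeta h rfl rfl) (P.zeta (c := c) rfl rfl f +
      P.zeta (c := a) (add_comm a c) (deg_common h h') g))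
    (by
      intro c d c' d' e h' h'' hc hd g
      refine Eq.trans ?_ (homMk_zeta (c := e) (deg_zeta h rfl rfl) (deg_zeta h rfl rfl)
        (by rw [← add_assoc, hc]) (by rw [← add_assoc, hc]) _)
      rw [P.zeta_add, P.zeta_zeta _ _ _ _ hc rfl rfl,
        P.zeta_zeta _ _ _ _ (add_comm e a) _ (by rw [add_assoc, hd, deg_common h h'']),
        P.zeta_zeta _ _ _ _ rfl]
      rw [← hc]; abel))
    (by
      intro a b a' b' e h h' ha hb f
      induction ψ using Hom.ind with | @h c d k g =>
      simp only [Hom.lift_homMk]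
      rw [← homMk_zeta (c := e) (deg_zeta h rfl rfl) (deg_zeta h' rfl rfl)
        (by rw [← ha, add_left_comm]) (by rw [← hb, add_left_comm]), P.zeta_add,
        P.zeta_zeta _ _ _ _ (add_comm e c),
        P.zeta_zeta _ _ _ _ ha,
        P.zeta_zeta _ _ _ _ rfl]
      · rw [add_assoc, ha]
      · rw [add_assoc, hb])

lemma Hom.homMk_add {x y : Loc P} {a b : M} (h : P.deg a + y.wt = P.deg b + x.wt)
    (f g : P.Rep x.pt a y.pt b) : (homMk h f).add (homMk h g) = homMk h (f + g) := by
  change homMk _ (P.zeta _ _ f + P.zeta _ _ g) = _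
  rw [← P.zeta_add, homMk_zeta]

variable (P) in
-- Supplies a degree in which to write the zero morphism; it exists because `M` generates `G`.
lemma exists_deg (x y : Loc P) : ∃ a b, P.deg a + y.wt = P.deg b + x.wt := by
  obtain ⟨a, b, h⟩ := P.exists_deg_eq (x.wt - y.wt)
  exact ⟨a, b, by rw [h]; abel⟩

lemma homMk_zero_eq {x y : Loc P} {a b c d : M} (h : P.deg a + y.wt = P.deg b + x.wt)
    (h' : P.deg c + y.wt = P.deg d + x.wt) :
    homMk h (0 : P.Rep x.pt a y.pt b) = homMk h' (0 : P.Rep x.pt c y.pt d) := by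
  have z {a b a' b' e : M} (ha : e + a = a') (hb : e + b = b') :
      P.zeta ha hb (0 : P.Rep x.pt a y.pt b) = 0 := by
    rw [← zero_smul k (0 : P.Rep x.pt a y.pt b), P.zeta_smul', zero_smul]
  rw [homMk_eq_iff]
  exact ⟨c, a, _, _, rfl, rfl, add_comm _ _, deg_common h h', by rw [z, z]⟩

lemma Hom.exists_common₃ {x y : Loc P} (φ ψ χ : Hom x y) :
    ∃ (a b : M) (h : P.deg a + y.wt = P.deg b + x.wt) (f g k : P.Rep x.pt a y.pt b),
      homMk h f = φ ∧ homMk h g = ψ ∧ homMk h k = χ := by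
  obtain ⟨a, b, h, f, g, rfl, rfl⟩ := Hom.exists_common φ ψ
  induction χ using Hom.ind with | @h c d h' k =>
  exact ⟨_, _, deg_zeta h rfl rfl, P.zeta rfl rfl f, P.zeta rfl rfl g,
    P.zeta (add_comm _ _) (deg_common h h') k,
    homMk_zeta _ _ _ _ _, homMk_zeta _ _ _ _ _, homMk_zeta _ _ _ _ _⟩

/-- Scalar multiplication of morphisms of the localization. -/
def Hom.smul {x y : Loc P} (r : k) (φ : Hom x y) : Hom x y :=
  φ.lift (fun {_ _} h f => homMk h (r • f)) (by
    intro a b a' b' e h h' ha hb f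
    rw [← P.zeta_smul', homMk_zeta])

/-- The zero morphism of the localization. -/
noncomputable def Hom.zero (x y : Loc P) : Hom x y :=
  homMk (exists_deg P x y).choose_spec.choose_spec 0

lemma Hom.zero_eq {x y : Loc P} {a b : M} (h : P.deg a + y.wt = P.deg b + x.wt) :
    Hom.zero x y = homMk h (0 : P.Rep x.pt a y.pt b) := homMk_zero_eq _ _

noncomputable instance (x y : Loc P) : AddCommGroup (x ⟶ y) where
  add := Hom.add
  zero := Hom.zero x y
  neg := Hom.smul (-1 : k)
  nsmul := @nsmulRec _ ⟨Hom.zero x y⟩ ⟨Hom.add⟩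
  zsmul := @zsmulRec _ ⟨Hom.zero x y⟩ ⟨Hom.add⟩ ⟨Hom.smul (-1 : k)⟩
    (@nsmulRec _ ⟨Hom.zero x y⟩ ⟨Hom.add⟩)
  add_assoc φ ψ χ := by
    obtain ⟨a, b, h, f, g, k, rfl, rfl, rfl⟩ := Hom.exists_common₃ φ ψ χ
    change ((homMk h f).add (homMk h g)).add (homMk h k) =
      (homMk h f).add ((homMk h g).add (homMk h k))
    simp only [Hom.homMk_add, add_assoc]
  zero_add φ := by
    induction φ using Hom.ind with | h h f =>
    change (Hom.zero x y).add (homMk h f) = homMk h f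
    rw [Hom.zero_eq h, Hom.homMk_add, zero_add]
  add_zero φ := by
    induction φ using Hom.ind with | h h f =>
    change (homMk h f).add (Hom.zero x y) = homMk h f
    rw [Hom.zero_eq h, Hom.homMk_add, add_zero]
  neg_add_cancel φ := by
    induction φ using Hom.ind with | h h f =>
    change (homMk h ((-1 : k) • f)).add (homMk h f) = Hom.zero x y
    rw [Hom.zero_eq h, Hom.homMk_add, neg_one_smul, neg_add_cancel]
  add_comm φ ψ := by
    obtain ⟨a, b, h, f, g, rfl, rfl⟩ := Hom.exists_common φ ψ
    change (homMk h f).add (homMk h g) = (homMk h g).add (homMk h f)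
    simp only [Hom.homMk_add, add_comm]

lemma mk_add {x y : Loc P} {a b : M} (h : P.deg a + y.wt = P.deg b + x.wt)
    (f g : P.Rep x.pt a y.pt b) : mk h f + mk h g = mk h (f + g) := Hom.homMk_add h f g

noncomputable instance (x y : Loc P) : Module k (x ⟶ y) where
  smul := Hom.smul
  one_smul φ := by
    induction φ using Hom.ind with | h h f =>
    exact congrArg (homMk h) (one_smul k f)
  mul_smul r s φ := by
    induction φ using Hom.ind with | h h f =>
    exact congrArg (homMk h) (mul_smul r s f)
  smul_zero r := by
    obtain ⟨a, b, h⟩ := exists_deg P x y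
    change Hom.smul r (Hom.zero x y) = Hom.zero x y
    rw [Hom.zero_eq h]
    exact congrArg (homMk h) (smul_zero r)
  zero_smul φ := by
    induction φ using Hom.ind with | h h f =>
    change _ = Hom.zero x y
    rw [Hom.zero_eq h]
    exact congrArg (homMk h) (zero_smul k f)
  smul_add r φ ψ := by
    obtain ⟨a, b, h, f, g, rfl, rfl⟩ := Hom.exists_common φ ψ
    change Hom.smul r ((homMk h f).add (homMk h g)) = (homMk h (r • f)).add (homMk h (r • g))
    rw [Hom.homMk_add, Hom.homMk_add, ← smul_add]
    rfl
  add_smul r s φ := by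
    induction φ using Hom.ind with | h h f =>
    change homMk h ((r + s) • f) = (homMk h (r • f)).add (homMk h (s • f))
    rw [Hom.homMk_add, add_smul]

lemma smul_mk {x y : Loc P} {a b : M} (h : P.deg a + y.wt = P.deg b + x.wt) (r : k)
    (f : P.Rep x.pt a y.pt b) : r • mk h f = mk h (r • f) := rfl

noncomputable instance : Preadditive (Loc P) where
  add_comp x y z φ φ' ψ := by
    obtain ⟨a, b, h, f, f', rfl, rfl⟩ := exists_common φ φ'
    induction ψ using ind with | h h' g =>
    have e := deg_comp h h' rfl rfl
    rw [mk_add, mk_comp _ _ rfl rfl e, mk_comp _ _ rfl rfl e, mk_comp _ _ rfl rfl e, mk_add,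
      P.add_comp_rep, smul_add]
  comp_add x y z φ ψ ψ' := by
    obtain ⟨a, b, h', g, g', rfl, rfl⟩ := exists_common ψ ψ'
    induction φ using ind with | h h f =>
    have e := deg_comp h h' rfl rfl
    rw [mk_add, mk_comp _ _ rfl rfl e, mk_comp _ _ rfl rfl e, mk_comp _ _ rfl rfl e, mk_add,
      P.rep_comp_add, smul_add]

noncomputable instance : Linear k (Loc P) where
  smul_comp x y z r φ ψ := by
    induction φ using ind with | h h f =>
    induction ψ using ind with | h h' g =>
    have e := deg_comp h h' rfl rfl
    rw [smul_mk, mk_comp _ _ rfl rfl e, mk_comp _ _ rfl rfl e, smul_mk,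
      P.smul_comp_rep', smul_comm]
  comp_smul x y z φ r ψ := by
    induction φ using ind with | h h f =>
    induction ψ using ind with | h h' g =>
    have e := deg_comp h h' rfl rfl
    rw [smul_mk, mk_comp _ _ rfl rfl e, mk_comp _ _ rfl rfl e, smul_mk,
      P.rep_comp_smul', smul_comm]

lemma whiskerLeft_add' (x : Loc P) {y z : Loc P} (φ ψ : y ⟶ z) :
    x ◁ (φ + ψ) = x ◁ φ + x ◁ ψ := by
  obtain ⟨a, b, h, f, g, rfl, rfl⟩ := exists_common φ ψ
  have e := deg_whiskerLeft x h
  rw [mk_add, whiskerLeft_mk x h e, whiskerLeft_mk x h e, whiskerLeft_mk x h e, mk_add,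
    P.whiskerL_add]

lemma add_whiskerRight' (x : Loc P) {y z : Loc P} (φ ψ : y ⟶ z) :
    (φ + ψ) ▷ x = φ ▷ x + ψ ▷ x := by
  obtain ⟨a, b, h, f, g, rfl, rfl⟩ := exists_common φ ψ
  have e := deg_whiskerRight x h
  rw [mk_add, mk_whiskerRight x h e, mk_whiskerRight x h e, mk_whiskerRight x h e, mk_add,
    P.whiskerR_add, smul_add]

lemma whiskerLeft_smul' (x : Loc P) {y z : Loc P} (r : k) (φ : y ⟶ z) :
    x ◁ (r • φ) = r • x ◁ φ := by
  induction φ using ind with | h h f =>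
  have e := deg_whiskerLeft x h
  rw [smul_mk, whiskerLeft_mk x h e, whiskerLeft_mk x h e, smul_mk, P.whiskerL_smul']

lemma smul_whiskerRight' (x : Loc P) {y z : Loc P} (r : k) (φ : y ⟶ z) :
    (r • φ) ▷ x = r • φ ▷ x := by
  induction φ using ind with | h h f =>
  have e := deg_whiskerRight x h
  rw [smul_mk, mk_whiskerRight x h e, mk_whiskerRight x h e, smul_mk, P.whiskerR_smul', smul_comm]

instance : MonoidalPreadditive (Loc P) where
  whiskerLeft_zero {x y z} := by
    simpa using whiskerLeft_smul' x (0 : k) (0 : y ⟶ z)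
  zero_whiskerRight {x y z} := by
    simpa using smul_whiskerRight' x (0 : k) (0 : y ⟶ z)
  whiskerLeft_add {x y z} φ ψ := whiskerLeft_add' x φ ψ
  add_whiskerRight {x y z} φ ψ := add_whiskerRight' x φ ψ

instance : MonoidalLinear k (Loc P) where
  whiskerLeft_smul x _ _ r φ := whiskerLeft_smul' x r φ
  smul_whiskerRight r _ _ φ x := smul_whiskerRight' x r φ

lemma of_add {x y : Loc P} (h : x.wt = y.wt) (f g : x.pt ⟶ y.pt) :
    of h (f + g) = of h f + of h g := by
  rw [of, of, of, mk_add]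
  congr 1
  simp [CentralPowers.ofHom]

lemma of_smul {x y : Loc P} (h : x.wt = y.wt) (r : k) (f : x.pt ⟶ y.pt) :
    of h (r • f) = r • of h f := by
  rw [of, of, smul_mk]
  congr 1
  simp [CentralPowers.ofHom]

instance : (functor P).Additive where
  map_add {X Y f g} := of_add (x := pair P X 0) (y := pair P Y 0) rfl f g

instance : (functor P).Linear k where
  map_smul {X Y} f r := of_smul (x := pair P X 0) (y := pair P Y 0) rfl r f

end Loc
end
end BraiderLocalization

/-! ### Tensor products of words of braiders and rearrangements of letters -/

namespace BraiderLocalization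

namespace Braider

variable {T : Type u} [Category.{v} T] [MonoidalCategory T]

/-- The unit object as a braider. -/
@[simps]
def unitBraider : Braider T where
  pt := 𝟙_ T
  R X := (λ_ X).hom ≫ (ρ_ X).inv
  naturality f := by simp
  tensor X Y := by monoidal
  unit := by monoidal

/-- The tensor product of two braiders. -/
@[simps]
def prod (B B' : Braider T) : Braider T where
  pt := B.pt ⊗ B'.pt
  R X := (α_ _ _ _).hom ≫ (B.pt ◁ B'.R X) ≫ (α_ _ _ _).inv ≫ (B.R X ▷ B'.pt) ≫ (α_ _ _ _).hom
  naturality {X Y} f := by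
    calc _ = 𝟙 _ ⊗≫ B.pt ◁ (B'.pt ◁ f ≫ B'.R Y) ⊗≫ B.R Y ▷ B'.pt ⊗≫ 𝟙 _ := by monoidal
      _ = 𝟙 _ ⊗≫ B.pt ◁ B'.R X ⊗≫ (B.pt ◁ f ≫ B.R Y) ▷ B'.pt ⊗≫ 𝟙 _ := by
        rw [B'.naturality]; monoidal
      _ = _ := by rw [B.naturality]; monoidal
  tensor X Y := by
    rw [B.tensor, B'.tensor]
    calc _ = 𝟙 _ ⊗≫ B.pt ◁ B'.R X ▷ Y ⊗≫ ((B.pt ⊗ X) ◁ B'.R Y ≫ B.R X ▷ (Y ⊗ B'.pt)) ⊗≫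
          X ◁ B.R Y ▷ B'.pt ⊗≫ 𝟙 _ := by monoidal
      _ = _ := by rw [whisker_exchange]; monoidal
  unit := by
    have h : B.R (𝟙_ T) = (ρ_ _).hom ≫ (λ_ _).inv := by rw [← B.unit]; simp
    have h' : B'.R (𝟙_ T) = (ρ_ _).hom ≫ (λ_ _).inv := by rw [← B'.unit]; simp
    rw [h, h']; monoidal

end Braider

section Words

variable {k : Type x} [CommRing k] {T : Type u} [Category.{v} T] [MonoidalCategory T]
  [Preadditive T] [Linear k T] [MonoidalPreadditive T] [MonoidalLinear k T] {I : Type w}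
  (C : I → Braider T)

/-- The tensor product of the braiders of a word. -/
def word : List I → Braider T
  | [] => Braider.unitBraider
  | i :: l => (C i).prod (word l)

/-- The object underlying the tensor product of a word. -/
abbrev W (l : List I) : T := (word C l).pt

/-- Concatenation of words. -/
def append : ∀ l m : List I, W C l ⊗ W C m ≅ W C (l ++ m)
  | [], m => λ_ (W C m)
  | i :: l, m => α_ _ _ _ ≪≫ whiskerLeftIso (C i).pt (append l m)

lemma append_cons_hom (i : I) (l m : List I) : (append C (i :: l) m).hom =
    (α_ (C i).pt (W C l) (W C m)).hom ≫ (C i).pt ◁ (append C l m).hom := rfl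

lemma append_braider (l m : List I) (X : T) :
    ((append C l m).hom ▷ X) ≫ (word C (l ++ m)).R X =
      (α_ _ _ _).hom ≫ (W C l ◁ (word C m).R X) ≫ (α_ _ _ _).inv ≫
        ((word C l).R X ▷ W C m) ≫ (α_ _ _ _).hom ≫ (X ◁ (append C l m).hom) := by
  induction l with
  | nil =>
    change (λ_ (W C m)).hom ▷ X ≫ (word C m).R X = (α_ (𝟙_ T) (W C m) X).hom ≫
      (𝟙_ T ◁ (word C m).R X) ≫ (α_ _ _ _).inv ≫
        (((λ_ X).hom ≫ (ρ_ X).inv) ▷ W C m) ≫ (α_ _ _ _).hom ≫ (X ◁ (λ_ (W C m)).hom)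
    monoidal
  | cons i l ih =>
    change ((α_ (C i).pt (W C l) (W C m)).hom ≫ (C i).pt ◁ (append C l m).hom) ▷ X ≫
      (α_ (C i).pt (W C (l ++ m)) X).hom ≫ ((C i).pt ◁ (word C (l ++ m)).R X) ≫ (α_ _ _ _).inv ≫
        ((C i).R X ▷ W C (l ++ m)) ≫ (α_ _ _ _).hom =
      (α_ ((C i).pt ⊗ W C l) (W C m) X).hom ≫ (((C i).pt ⊗ W C l) ◁ (word C m).R X) ≫
        (α_ _ _ _).inv ≫ (((α_ _ _ _).hom ≫ ((C i).pt ◁ (word C l).R X) ≫ (α_ _ _ _).inv ≫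
        ((C i).R X ▷ W C l) ≫ (α_ _ _ _).hom) ▷ W C m) ≫ (α_ _ _ _).hom ≫
        (X ◁ ((α_ (C i).pt (W C l) (W C m)).hom ≫ (C i).pt ◁ (append C l m).hom))
    calc _ = 𝟙 _ ⊗≫ (C i).pt ◁ ((append C l m).hom ▷ X ≫ (word C (l ++ m)).R X) ⊗≫
          ((C i).R X ▷ W C (l ++ m)) ⊗≫ 𝟙 _ := by monoidal
      _ = 𝟙 _ ⊗≫ (C i).pt ◁ W C l ◁ (word C m).R X ⊗≫ (C i).pt ◁ (word C l).R X ▷ W C m ⊗≫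
          (((C i).pt ⊗ X) ◁ (append C l m).hom ≫ (C i).R X ▷ W C (l ++ m)) ⊗≫ 𝟙 _ := by
        rw [ih]; monoidal
      _ = _ := by rw [whisker_exchange]; monoidal

variable (η : I → I → kˣ)

/-- The renormalized braiding of two letters. -/
def letterSwap (i j : I) : (C i).pt ⊗ (C j).pt ⟶ (C j).pt ⊗ (C i).pt :=
  (η i j)⁻¹ • (C i).R (C j).pt

/-- The renormalized braiding of the first two letters of a word. -/
def swap (i j : I) (l : List I) : W C (i :: j :: l) ⟶ W C (j :: i :: l) :=
  (α_ (C i).pt (C j).pt (W C l)).inv ≫ letterSwap C η i j ▷ W C l ≫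
    (α_ (C j).pt (C i).pt (W C l)).hom

/-- Naturality of `R_{C_i}` with respect to the morphism `R_{C_j}(C_m)`, expanded by the tensor
axiom, is the Yang-Baxter equation. The same three factors `η` occur on both sides. -/
lemma letterSwap_yang_baxter (i j m : I) :
    (C i).pt ◁ letterSwap C η j m ≫ (α_ _ _ _).inv ≫ letterSwap C η i m ▷ (C j).pt ≫
      (α_ _ _ _).hom ≫ (C m).pt ◁ letterSwap C η i j =
    (α_ _ _ _).inv ≫ letterSwap C η i j ▷ (C m).pt ≫ (α_ _ _ _).hom ≫
      (C j).pt ◁ letterSwap C η i m ≫ (α_ _ _ _).inv ≫ letterSwap C η j m ▷ (C i).pt ≫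
      (α_ _ _ _).hom := by
  have n := (C i).naturality ((C j).R (C m).pt)
  rw [(C i).tensor, (C i).tensor] at n
  simp only [letterSwap, Units.smul_def, Linear.smul_comp, Linear.comp_smul,
    MonoidalLinear.whiskerLeft_smul, MonoidalLinear.smul_whiskerRight, smul_smul]
  congr 1
  · ring
  · rw [← cancel_mono (α_ _ _ _).inv]
    simpa using n

lemma swap_naturality (i j : I) {l l' : List I} (f : W C l ⟶ W C l') :
    (C i).pt ◁ (C j).pt ◁ f ≫ swap C η i j l' = swap C η i j l ≫ (C j).pt ◁ (C i).pt ◁ f := by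
  calc _ = 𝟙 ((C i).pt ⊗ (C j).pt ⊗ W C l) ⊗≫
        (((C i).pt ⊗ (C j).pt) ◁ f ≫ letterSwap C η i j ▷ W C l') ⊗≫
          𝟙 ((C j).pt ⊗ (C i).pt ⊗ W C l') := by
        simp only [swap]; monoidal
    _ = _ := by rw [whisker_exchange]; simp only [swap]; monoidal

lemma swap_yang_baxter (i j m : I) (l : List I) :
    (C i).pt ◁ swap C η j m l ≫ swap C η i m (j :: l) ≫ (C m).pt ◁ swap C η i j l =
      swap C η i j (m :: l) ≫ (C j).pt ◁ swap C η i m l ≫ swap C η j m (i :: l) := by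
  calc _ = 𝟙 ((C i).pt ⊗ (C j).pt ⊗ (C m).pt ⊗ W C l) ⊗≫
        ((C i).pt ◁ letterSwap C η j m ≫ (α_ _ _ _).inv ≫ letterSwap C η i m ▷ (C j).pt ≫
      (α_ _ _ _).hom ≫ (C m).pt ◁ letterSwap C η i j) ▷ W C l ⊗≫
          𝟙 ((C m).pt ⊗ (C j).pt ⊗ (C i).pt ⊗ W C l) := by
        simp only [swap]
        change _ ≫ ((α_ _ _ ((C j).pt ⊗ W C l)).inv ≫ _ ▷ ((C j).pt ⊗ W C l) ≫
          (α_ _ _ ((C j).pt ⊗ W C l)).hom) ≫ _ = _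
        monoidal
    _ = _ := by
        rw [letterSwap_yang_baxter]
        simp only [swap]
        change _ = ((α_ _ _ ((C m).pt ⊗ W C l)).inv ≫ _ ▷ ((C m).pt ⊗ W C l) ≫
          (α_ _ _ ((C m).pt ⊗ W C l)).hom) ≫ _ ≫ ((α_ _ _ ((C i).pt ⊗ W C l)).inv ≫
          _ ▷ ((C i).pt ⊗ W C l) ≫ (α_ _ _ ((C i).pt ⊗ W C l)).hom)
        monoidal

/-- Naturality of `R_{C_i}` with respect to `R_{C_j}(X)` makes the exchange of two letters a
morphism of braiders. -/
lemma swap_braider (i j : I) (l : List I) (X : T) :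
    swap C η i j l ▷ X ≫ (word C (j :: i :: l)).R X =
      (word C (i :: j :: l)).R X ≫ X ◁ swap C η i j l := by
  have n := (C i).naturality ((C j).R X)
  rw [(C i).tensor, (C i).tensor] at n
  have n' : letterSwap C η i j ▷ X ≫ (α_ _ _ _).hom ≫ (C j).pt ◁ (C i).R X ≫ (α_ _ _ _).inv ≫
      (C j).R X ▷ (C i).pt ≫ (α_ _ _ _).hom = (α_ _ _ _).hom ≫ (C i).pt ◁ (C j).R X ≫
        (α_ _ _ _).inv ≫ (C i).R X ▷ (C j).pt ≫ (α_ _ _ _).hom ≫ X ◁ letterSwap C η i j := by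
    simp only [letterSwap, Units.smul_def, Linear.smul_comp, Linear.comp_smul,
      MonoidalLinear.whiskerLeft_smul, MonoidalLinear.smul_whiskerRight]
    congr 1
    rw [← cancel_epi (α_ _ _ _).inv, ← cancel_mono (α_ _ _ _).inv]
    simpa using n.symm
  change ((α_ (C i).pt (C j).pt (W C l)).inv ≫ letterSwap C η i j ▷ W C l ≫
    (α_ (C j).pt (C i).pt (W C l)).hom) ▷ X ≫ ((α_ (C j).pt ((C i).pt ⊗ W C l) X).hom ≫
      (C j).pt ◁ ((α_ (C i).pt (W C l) X).hom ≫ (C i).pt ◁ (word C l).R X ≫ (α_ _ _ _).inv ≫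
        (C i).R X ▷ W C l ≫ (α_ _ _ _).hom) ≫ (α_ _ _ _).inv ≫
          (C j).R X ▷ ((C i).pt ⊗ W C l) ≫ (α_ _ _ _).hom) =
    ((α_ (C i).pt ((C j).pt ⊗ W C l) X).hom ≫
      (C i).pt ◁ ((α_ (C j).pt (W C l) X).hom ≫ (C j).pt ◁ (word C l).R X ≫ (α_ _ _ _).inv ≫
        (C j).R X ▷ W C l ≫ (α_ _ _ _).hom) ≫ (α_ _ _ _).inv ≫
          (C i).R X ▷ ((C j).pt ⊗ W C l) ≫ (α_ _ _ _).hom) ≫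
    X ◁ ((α_ (C i).pt (C j).pt (W C l)).inv ≫ letterSwap C η i j ▷ W C l ≫
    (α_ (C j).pt (C i).pt (W C l)).hom)
  calc _ = 𝟙 _ ⊗≫ (letterSwap C η i j ▷ (W C l ⊗ X) ≫
        ((C j).pt ⊗ (C i).pt) ◁ (word C l).R X) ⊗≫
        (C j).pt ◁ (C i).R X ▷ W C l ⊗≫ (C j).R X ▷ ((C i).pt ⊗ W C l) ⊗≫ 𝟙 _ := by monoidal
    _ = 𝟙 _ ⊗≫ ((C i).pt ⊗ (C j).pt) ◁ (word C l).R X ⊗≫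
        (letterSwap C η i j ▷ X ≫ (α_ _ _ _).hom ≫ (C j).pt ◁ (C i).R X ≫ (α_ _ _ _).inv ≫
      (C j).R X ▷ (C i).pt ≫ (α_ _ _ _).hom) ▷ W C l ⊗≫ 𝟙 _ := by
        rw [← whisker_exchange]; monoidal
    _ = _ := by rw [n']; monoidal

variable {C η}

/-- The maps between words obtained by permuting letters. -/
inductive Perm (C : I → Braider T) (η : I → I → kˣ) : ∀ l l' : List I, (W C l ⟶ W C l') → Prop
  | refl (l : List I) : Perm C η l l (𝟙 _)
  | cons (i : I) {l l' : List I} {f : W C l ⟶ W C l'} : Perm C η l l' f →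
      Perm C η (i :: l) (i :: l') ((C i).pt ◁ f : (C i).pt ⊗ W C l ⟶ (C i).pt ⊗ W C l')
  | swap (i j : I) (l : List I) : Perm C η (i :: j :: l) (j :: i :: l) (swap C η i j l)
  | trans {l l' l'' : List I} {f : W C l ⟶ W C l'} {g : W C l' ⟶ W C l''} :
      Perm C η l l' f → Perm C η l' l'' g → Perm C η l l'' (f ≫ g)

namespace Perm

lemma exists_of_perm (C : I → Braider T) (η : I → I → kˣ) {l l' : List I} (h : l.Perm l') :
    ∃ f, Perm C η l l' f := by
  induction h with
  | nil => exact ⟨_, refl _⟩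
  | cons i _ ih => exact ⟨_, cons i ih.choose_spec⟩
  | swap i j l => exact ⟨_, swap j i l⟩
  | trans _ _ ih ih' => exact ⟨_, trans ih.choose_spec ih'.choose_spec⟩

lemma braider {l l' : List I} {f : W C l ⟶ W C l'} (h : Perm C η l l' f) (X : T) :
    f ▷ X ≫ (word C l').R X = (word C l).R X ≫ X ◁ f := by
  induction h with
  | refl l => simp
  | cons i h ih =>
    rename_i l l' f
    change ((C i).pt ◁ f) ▷ X ≫ ((α_ (C i).pt (W C l') X).hom ≫ (C i).pt ◁ (word C l').R X ≫
      (α_ _ _ _).inv ≫ (C i).R X ▷ W C l' ≫ (α_ _ _ _).hom) = ((α_ (C i).pt (W C l) X).hom ≫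
      (C i).pt ◁ (word C l).R X ≫ (α_ _ _ _).inv ≫ (C i).R X ▷ W C l ≫ (α_ _ _ _).hom) ≫
        X ◁ (C i).pt ◁ f
    calc _ = 𝟙 _ ⊗≫ (C i).pt ◁ (f ▷ X ≫ (word C l').R X) ⊗≫ (C i).R X ▷ W C l' ⊗≫ 𝟙 _ := by
          monoidal
      _ = 𝟙 _ ⊗≫ (C i).pt ◁ (word C l).R X ⊗≫ (((C i).pt ⊗ X) ◁ f ≫ (C i).R X ▷ W C l') ⊗≫
          𝟙 _ := by
          rw [ih]; monoidal
      _ = _ := by rw [whisker_exchange]; monoidal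
  | swap i j l => exact swap_braider C η i j l X
  | trans h h' ih ih' =>
    rw [comp_whiskerRight, Category.assoc, ih', reassoc_of% ih, whiskerLeft_comp]

lemma append_left (m : List I) {l l' : List I} {f : W C l ⟶ W C l'} (h : Perm C η l l' f) :
    ∃ f', Perm C η (m ++ l) (m ++ l') f' ∧
      W C m ◁ f ≫ (append C m l').hom = (append C m l).hom ≫ f' := by
  induction m with
  | nil => exact ⟨f, h, leftUnitor_naturality f⟩
  | cons i m ih =>
    obtain ⟨f', h', e⟩ := ih
    refine ⟨_, cons i h', ?_⟩
    change ((C i).pt ⊗ W C m) ◁ f ≫ (α_ (C i).pt (W C m) (W C l')).hom ≫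
      (C i).pt ◁ (append C m l').hom = ((α_ (C i).pt (W C m) (W C l)).hom ≫
        (C i).pt ◁ (append C m l).hom) ≫ (C i).pt ◁ f'
    calc _ = 𝟙 _ ⊗≫ (C i).pt ◁ (W C m ◁ f ≫ (append C m l').hom) ⊗≫ 𝟙 _ := by monoidal
      _ = _ := by rw [e]; monoidal

lemma append_right (m : List I) {l l' : List I} {f : W C l ⟶ W C l'} (h : Perm C η l l' f) :
    ∃ f', Perm C η (l ++ m) (l' ++ m) f' ∧
      f ▷ W C m ≫ (append C l' m).hom = (append C l m).hom ≫ f' := by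
  induction h with
  | refl l => exact ⟨_, refl _, by simp⟩
  | cons i h ih =>
    rename_i l l' f
    obtain ⟨f', h', e⟩ := ih
    refine ⟨_, cons i h', ?_⟩
    change ((C i).pt ◁ f) ▷ W C m ≫ (α_ (C i).pt (W C l') (W C m)).hom ≫
      (C i).pt ◁ (append C l' m).hom = ((α_ (C i).pt (W C l) (W C m)).hom ≫
        (C i).pt ◁ (append C l m).hom) ≫ (C i).pt ◁ f'
    calc _ = 𝟙 _ ⊗≫ (C i).pt ◁ (f ▷ W C m ≫ (append C l' m).hom) ⊗≫ 𝟙 _ := by monoidal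
      _ = _ := by rw [e]; monoidal
  | swap i j l =>
    refine ⟨_, swap i j _, ?_⟩
    rw [append_cons_hom, append_cons_hom, append_cons_hom, append_cons_hom]
    simp only [BraiderLocalization.swap]
    change ((α_ (C i).pt (C j).pt (W C l)).inv ≫ letterSwap C η i j ▷ W C l ≫
      (α_ (C j).pt (C i).pt (W C l)).hom) ▷ W C m ≫ (α_ (C j).pt ((C i).pt ⊗ W C l) (W C m)).hom ≫
      (C j).pt ◁ ((α_ (C i).pt (W C l) (W C m)).hom ≫ (C i).pt ◁ (append C l m).hom) =
      ((α_ (C i).pt ((C j).pt ⊗ W C l) (W C m)).hom ≫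
      (C i).pt ◁ ((α_ (C j).pt (W C l) (W C m)).hom ≫ (C j).pt ◁ (append C l m).hom)) ≫
      (α_ (C i).pt (C j).pt (W C (l ++ m))).inv ≫ letterSwap C η i j ▷ W C (l ++ m) ≫
      (α_ (C j).pt (C i).pt (W C (l ++ m))).hom
    calc _ = 𝟙 _ ⊗≫ (letterSwap C η i j ▷ (W C l ⊗ W C m) ≫
          ((C j).pt ⊗ (C i).pt) ◁ (append C l m).hom) ⊗≫ 𝟙 _ := by monoidal
      _ = _ := by rw [← whisker_exchange]; monoidal
  | trans h h' ih ih' =>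
    obtain ⟨f, hf, e⟩ := ih
    obtain ⟨g, hg, e'⟩ := ih'
    exact ⟨_, trans hf hg, by rw [comp_whiskerRight, Category.assoc, e', reassoc_of% e]⟩

end Perm

/-- The two bracketed concatenations are equal lists, but not by definition. The comparison is
recorded as a rearrangement, built from identities, rather than as a transport, so that uniqueness
of rearrangements applies to it. -/
lemma append_assoc_perm (C : I → Braider T) (η : I → I → kˣ) (l m n : List I) :
    ∃ f, Perm C η ((l ++ m) ++ n) (l ++ (m ++ n)) f ∧
      (append C l m).hom ▷ W C n ≫ (append C (l ++ m) n).hom ≫ f =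
        (α_ _ _ _).hom ≫ W C l ◁ (append C m n).hom ≫ (append C l (m ++ n)).hom := by
  induction l with
  | nil =>
    refine ⟨_, Perm.refl _, ?_⟩
    change (λ_ (W C m)).hom ▷ W C n ≫ (append C m n).hom ≫ 𝟙 _ =
      (α_ (𝟙_ T) _ _).hom ≫ 𝟙_ T ◁ (append C m n).hom ≫ (λ_ _).hom
    monoidal
  | cons i l ih =>
    obtain ⟨f, h, e⟩ := ih
    refine ⟨_, Perm.cons i h, ?_⟩
    change ((α_ (C i).pt (W C l) (W C m)).hom ≫ (C i).pt ◁ (append C l m).hom) ▷ W C n ≫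
      ((α_ (C i).pt (W C (l ++ m)) (W C n)).hom ≫ (C i).pt ◁ (append C (l ++ m) n).hom) ≫
        (C i).pt ◁ f = (α_ ((C i).pt ⊗ W C l) (W C m) (W C n)).hom ≫
        ((C i).pt ⊗ W C l) ◁ (append C m n).hom ≫ (α_ (C i).pt (W C l) (W C (m ++ n))).hom ≫
          (C i).pt ◁ (append C l (m ++ n)).hom
    calc _ = 𝟙 _ ⊗≫ (C i).pt ◁ ((append C l m).hom ▷ W C n ≫ (append C (l ++ m) n).hom ≫ f) ⊗≫
          𝟙 _ := by monoidal
      _ = _ := by rw [e]; monoidal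

lemma append_nil_perm (C : I → Braider T) (η : I → I → kˣ) (l : List I) :
    ∃ f, Perm C η l (l ++ []) f ∧ (append C l []).hom = (ρ_ _).hom ≫ f := by
  induction l with
  | nil => exact ⟨_, Perm.refl _, by rw [Category.comp_id]; exact unitors_equal⟩
  | cons i l ih =>
    obtain ⟨f, h, e⟩ := ih
    refine ⟨_, Perm.cons i h, ?_⟩
    change (α_ (C i).pt (W C l) (𝟙_ T)).hom ≫ (C i).pt ◁ (append C l []).hom =
      (ρ_ ((C i).pt ⊗ W C l)).hom ≫ (C i).pt ◁ f
    rw [e]; monoidal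

end Words
end BraiderLocalization

/-! ### Coherence of rearrangements by insertion sort -/

namespace BraiderLocalization

section Words

variable {k : Type x} [CommRing k] {T : Type u} [Category.{v} T] [MonoidalCategory T]
  [Preadditive T] [Linear k T] [MonoidalPreadditive T] [MonoidalLinear k T] {I : Type w}
  {C : I → Braider T} {η : I → I → kˣ}

/-- The units `η` are a commutation matrix of the family `C`. -/
structure IsCommutationMatrix (C : I → Braider T) (η : I → I → kˣ) : Prop where
  self_eq : ∀ i, (C i).R (C i).pt = ((η i i : kˣ) : k) • 𝟙 ((C i).pt ⊗ (C i).pt)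
  pair_eq : ∀ i j, (C i).R (C j).pt ≫ (C j).R (C i).pt =
    ((η i j * η j i : kˣ) : k) • 𝟙 ((C i).pt ⊗ (C j).pt)

namespace IsCommutationMatrix

variable (hη : IsCommutationMatrix C η)
include hη

lemma letterSwap_self (i : I) : letterSwap C η i i = 𝟙 _ := by
  rw [letterSwap, hη.self_eq, ← Units.smul_def, inv_smul_smul]

lemma letterSwap_letterSwap (i j : I) : letterSwap C η i j ≫ letterSwap C η j i = 𝟙 _ := by
  simp only [letterSwap, Units.smul_def, Linear.smul_comp, Linear.comp_smul, hη.pair_eq, smul_smul]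
  rw [← Units.val_mul, ← Units.val_mul]
  simp [mul_comm]

lemma swap_self (i : I) (l : List I) : swap C η i i l = 𝟙 _ := by
  change (α_ _ _ _).inv ≫ letterSwap C η i i ▷ W C l ≫ (α_ _ _ _).hom =
    𝟙 ((C i).pt ⊗ (C i).pt ⊗ W C l)
  rw [hη.letterSwap_self, id_whiskerRight, Category.id_comp, Iso.inv_hom_id]

lemma swap_swap (i j : I) (l : List I) : swap C η i j l ≫ swap C η j i l = 𝟙 _ := by
  change ((α_ _ _ _).inv ≫ letterSwap C η i j ▷ W C l ≫ (α_ (C j).pt (C i).pt (W C l)).hom) ≫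
    (α_ (C j).pt (C i).pt (W C l)).inv ≫ letterSwap C η j i ▷ W C l ≫ (α_ _ _ _).hom =
    𝟙 ((C i).pt ⊗ (C j).pt ⊗ W C l)
  rw [Category.assoc, Category.assoc, Iso.hom_inv_id_assoc,
    ← comp_whiskerRight_assoc, hη.letterSwap_letterSwap, id_whiskerRight, Category.id_comp,
    Iso.inv_hom_id]

end IsCommutationMatrix

variable (C) in
/-- Morphisms out of the tensor product of a word to that of another word. -/
abbrev Arrow' (l : List I) := Σ l' : List I, W C l ⟶ W C l'

namespace Arrow'

/-- Precomposition. -/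
def pre {l m : List I} (f : W C l ⟶ W C m) (y : Arrow' C m) : Arrow' C l := ⟨y.1, f ≫ y.2⟩

/-- Tensoring with a letter. -/
def lft (i : I) {l m : List I} (f : W C l ⟶ W C m) : W C (i :: l) ⟶ W C (i :: m) :=
  (C i).pt ◁ f

lemma lft_comp (i : I) {l m n : List I} (f : W C l ⟶ W C m) (g : W C m ⟶ W C n) :
    lft i (f ≫ g) = lft i f ≫ lft i g := whiskerLeft_comp _ _ _

lemma lft_id (i : I) (l : List I) : lft i (𝟙 (W C l)) = 𝟙 _ := whiskerLeft_id _ _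

lemma swap_lft (i j : I) {l l' : List I} (f : W C l ⟶ W C l') :
    lft i (lft j f) ≫ swap C η i j l' = swap C η i j l ≫ lft j (lft i f) :=
  swap_naturality C η i j f

/-- Tensoring with a letter. -/
def cons (i : I) {l : List I} (y : Arrow' C l) : Arrow' C (i :: l) := ⟨i :: y.1, lft i y.2⟩

lemma pre_pre {l m n : List I} (f : W C l ⟶ W C m) (g : W C m ⟶ W C n) (y : Arrow' C n) :
    pre f (pre g y) = pre (f ≫ g) y := by simp [pre]

lemma pre_id {l : List I} (y : Arrow' C l) : pre (𝟙 _) y = y := by simp [pre]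

lemma cons_pre (i : I) {l m : List I} (f : W C l ⟶ W C m) (y : Arrow' C m) :
    cons i (pre f y) = pre (lft i f) (cons i y) := by simp [pre, cons, lft_comp]

variable [LinearOrder I]

variable (C η) in
/-- Insertion of a letter in front of the first letter that is not smaller. -/
def ins (i : I) : ∀ l : List I, Arrow' C (i :: l)
  | [] => ⟨[i], 𝟙 _⟩
  | j :: l => if i ≤ j then ⟨i :: j :: l, 𝟙 _⟩ else pre (swap C η i j l) (cons j (ins i l))

variable (η) in
/-- Insertion of a letter into the target of an arrow. -/
def insertInto (i : I) {l : List I} (y : Arrow' C l) : Arrow' C (i :: l) :=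
  pre (lft i y.2) (ins C η i y.1)

lemma insertInto_pre (i : I) {l m : List I} (f : W C l ⟶ W C m) (y : Arrow' C m) :
    insertInto η i (pre f y) = pre (lft i f) (insertInto η i y) := by
  simp only [insertInto, pre, lft_comp, Category.assoc]

lemma ins_cons_of_le {i j : I} (h : i ≤ j) (l : List I) :
    ins C η i (j :: l) = ⟨i :: j :: l, 𝟙 _⟩ := by simp only [ins, if_pos h]

lemma ins_cons_of_lt {i j : I} (h : j < i) (l : List I) :
    ins C η i (j :: l) = pre (swap C η i j l) (cons j (ins C η i l)) := by
  simp only [ins, if_neg (not_le.2 h)]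

/-- Naturality of the swap lets `i` cross `j` before the rest of the word is sorted. -/
lemma insertInto_cons_of_lt {i j : I} (h : j < i) {l : List I} (y : Arrow' C l) :
    insertInto η i (cons j y) = pre (swap C η i j l) (cons j (insertInto η i y)) := by
  simp only [insertInto, cons_pre, pre_pre, ← swap_lft]
  simp only [cons, ins_cons_of_lt h, pre_pre]

lemma insertInto_of_le {i j : I} (h : i ≤ j) {l m : List I} (f : W C l ⟶ W C (j :: m)) :
    insertInto η i ⟨j :: m, f⟩ = ⟨i :: j :: m, lft i f⟩ := by
  change pre (lft i f) (ins C η i (j :: m)) = _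
  rw [ins_cons_of_le h]
  exact congrArg (Sigma.mk _) (Category.comp_id (lft i f))

end Arrow'

open Arrow'

namespace IsCommutationMatrix

variable [LinearOrder I] (hη : IsCommutationMatrix C η)
include hη

/-- Induction on the word. While both letters exceed the head, both cross it and the Yang-Baxter
equation exchanges the order. Once the smaller letter `i` stays in front of the head, one computes
directly, using that swaps are involutive. -/
lemma insert_ins_of_lt {i j : I} (hij : i < j) (l : List I) :
    insertInto η i (ins C η j l) = pre (swap C η i j l) (insertInto η j (ins C η i l)) := by
  -- The case where `i` does not move. Inserting `j` into `i :: l` begins with a swap, which cancels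
  -- the swap on the right-hand side.
  have key : ∀ l : List I, (∃ (n : I) (m' : List I) (f : _ ⟶ W C (n :: m')),
      ins C η j l = ⟨n :: m', f⟩ ∧ i ≤ n) → ins C η i l = ⟨i :: l, 𝟙 _⟩ →
      insertInto η i (ins C η j l) = pre (swap C η i j l) (insertInto η j (ins C η i l)) := by
    intro l hl hi
    obtain ⟨n, m', f, e, h⟩ := hl
    have : insertInto η j (⟨i :: l, 𝟙 _⟩ : Arrow' C (i :: l)) =
        pre (swap C η j i l) (cons i (ins C η j l)) := by
      change pre (lft j (𝟙 _)) (ins C η j (i :: l)) = _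
      rw [lft_id, pre_id, ins_cons_of_lt hij]
    rw [hi, this, pre_pre, hη.swap_swap, pre_id, e, insertInto_of_le h]
    rfl
  induction l with
  | nil => exact key [] ⟨j, [], 𝟙 _, rfl, hij.le⟩ rfl
  | cons m l ih =>
    by_cases him : i ≤ m
    · refine key _ ?_ (ins_cons_of_le him l)
      by_cases hjm : j ≤ m
      · exact ⟨j, _, _, ins_cons_of_le hjm l, hij.le⟩
      · exact ⟨m, _, _, ins_cons_of_lt (not_le.1 hjm) l, him⟩
    · rw [not_le] at him
      rw [ins_cons_of_lt him, ins_cons_of_lt (him.trans hij), insertInto_pre, insertInto_pre,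
        insertInto_cons_of_lt him, insertInto_cons_of_lt (him.trans hij), ih, cons_pre]
      simp only [pre_pre]
      congr 1
      exact swap_yang_baxter C η i j m l

lemma insert_ins (i j : I) (l : List I) :
    insertInto η i (ins C η j l) = pre (swap C η i j l) (insertInto η j (ins C η i l)) := by
  rcases lt_trichotomy i j with h | rfl | h
  · exact hη.insert_ins_of_lt h l
  · rw [hη.swap_self, pre_id]
  · rw [hη.insert_ins_of_lt h, pre_pre, hη.swap_swap, pre_id]

lemma insert_insert (i j : I) {l : List I} (y : Arrow' C l) :
    insertInto η i (insertInto η j y) = pre (swap C η i j l) (insertInto η j (insertInto η i y)) := by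
  change insertInto η i (pre _ _) = pre _ (insertInto η j (pre _ _))
  rw [insertInto_pre, insertInto_pre, hη.insert_ins, pre_pre, pre_pre, swap_lft]

end IsCommutationMatrix

section

variable [LinearOrder I]

variable (C η) in
/-- Insertion sort. -/
def normalForm : ∀ l : List I, Arrow' C l
  | [] => ⟨[], 𝟙 _⟩
  | i :: l => insertInto η i (normalForm l)

namespace IsCommutationMatrix

variable (hη : IsCommutationMatrix C η)
include hη

/-- It suffices to treat the generators. The only substantial one is a swap, and there the claim is
that two insertions commute up to the swap. -/
lemma pre_normalForm {l l' : List I} {f : W C l ⟶ W C l'} (h : Perm C η l l' f) :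
    pre f (normalForm C η l') = normalForm C η l := by
  induction h with
  | refl l => exact pre_id _
  | cons i h ih => exact (insertInto_pre i _ _).symm.trans (by rw [ih]; rfl)
  | swap i j l => exact (hη.insert_insert i j _).symm
  | trans _ _ ih ih' => rw [← pre_pre, ih', ih]

lemma isIso_swap (i j : I) (l : List I) : IsIso (swap C η i j l) :=
  ⟨_, hη.swap_swap i j l, hη.swap_swap j i l⟩

lemma isIso_perm {l l' : List I} {f : W C l ⟶ W C l'} (h : Perm C η l l' f) : IsIso f := by
  induction h with
  | refl l => infer_instance
  | cons i h ih => exact inferInstanceAs (IsIso ((C i).pt ◁ _))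
  | swap i j l => exact hη.isIso_swap i j l
  | trans _ _ ih ih' => exact inferInstance

lemma isIso_ins (i : I) (l : List I) : IsIso (ins C η i l).2 := by
  induction l with
  | nil => exact inferInstanceAs (IsIso (𝟙 _))
  | cons j l ih =>
    rcases le_or_gt i j with h | h
    · rw [ins_cons_of_le h]; exact inferInstanceAs (IsIso (𝟙 _))
    · rw [ins_cons_of_lt h]
      have := hη.isIso_swap i j l
      have : IsIso (lft j (ins C η i l).2) := inferInstanceAs (IsIso ((C j).pt ◁ _))
      exact inferInstanceAs (IsIso (swap C η i j l ≫ lft j (ins C η i l).2))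

lemma isIso_normalForm (l : List I) : IsIso (normalForm C η l).2 := by
  induction l with
  | nil => exact inferInstanceAs (IsIso (𝟙 _))
  | cons j l ih =>
    have : IsIso (lft j (normalForm C η l).2) := inferInstanceAs (IsIso ((C j).pt ◁ _))
    have := hη.isIso_ins j (normalForm C η l).1
    exact inferInstanceAs (IsIso (lft j (normalForm C η l).2 ≫ (ins C η j _).2))

/-- Followed by the sorting arrow of `l'`, both maps become the sorting arrow of `l`; sorting arrows
are isomorphisms. -/
lemma perm_unique {l l' : List I} {f g : W C l ⟶ W C l'} (hf : Perm C η l l' f)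
    (hg : Perm C η l l' g) : f = g := by
  have e := (hη.pre_normalForm hf).trans (hη.pre_normalForm hg).symm
  have := hη.isIso_normalForm l'
  rw [← cancel_mono (normalForm C η l').2]
  simpa [pre] using e

end IsCommutationMatrix

end

/-! ### Braidings of words as scalar multiples of rearrangements -/

/-- The product of the commutation factors of the letters of two words. -/
def wordFactor (η : I → I → kˣ) (l m : List I) : kˣ :=
  (l.map fun i => (m.map (η i)).prod).prod

lemma smul_swap_comp {A B M N : T} (c d : kˣ) (s : A ⊗ B ⟶ B ⊗ A) (f : A ⊗ M ⟶ N) :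
    (α_ A B M).inv ≫ (c • s) ▷ M ≫ (α_ B A M).hom ≫ B ◁ (d • f) =
      (c * d) • (((α_ A B M).inv ≫ s ▷ M ≫ (α_ B A M).hom) ≫ B ◁ f) := by
  simp only [Units.smul_def, Linear.smul_comp, Linear.comp_smul, mul_smul,
    MonoidalLinear.whiskerLeft_smul, MonoidalLinear.smul_whiskerRight, Category.assoc]
  exact smul_comm _ _ _

/-- The inductive step of `word_comm` with words replaced by variables: `L` crosses `M` by `e`, then
the letter `A` crosses `M` by `e₁`, while `eg` and `e₂` handle concatenation. -/
lemma comm_step {A L M LM ML N N' N'' : T} {rL : L ⊗ M ⟶ M ⊗ L} {rA : A ⊗ M ⟶ M ⊗ A}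
    {p : M ⊗ L ⟶ ML} {q : L ⊗ M ⟶ LM} {f : LM ⟶ ML} {w v : kˣ} (e : rL ≫ p = w • (q ≫ f))
    {a₁ : M ⊗ A ⊗ 𝟙_ T ⟶ N} {f₁ : A ⊗ M ⟶ N} (e₁ : rA ≫ M ◁ (ρ_ A).inv ≫ a₁ = v • f₁)
    {a₂ : N ⊗ L ⟶ N'} {g : N' ⟶ N''} {a₃ : M ⊗ A ⊗ L ⟶ N''}
    (eg : a₁ ▷ L ≫ a₂ ≫ g = (α_ M (A ⊗ 𝟙_ T) L).hom ≫
      M ◁ ((α_ A (𝟙_ T) L).hom ≫ A ◁ (λ_ L).hom) ≫ a₃)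
    {f₂ : A ⊗ ML ⟶ N'} (e₂ : f₁ ▷ L ≫ a₂ = ((α_ _ _ _).hom ≫ A ◁ p) ≫ f₂) :
    ((α_ A L M).hom ≫ A ◁ rL ≫ (α_ _ _ _).inv ≫ rA ▷ L ≫ (α_ _ _ _).hom) ≫ a₃ =
      (v * w) • (((α_ A L M).hom ≫ A ◁ q) ≫ A ◁ f ≫ f₂ ≫ g) := by
  calc _ = (α_ A L M).hom ≫ A ◁ rL ≫ (α_ _ _ _).inv ≫
          (rA ▷ L ≫ (M ◁ (ρ_ A).inv) ▷ L ≫ a₁ ▷ L ≫ a₂ ≫ g) := by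
        rw [eg]; monoidal
    _ = (α_ A L M).hom ≫ A ◁ rL ≫ (α_ _ _ _).inv ≫ (v • f₁) ▷ L ≫ a₂ ≫ g := by
        simp only [← e₁, comp_whiskerRight, Category.assoc]
    _ = v • ((α_ A L M).hom ≫ A ◁ rL ≫ (α_ _ _ _).inv ≫ f₁ ▷ L ≫ a₂ ≫ g) := by
        simp only [Units.smul_def, Linear.smul_comp, Linear.comp_smul,
          MonoidalLinear.smul_whiskerRight]
    _ = v • ((α_ A L M).hom ≫ A ◁ (rL ≫ p) ≫ f₂ ≫ g) := by
        rw [reassoc_of% e₂]; simp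
    _ = _ := by
        rw [e, mul_smul]
        simp only [Units.smul_def, Linear.smul_comp, Linear.comp_smul,
          MonoidalLinear.whiskerLeft_smul, whiskerLeft_comp, Category.assoc]

/-- By the tensor axiom `C_i` crosses the letters one at a time, each crossing being `η` times a
normalized swap. -/
lemma letter_comm (C : I → Braider T) (η : I → I → kˣ) (i : I) (m : List I) :
    ∃ f, Perm C η (i :: m) (m ++ [i]) f ∧
      (C i).R (W C m) ≫ W C m ◁ (ρ_ (C i).pt).inv ≫ (append C m [i]).hom =
        (m.map (η i)).prod • f := by
  induction m with
  | nil =>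
    refine ⟨_, Perm.refl _, ?_⟩
    change (C i).R (𝟙_ T) ≫ 𝟙_ T ◁ (ρ_ (C i).pt).inv ≫ (λ_ ((C i).pt ⊗ 𝟙_ T)).hom =
      (1 : kˣ) • 𝟙 ((C i).pt ⊗ 𝟙_ T)
    have h : (C i).R (𝟙_ T) = (ρ_ _).hom ≫ (λ_ _).inv := by rw [← (C i).unit]; simp
    rw [h, one_smul]; monoidal
  | cons j m ih =>
    obtain ⟨f, hf, e⟩ := ih
    refine ⟨_, Perm.trans (Perm.swap i j m) (Perm.cons j hf), ?_⟩
    change (C i).R ((C j).pt ⊗ W C m) ≫ ((C j).pt ⊗ W C m) ◁ (ρ_ (C i).pt).inv ≫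
      (α_ (C j).pt (W C m) ((C i).pt ⊗ 𝟙_ T)).hom ≫ (C j).pt ◁ (append C m [i]).hom =
      ((j :: m).map (η i)).prod • (swap C η i j m ≫ (C j).pt ◁ f)
    have e1 : (C i).R (C j).pt = η i j • letterSwap C η i j := by rw [letterSwap, smul_inv_smul]
    calc _ = 𝟙 _ ⊗≫ (C i).R (C j).pt ▷ W C m ⊗≫ (C j).pt ◁ ((C i).R (W C m) ≫
            W C m ◁ (ρ_ (C i).pt).inv ≫ (append C m [i]).hom) ⊗≫ 𝟙 _ := by
          rw [(C i).tensor]; monoidal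
      _ = (α_ (C i).pt (C j).pt (W C m)).inv ≫ (η i j • letterSwap C η i j) ▷ W C m ≫
            (α_ (C j).pt (C i).pt (W C m)).hom ≫ (C j).pt ◁ ((m.map (η i)).prod • f) := by
          rw [e, e1]; monoidal
      _ = _ := smul_swap_comp _ _ _ _

lemma word_comm (C : I → Braider T) (η : I → I → kˣ) (l m : List I) :
    ∃ f, Perm C η (l ++ m) (m ++ l) f ∧
      (word C l).R (W C m) ≫ (append C m l).hom =
        wordFactor η l m • ((append C l m).hom ≫ f) := by
  induction l with
  | nil =>
    obtain ⟨f, hf, e⟩ := append_nil_perm C η m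
    refine ⟨f, hf, ?_⟩
    rw [e, show wordFactor η [] m = 1 from rfl, one_smul]
    change ((λ_ (W C m)).hom ≫ (ρ_ (W C m)).inv) ≫ _ = (λ_ (W C m)).hom ≫ _
    simp
  | cons i l ih =>
    obtain ⟨f, hf, e⟩ := ih
    obtain ⟨f₁, hf₁, e₁⟩ := letter_comm C η i m
    obtain ⟨g, hg, eg⟩ := append_assoc_perm C η m [i] l
    obtain ⟨f₂, hf₂, e₂⟩ := hf₁.append_right l
    refine ⟨_, Perm.trans (Perm.cons i hf) (Perm.trans hf₂ hg), ?_⟩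
    have hw : wordFactor η (i :: l) m = (m.map (η i)).prod * wordFactor η l m := by
      simp [wordFactor]
    rw [hw]
    exact comm_step e e₁ eg e₂

end Words
end BraiderLocalization

/-! ### The powers of a real commuting family -/

namespace BraiderLocalization

section Exponents

variable {I : Type w} {k : Type x} [CommRing k] (η : I → I → kˣ)

lemma biChar_zero_left (β : I →₀ ℤ) : biChar η 0 β = 1 := by simp [biChar]

lemma biChar_zero_right (α : I →₀ ℤ) : biChar η α 0 = 1 := by simp [biChar]

lemma biChar_add_left (α α' β : I →₀ ℤ) :
    biChar η (α + α') β = biChar η α β * biChar η α' β := by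
  classical
  refine Finsupp.prod_add_index' (fun i => by simp) fun i m n => ?_
  simp only [add_mul, zpow_add, Finsupp.prod_mul]

lemma biChar_add_right (α β β' : I →₀ ℤ) :
    biChar η α (β + β') = biChar η α β * biChar η α β' := by
  classical
  simp only [biChar]
  rw [← Finsupp.prod_mul]
  congr 1
  funext i m
  refine Finsupp.prod_add_index' (fun j => by simp) fun j n n' => ?_
  simp only [mul_add, zpow_add]

lemma biChar_single (i j : I) : biChar η (Finsupp.single i 1) (Finsupp.single j 1) = η i j := by
  simp [biChar]

/-- `toInt` as a homomorphism. -/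
noncomputable def toIntHom (I : Type w) : (I →₀ ℕ) →+ (I →₀ ℤ) :=
  Finsupp.mapRange.addMonoidHom (Nat.castAddMonoidHom ℤ)

lemma toIntHom_apply (a : I →₀ ℕ) : toIntHom I a = toInt a := rfl

lemma toInt_injective : Function.Injective (toInt : (I →₀ ℕ) → (I →₀ ℤ)) :=
  Finsupp.mapRange_injective _ Nat.cast_zero Nat.cast_injective

lemma toInt_single (i : I) : toInt (Finsupp.single i 1) = Finsupp.single i 1 := by
  simp [toInt]

lemma exists_toInt_eq (γ : I →₀ ℤ) : ∃ a b : I →₀ ℕ, toInt a = toInt b + γ := by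
  refine ⟨γ.mapRange Int.toNat rfl, (-γ).mapRange Int.toNat rfl, ?_⟩
  ext i
  simp only [toInt, Finsupp.mapRange_apply, Finsupp.add_apply, Finsupp.neg_apply]
  omega

end Exponents

section Words

variable {k : Type x} [CommRing k] {T : Type u} [Category.{v} T] [MonoidalCategory T]
  [Preadditive T] [Linear k T] [MonoidalPreadditive T] [MonoidalLinear k T] {I : Type w}
  {C : I → Braider T} {η : I → I → kˣ}

/-- A word with prescribed multiplicities. -/
noncomputable def wordOf (a : I →₀ ℕ) : List I := (Finsupp.toMultiset a).toList

lemma wordOf_zero : wordOf (0 : I →₀ ℕ) = [] := by simp [wordOf]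

lemma wordOf_single (i : I) : wordOf (Finsupp.single i 1) = [i] := by simp [wordOf]

lemma wordOf_add {a b c : I →₀ ℕ} (h : a + b = c) : (wordOf a ++ wordOf b).Perm (wordOf c) := by
  rw [← Multiset.coe_eq_coe, ← Multiset.coe_add]
  simp [wordOf, ← h]

/-- Both sides are multiplicative in the letters of each word, which reduces the claim to single
letters. -/
lemma wordFactor_eq_biChar (l m : List I) (a b : I →₀ ℕ)
    (ha : Finsupp.toMultiset a = (l : Multiset I)) (hb : Finsupp.toMultiset b = (m : Multiset I)) :
    wordFactor η l m = biChar η (toInt a) (toInt b) := by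
  classical
  have inj {a b : I →₀ ℕ} (h : Finsupp.toMultiset a = Finsupp.toMultiset b) : a = b :=
    Multiset.toFinsupp.symm.injective h
  have surj (s : Multiset I) : ∃ a : I →₀ ℕ, Finsupp.toMultiset a = s :=
    Multiset.toFinsupp.symm.surjective s
  have letter : ∀ (i : I) (m : List I) (b : I →₀ ℕ), Finsupp.toMultiset b = (m : Multiset I) →
      (m.map (η i)).prod = biChar η (Finsupp.single i 1) (toInt b) := by
    intro i m
    induction m with
    | nil =>
      intro b hb
      obtain rfl : b = 0 := inj (by simpa using hb)
      rw [← toIntHom_apply, map_zero, biChar_zero_right]; rfl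
    | cons j m ih =>
      intro b hb
      obtain ⟨b', hb'⟩ := surj (m : Multiset I)
      obtain rfl : b = Finsupp.single j 1 + b' := inj (by
        rw [hb, map_add, hb', Finsupp.toMultiset_single]; simp)
      rw [List.map_cons, List.prod_cons, ih b' hb', ← toIntHom_apply, ← toIntHom_apply, map_add,
        biChar_add_right]
      simp only [toIntHom_apply, toInt_single, biChar_single]
  induction l generalizing a with
  | nil =>
    obtain rfl : a = 0 := inj (by simpa using ha)
    rw [← toIntHom_apply, map_zero, biChar_zero_left]; rfl
  | cons j l ih =>
    obtain ⟨a', ha'⟩ := surj (l : Multiset I)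
    obtain rfl : a = Finsupp.single j 1 + a' := inj (by
      rw [ha, map_add, ha', Finsupp.toMultiset_single]; simp)
    have : wordFactor η (j :: l) m = (m.map (η j)).prod * wordFactor η l m := by
      simp [wordFactor]
    rw [this, ih a' ha', letter j m b hb, ← toIntHom_apply (_ + _), map_add, biChar_add_left,
      toIntHom_apply, toInt_single]
    rfl

namespace IsCommutationMatrix

variable (hη : IsCommutationMatrix C η)
include hη

lemma perm_eq {l l' : List I} {f g : W C l ⟶ W C l'} (hf : Perm C η l l' f)
    (hg : Perm C η l l' g) : f = g := by
  -- Sorting needs an order on the index set, but the conclusion does not depend on it; a well-order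
  -- serves.
  classical
  let _ : LinearOrder I := IsWellOrder.linearOrder (WellOrderingRel (α := I))
  exact hη.perm_unique hf hg

/-- The isomorphism of the tensor products of two words with the same letters. -/
noncomputable def permIso {l l' : List I} (h : l.Perm l') : W C l ≅ W C l' :=
  have : IsIso (Perm.exists_of_perm C η h).choose := by
    classical
    let _ : LinearOrder I := IsWellOrder.linearOrder (WellOrderingRel (α := I))
    exact hη.isIso_perm (Perm.exists_of_perm C η h).choose_spec
  asIso (Perm.exists_of_perm C η h).choose

lemma perm_permIso {l l' : List I} (h : l.Perm l') : Perm C η l l' (hη.permIso h).hom :=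
  (Perm.exists_of_perm C η h).choose_spec

/-- The isomorphisms `C^a ⊗ C^b ≅ C^{a + b}`. -/
noncomputable def wordIso {a b c : I →₀ ℕ} (h : a + b = c) :
    W C (wordOf a) ⊗ W C (wordOf b) ≅ W C (wordOf c) :=
  append C _ _ ≪≫ hη.permIso (wordOf_add h)

lemma wordIso_hom {a b c : I →₀ ℕ} (h : a + b = c) : (hη.wordIso h).hom =
    (append C _ _).hom ≫ (hη.permIso (wordOf_add h)).hom := rfl

/-- Each side is concatenation followed by a rearrangement, and the rearrangements have the same
ends, so they agree. -/
lemma wordIso_assoc {a b c ab bc abc : I →₀ ℕ} (h₁ : a + b = ab) (h₂ : ab + c = abc)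
    (h₃ : b + c = bc) (h₄ : a + bc = abc) :
    ((hη.wordIso h₁).hom ▷ W C (wordOf c)) ≫ (hη.wordIso h₂).hom =
      (α_ _ _ _).hom ≫ (W C (wordOf a) ◁ (hη.wordIso h₃).hom) ≫ (hη.wordIso h₄).hom := by
  obtain ⟨f₁, hf₁, e₁⟩ := (hη.perm_permIso (wordOf_add h₁)).append_right (wordOf c)
  obtain ⟨f₃, hf₃, e₃⟩ := (hη.perm_permIso (wordOf_add h₃)).append_left (wordOf a)
  obtain ⟨g, hg, e⟩ := append_assoc_perm C η (wordOf a) (wordOf b) (wordOf c)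
  simp only [wordIso_hom, comp_whiskerRight, whiskerLeft_comp, Category.assoc]
  rw [reassoc_of% e₁, reassoc_of% e₃, ← reassoc_of% e]
  congr 2
  exact hη.perm_eq (hf₁.trans (hη.perm_permIso _)) (hg.trans (hf₃.trans (hη.perm_permIso _)))

lemma wordIso_comm {a b c : I →₀ ℕ} (h : a + b = c) (h' : b + a = c) :
    (word C (wordOf a)).R (W C (wordOf b)) ≫ (hη.wordIso h').hom =
      biChar η (toInt a) (toInt b) • (hη.wordIso h).hom := by
  obtain ⟨f, hf, e⟩ := word_comm C η (wordOf a) (wordOf b)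
  rw [wordFactor_eq_biChar _ _ a b (by simp [wordOf]) (by simp [wordOf])] at e
  rw [wordIso_hom, reassoc_of% e, hη.wordIso_hom h, hη.perm_eq (hη.perm_permIso (wordOf_add h))
    (hf.trans (hη.perm_permIso (wordOf_add h')))]
  simp [Units.smul_def]

/-- The braiders `C^a` of a real commuting family. -/
noncomputable def powers : CentralPowers kˣ T (I →₀ ℕ) (I →₀ ℤ) where
  deg := toIntHom I
  deg_injective := toInt_injective
  exists_deg_eq := exists_toInt_eq
  κ := biChar η
  κ_add_left := biChar_add_left η
  κ_add_right := biChar_add_right η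
  pow a := word C (wordOf a)
  ξ h := hη.wordIso h
  -- The word of exponent `0` is only propositionally empty; the identification is again taken as a
  -- rearrangement.
  zeroIso := hη.permIso (List.Perm.of_eq wordOf_zero)
  zeroIso_braider X := ((hη.perm_permIso (List.Perm.of_eq wordOf_zero)).braider X).symm
  ξ_braider h X := by
    rw [wordIso_hom, comp_whiskerRight, Category.assoc, (hη.perm_permIso _).braider,
      reassoc_of% append_braider, whiskerLeft_comp]
  ξ_assoc := hη.wordIso_assoc
  ξ_zero := by
    have hz := hη.perm_permIso (List.Perm.of_eq (wordOf_zero (I := I)))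
    obtain ⟨f₁, hf₁, e₁⟩ := hz.append_right (wordOf 0)
    obtain ⟨f₂, hf₂, e₂⟩ := hz.append_left []
    have e : (hη.wordIso (add_zero 0)).hom ≫ (hη.permIso (List.Perm.of_eq wordOf_zero)).hom =
        ((hη.permIso (List.Perm.of_eq wordOf_zero)).hom ⊗ₘ
          (hη.permIso (List.Perm.of_eq wordOf_zero)).hom) ≫ (append C [] []).hom := by
      rw [MonoidalCategory.tensorHom_def, Category.assoc, e₂, ← Category.assoc, e₁, wordIso_hom,
        Category.assoc, Category.assoc]
      congr 1
      exact hη.perm_eq ((hη.perm_permIso _).trans hz) (hf₁.trans hf₂)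
    exact e
  comm h h' := hη.wordIso_comm h h'

/-- The isomorphism of `C^{e_i}` with `C_i`. -/
noncomputable def singleIso (i : I) : W C (wordOf (Finsupp.single i 1)) ≅ (C i).pt :=
  hη.permIso (List.Perm.of_eq (wordOf_single i)) ≪≫ (ρ_ (C i).pt : (C i).pt ⊗ 𝟙_ T ≅ (C i).pt)

lemma singleIso_braider (i : I) (X : T) :
    (word C (wordOf (Finsupp.single i 1))).R X ≫ (X ◁ (hη.singleIso i).hom) =
      ((hη.singleIso i).hom ▷ X) ≫ (C i).R X := by
  have h := (hη.perm_permIso (List.Perm.of_eq (wordOf_single i))).braider X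
  have e : (word C [i]).R X ≫ X ◁ (ρ_ (C i).pt).hom = (ρ_ (C i).pt).hom ▷ X ≫ (C i).R X := by
    change ((α_ (C i).pt (𝟙_ T) X).hom ≫ (C i).pt ◁ ((λ_ X).hom ≫ (ρ_ X).inv) ≫ (α_ _ _ _).inv ≫
      (C i).R X ▷ 𝟙_ T ≫ (α_ _ _ _).hom) ≫ X ◁ (ρ_ (C i).pt).hom = _
    monoidal
  have key : ∀ {A B D : T} {r : A ⊗ X ⟶ X ⊗ A} {s : B ⊗ X ⟶ X ⊗ B} {t : D ⊗ X ⟶ X ⊗ D}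
      {f : A ⟶ B} {g : B ⟶ D}, f ▷ X ≫ s = r ≫ X ◁ f → s ≫ X ◁ g = g ▷ X ≫ t →
      r ≫ X ◁ (f ≫ g) = (f ≫ g) ▷ X ≫ t := by
    intro A B D r s t f g h h'
    rw [whiskerLeft_comp, reassoc_of% h.symm, h', comp_whiskerRight, Category.assoc]
  exact key h e

end IsCommutationMatrix

/-- An order on `I` allows the constant `c_{ij}` to be placed entirely on the pair with `i < j`. The
chosen `c_{ij}` and `c_{ji}` need not be equal in `k`; only their effects on the relevant morphisms
must coincide. -/
lemma IsRealCommutingFamily.exists_isCommutationMatrix (hC : IsRealCommutingFamily k C) :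
    ∃ η : I → I → kˣ, IsCommutationMatrix C η := by
  classical
  let _ : LinearOrder I := IsWellOrder.linearOrder (WellOrderingRel (α := I))
  choose s hs using hC.self
  choose c hc using hC.pair
  refine ⟨fun i j => if i = j then s i else if i < j then c i j else 1, fun i => ?_,
    fun i j => ?_⟩
  · simpa using hs i
  · rcases lt_trichotomy i j with h | rfl | h
    · simpa [h.ne, h.ne', h, h.not_gt] using hc i j
    · simp [hs, smul_smul]
    · simp only [h.ne, h.ne', h, h.not_gt, if_false, if_true, one_mul]
      have h₁ := hc i j
      have h₂ := hc j i
      -- The triple composite of `R_{C_i}(C_j)`, `R_{C_j}(C_i)`, `R_{C_i}(C_j)` is bracketed in two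
      -- ways. Composing once more with `R_{C_j}(C_i)` and dividing by `c_{ij}` gives the equality
      -- on the identity.
      have h₃ : (c i j : k) • (C i).R (C j).pt = (c j i : k) • (C i).R (C j).pt := by
        rw [← Category.id_comp ((C i).R (C j).pt), ← Linear.smul_comp, ← h₁, Category.assoc, h₂]
        simp
      have h₄ := congrArg (· ≫ (C j).R (C i).pt) h₃
      simp only [Linear.smul_comp, h₁, smul_smul] at h₄
      have h₅ := congrArg ((((c i j)⁻¹ : kˣ) : k) • ·) h₄
      simp only [smul_smul] at h₅
      rw [h₁]
      rw [mul_comm (c j i : k), ← mul_assoc, ← mul_assoc, Units.inv_mul, one_mul, one_mul] at h₅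
      exact h₅

end Words
end BraiderLocalization

/-! ### The explicit form of the localization -/

namespace BraiderLocalization

variable {k : Type x} [CommRing k] {T : Type u} [Category.{v} T] [MonoidalCategory T]
  [Preadditive T] [Linear k T] [MonoidalPreadditive T] [MonoidalLinear k T] {I : Type w}
  {C : I → Braider T} {η : I → I → kˣ}

namespace CentralPowers

/-- The tensor product of representatives. -/
def tensor {K : Type x} [CommGroup K] {T : Type u} [Category.{v} T]
    [MonoidalCategory T] [∀ X Y : T, MulAction K (X ⟶ Y)] {M : Type w} [AddCommMonoid M]
    {G : Type w} [AddCommGroup G] (P : CentralPowers K T M G)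
    {X X' Y Y' : T} {a a' b b' s s' : M} (hs : a + b = s)
    (hs' : a' + b' = s') (f : P.Rep X a X' a') (g : P.Rep Y b Y' b') :
    P.Rep (X ⊗ Y) s (X' ⊗ Y') s' :=
  ((P.ξ hs).inv ▷ (X ⊗ Y)) ⊗≫ (P.C a ◁ (P.pow b).R X ▷ Y) ⊗≫ (f ⊗ₘ g) ⊗≫
    (X' ◁ (P.pow a').R Y' ▷ P.C b') ⊗≫ ((X' ⊗ Y') ◁ (P.ξ hs').hom)

lemma comp_whiskerL_whiskerR {K : Type x} [CommGroup K] {T : Type u} [Category.{v} T]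
    [MonoidalCategory T] [∀ X Y : T, MulAction K (X ⟶ Y)] {M : Type w} [AddCommMonoid M]
    {G : Type w} [AddCommGroup G] (P : CentralPowers K T M G)
    {X X' Y Y' : T} {a a' b b' s s' : M} (hs : a + b = s)
    (hs' : a' + b' = s') (f : P.Rep X a X' a') (g : P.Rep Y b Y' b') :
    P.comp hs hs' (P.whiskerL X g) (P.whiskerR f Y') =
      P.tensor hs hs' f g := by
  rw [tensor, MonoidalCategory.tensorHom_def']
  simp only [comp, whiskerL, whiskerR, r]
  monoidal

end CentralPowers

namespace Loc

variable {K : Type x} [CommGroup K] {T : Type u} [Category.{v} T] [MonoidalCategory T]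
  [∀ X Y : T, MulAction K (X ⟶ Y)] [ScalarCat K T] {M : Type w} [AddCommMonoid M]
  {G : Type w} [AddCommGroup G] {P : CentralPowers K T M G}

lemma mk_tensorHom_mk {x x' y y' : Loc P} {a a' b b' s s' : M}
    (h : P.deg a + x'.wt = P.deg a' + x.wt) (h' : P.deg b + y'.wt = P.deg b' + y.wt)
    (hs : a + b = s) (hs' : a' + b' = s')
    (h'' : P.deg s + (x' ⊗ y').wt = P.deg s' + (x ⊗ y).wt)
    (f : P.Rep x.pt a x'.pt a') (g : P.Rep y.pt b y'.pt b') :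
    mk h f ⊗ₘ mk h' g = mk h'' (P.κ (P.deg b' - y'.wt) (x.wt - x'.wt) •
      P.tensor hs hs' f g) := by
  change mk h f ▷ _ ≫ _ ◁ mk h' g = _
  -- Interchange selects the order in which the whiskered representatives compose to `P.tensor`. The
  -- factor of the composition and that of right whiskering then combine to `κ(deg b' - y'.wt, _)`,
  -- whose first argument is the index `ε`.
  rw [← whisker_exchange', whiskerLeft_mk _ _ (deg_whiskerLeft _ h'),
    mk_whiskerRight _ _ (deg_whiskerRight _ h), mk_comp _ _ hs hs' h'', P.rep_comp_smul, smul_smul]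
  rw [tensor_wt, tensor_wt, add_sub_add_right_eq_sub, ← P.κ_add_left, ← sub_eq_add_neg,
    ← P.comp_whiskerL_whiskerR]

lemma isIso_functor_map_R {B : Braider T} {a : M} (e : P.C a ≅ B.pt)
    (he : ∀ X, (P.pow a).R X ≫ X ◁ e.hom = e.hom ▷ X ≫ B.R X) (X : T) :
    IsIso ((functor P).map (B.R X)) := by
  have e : B.R X = e.inv ▷ X ≫ P.r a X ≫ X ◁ e.hom := by
    rw [CentralPowers.r, he, inv_hom_whiskerRight_assoc]
  rw [e, Functor.map_comp, Functor.map_comp]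
  infer_instance

end Loc

namespace IsCommutationMatrix

variable (hη : IsCommutationMatrix C η)

/-- The tensor powers of a real commuting family. -/
noncomputable def tensorPowers : Powers C η where
  self_eq := hη.self_eq
  pair_eq := hη.pair_eq
  pow a := word C (wordOf a)
  ξ h := hη.wordIso h
  zeroIso := hη.powers.zeroIso
  singleIso := hη.singleIso
  zeroIso_braider := hη.powers.zeroIso_braider
  singleIso_braider := hη.singleIso_braider
  ξ_braider := hη.powers.ξ_braider
  ξ_assoc := hη.powers.ξ_assoc
  ξ_zero := hη.powers.ξ_zero
  ξ_comm i j s h h' := by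
    have := hη.wordIso_comm h h'
    rw [toInt_single, toInt_single, biChar_single] at this
    exact this

lemma deg_eq {α β δ : I →₀ ℤ} {a b : I →₀ ℕ} (ha : toInt a = δ + α) (hb : toInt b = δ + β) :
    hη.powers.deg a + β = hη.powers.deg b + α := by
  change toInt a + β = toInt b + α
  rw [ha, hb]; abel

/-- The canonical map from `H_δ((X, α), (Y, β))` to the morphisms of the localization. -/
noncomputable def toHom {X Y : T} {α β : I →₀ ℤ} (δ : I →₀ ℤ) {a b : I →₀ ℕ}
    (ha : toInt a = δ + α) (hb : toInt b = δ + β) (f : hη.tensorPowers.Rep X a Y b) :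
    Loc.pair hη.powers X α ⟶ Loc.pair hη.powers Y β :=
  Loc.mk (x := Loc.pair hη.powers X α) (y := Loc.pair hη.powers Y β) (hη.deg_eq ha hb) f

theorem isExplicitModel : IsExplicitModel hη.tensorPowers (Loc.functor hη.powers)
    (Loc.pair hη.powers) hη.toHom where
  obj_bijective := ⟨fun p q h => Prod.ext (congrArg Loc.pt h) (congrArg Loc.wt h),
    fun z => ⟨(z.pt, z.wt), rfl⟩⟩
  ι_add {X Y α β _ _ _} ha hb f g := (Loc.mk_add (x := Loc.pair hη.powers X α)
    (y := Loc.pair hη.powers Y β) (hη.deg_eq ha hb) f g).symm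
  ι_smul ha hb r f := rfl
  ι_surjective {X Y α β} φ := by
    induction φ using Loc.ind with | @h a b h f =>
    change toInt a + β = toInt b + α at h
    refine ⟨toInt a - α, a, b, by abel, ?_, f, rfl⟩
    rw [sub_add_eq_add_sub, h, add_sub_cancel_right]
  ι_eq_iff {X Y α β δ₁ δ₂ a₁ b₁ a₂ b₂} ha₁ hb₁ ha₂ hb₂ f₁ f₂ := by
    refine (Loc.mk_eq_iff _ _ _ _).trans ?_
    constructor
    · rintro ⟨c₁, c₂, a, b, h₁, h₁', h₂, h₂', e⟩
      refine ⟨c₁, c₂, a, b, h₁, h₁', h₂, h₂', ?_, e⟩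
      have := congrArg (toIntHom I) (h₁.trans h₂.symm)
      simp only [map_add, toIntHom_apply, ha₁, ha₂] at this
      rw [← add_assoc, ← add_assoc] at this
      exact add_right_cancel this
    · rintro ⟨c₁, c₂, a, b, h₁, h₁', h₂, h₂', -, e⟩
      exact ⟨c₁, c₂, a, b, h₁, h₁', h₂, h₂', e⟩
  ι_id X α h := rfl
  ι_comp {X Y Z α β γ δ ε a b c d s t} ha hb hc hd hs ht hs' ht' f g := by
    rw [← hb]
    exact Loc.mk_comp (x := Loc.pair hη.powers X α) (y := Loc.pair hη.powers Y β)
      (z := Loc.pair hη.powers Z γ) (hη.deg_eq ha hb) (hη.deg_eq hc hd) hs ht (hη.deg_eq hs' ht') f g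
  obj_unit := rfl
  obj_tensor X Y α β := rfl
  ι_tensor {X X' Y Y' α α' β β' δ ε a a' b b' s s'} ha ha' hb hb' hs hs' ht ht' f g := by
    obtain rfl : ε = toInt b' - β' := eq_sub_of_add_eq hb'.symm
    have e := Loc.mk_tensorHom_mk (x := Loc.pair hη.powers X α) (y := Loc.pair hη.powers Y β)
      (x' := Loc.pair hη.powers X' α') (y' := Loc.pair hη.powers Y' β')
      (hη.deg_eq ha ha') (hη.deg_eq hb hb') hs hs'
      (hη.deg_eq (α := α + β) (β := α' + β') ht ht') f g
    exact (e.trans (Category.comp_id _).symm).trans (Category.id_comp _).symm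
  Υ_obj X := rfl
  Υ_map {X Y} h f := by
    exact ((Category.comp_id _).symm).trans (Category.id_comp _).symm

theorem invertsFamily : InvertsFamily C (Loc.functor hη.powers) :=
  ⟨fun i => (Loc.isInvertibleObj_functor_obj hη.powers (Finsupp.single i 1)).of_iso
    ((Loc.functor hη.powers).mapIso (hη.singleIso i)), fun i X =>
    Loc.isIso_functor_map_R (P := hη.powers) (hη.singleIso i) (hη.singleIso_braider i) X⟩

end IsCommutationMatrix

end BraiderLocalization

/-! ### Uniqueness: extending monoidal isomorphisms to the localization -/

namespace BraiderLocalization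

open Functor.LaxMonoidal Functor.OplaxMonoidal

section Compat

variable {L : Type u} [Category.{v} L] [MonoidalCategory L] {T' : Type u'} [Category.{v'} T']
  [MonoidalCategory T'] {F G : L ⥤ T'}

/-- The commutation of a square, as in the naturality of a transformation `F ⟶ G`. -/
def Compat {Z W : L} (ψ : F.obj Z ⟶ G.obj Z) (χ : F.obj W ⟶ G.obj W) (u : Z ⟶ W) : Prop :=
  ψ ≫ G.map u = F.map u ≫ χ

namespace Compat

lemma eq {Z : L} {ψ χ : F.obj Z ⟶ G.obj Z} (h : Compat ψ χ (𝟙 Z)) : ψ = χ := by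
  simpa [Compat] using h

lemma comp {Z W V : L} {ψ : F.obj Z ⟶ G.obj Z} {χ : F.obj W ⟶ G.obj W} {ω : F.obj V ⟶ G.obj V}
    {u : Z ⟶ W} {v : W ⟶ V} (h : Compat ψ χ u) (h' : Compat χ ω v) : Compat ψ ω (u ≫ v) := by
  rw [Compat] at *
  rw [G.map_comp, reassoc_of% h, h', F.map_comp, Category.assoc]

lemma inv {Z W : L} {ψ : F.obj Z ⟶ G.obj Z} {χ : F.obj W ⟶ G.obj W} {u : Z ⟶ W} [IsIso u]
    (h : Compat ψ χ u) : Compat χ ψ (CategoryTheory.inv u) := by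
  rw [Compat] at *
  rw [← cancel_mono (G.map u), Category.assoc, Category.assoc, h]
  simp

lemma inv_comp {Z W V : L} {ψ : F.obj Z ⟶ G.obj Z} {χ : F.obj W ⟶ G.obj W}
    {ω : F.obj V ⟶ G.obj V} {u : Z ⟶ W} [IsIso u] {v : Z ⟶ V} (h : Compat ψ χ u)
    (h' : Compat χ ω (CategoryTheory.inv u ≫ v)) : Compat ψ ω v := by
  simpa using h.comp h'

lemma of_comp {Z W V : L} {ψ : F.obj Z ⟶ G.obj Z} {χ : F.obj W ⟶ G.obj W}
    {ω : F.obj V ⟶ G.obj V} {u : Z ⟶ W} {v : W ⟶ V} [IsIso v] (h : Compat ψ ω (u ≫ v))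
    (h' : Compat χ ω v) : Compat ψ χ u := by
  simpa using h.comp h'.inv

variable [F.Monoidal] [G.Monoidal]

/-- The tensor product of two components of a would-be monoidal transformation. -/
def hat {Z W : L} (ψ : F.obj Z ⟶ G.obj Z) (χ : F.obj W ⟶ G.obj W) :
    F.obj (Z ⊗ W) ⟶ G.obj (Z ⊗ W) := δ F Z W ≫ (ψ ⊗ₘ χ) ≫ μ G Z W

lemma whiskerLeft {Z W V : L} {ψ : F.obj Z ⟶ G.obj Z} {χ : F.obj W ⟶ G.obj W} {u : Z ⟶ W}
    (h : Compat ψ χ u) (ω : F.obj V ⟶ G.obj V) : Compat (hat ω ψ) (hat ω χ) (V ◁ u) := by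
  rw [Compat] at *
  simp only [hat, Functor.Monoidal.map_whiskerLeft, Category.assoc, Functor.Monoidal.μ_δ_assoc]
  rw [MonoidalCategory.tensorHom_def, MonoidalCategory.tensorHom_def, Category.assoc,
    ← whiskerLeft_comp_assoc, h, whiskerLeft_comp]
  simp only [Category.assoc, whisker_exchange_assoc]

lemma whiskerRight {Z W V : L} {ψ : F.obj Z ⟶ G.obj Z} {χ : F.obj W ⟶ G.obj W} {u : Z ⟶ W}
    (h : Compat ψ χ u) (ω : F.obj V ⟶ G.obj V) : Compat (hat ψ ω) (hat χ ω) (u ▷ V) := by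
  rw [Compat] at *
  simp only [hat, Functor.Monoidal.map_whiskerRight, Category.assoc, Functor.Monoidal.μ_δ_assoc]
  rw [MonoidalCategory.tensorHom_def', MonoidalCategory.tensorHom_def', Category.assoc,
    ← comp_whiskerRight_assoc, h, comp_whiskerRight]
  simp only [Category.assoc, whisker_exchange_assoc]

/-- The cancellation that permits descent from `C^b ⊗ z`, which comes from `T`, to `z`. -/
lemma of_whiskerLeft {Z W V : L} {ψ : F.obj Z ⟶ G.obj Z} {χ : F.obj W ⟶ G.obj W} {u : Z ⟶ W}
    {ω : F.obj V ⟶ G.obj V} [IsIso ω] [(tensorLeft (G.obj V)).Faithful]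
    (h : Compat (hat ω ψ) (hat ω χ) (V ◁ u)) : Compat ψ χ u := by
  rw [Compat] at *
  simp only [hat, Functor.Monoidal.map_whiskerLeft, Category.assoc, Functor.Monoidal.μ_δ_assoc] at h
  rw [cancel_epi, ← Category.assoc, ← Category.assoc, cancel_mono,
    MonoidalCategory.tensorHom_def, MonoidalCategory.tensorHom_def, Category.assoc,
    whisker_exchange_assoc, cancel_epi, ← whiskerLeft_comp, ← whiskerLeft_comp] at h
  exact (tensorLeft (G.obj V)).map_injective h

lemma associator {Z W V : L} (ψ : F.obj Z ⟶ G.obj Z) (χ : F.obj W ⟶ G.obj W)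
    (ω : F.obj V ⟶ G.obj V) : Compat (hat (hat ψ χ) ω) (hat ψ (hat χ ω)) (α_ Z W V).hom := by
  have h₁ : hat (hat ψ χ) ω = δ F _ _ ≫ δ F _ _ ▷ _ ≫ ((ψ ⊗ₘ χ) ⊗ₘ ω) ≫ μ G _ _ ▷ _ ≫ μ G _ _ := by
    simp only [hat, MonoidalCategory.tensorHom_def, comp_whiskerRight, Category.assoc,
      whisker_exchange_assoc]
  have h₂ : hat ψ (hat χ ω) = δ F _ _ ≫ _ ◁ δ F _ _ ≫ (ψ ⊗ₘ (χ ⊗ₘ ω)) ≫ _ ◁ μ G _ _ ≫ μ G _ _ := by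
    simp only [hat, MonoidalCategory.tensorHom_def', MonoidalCategory.whiskerLeft_comp,
      Category.assoc, ← whisker_exchange_assoc]
  rw [Compat, h₁, h₂]
  simp only [Category.assoc, Functor.LaxMonoidal.associativity, associator_naturality_assoc]
  rw [Functor.OplaxMonoidal.associativity_assoc]

end Compat

/-- The monoidality of the components of a monoidal natural transformation. -/
lemma Compat.hat_app_app {φ : F ⟶ G} [F.Monoidal] [G.Monoidal] [NatTrans.IsMonoidal φ] (Z W : L) :
    Compat.hat (φ.app Z) (φ.app W) = φ.app (Z ⊗ W) := by
  rw [Compat.hat, ← NatTrans.IsMonoidal.tensor, Functor.Monoidal.δ_μ_assoc]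

end Compat

lemma IsInvertibleObj.map {L : Type u} [Category.{v} L] [MonoidalCategory L] {T' : Type u'}
    [Category.{v'} T'] [MonoidalCategory T'] (F : L ⥤ T') [F.Monoidal] {X Y : L}
    (e : X ⊗ Y ≅ 𝟙_ L) (e' : Y ⊗ X ≅ 𝟙_ L) : IsInvertibleObj (F.obj X) :=
  .of_inverse (Functor.Monoidal.μIso F X Y ≪≫ F.mapIso e ≪≫ (Functor.Monoidal.εIso F).symm)
    (Functor.Monoidal.μIso F Y X ≪≫ F.mapIso e' ≪≫ (Functor.Monoidal.εIso F).symm)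

namespace Loc

variable {K : Type x} [CommGroup K] {T : Type u} [Category.{v} T] [MonoidalCategory T]
  [∀ X Y : T, MulAction K (X ⟶ Y)] [ScalarCat K T] {M : Type w} [AddCommMonoid M]
  {G : Type w} [AddCommGroup G] (P : CentralPowers K T M G)
  {T' : Type u'} [Category.{v'} T'] [MonoidalCategory T']

lemma isInvertibleObj_map_functor_obj (F : Loc P ⥤ T') [F.Monoidal] (a : M) :
    IsInvertibleObj (F.obj ((functor P).obj (P.C a))) := by
  have e : (functor P).obj (P.C a) ≅ pair P (𝟙_ T) (P.deg a) :=
    (isoOf (x := pair P (P.C a) 0) (y := pair P (P.C a ⊗ 𝟙_ T) 0) rfl (ρ_ _).symm) ≪≫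
      isoShiftLeft P a (𝟙_ T) (add_zero (P.deg a))
  have h (α β : G) (hαβ : α + β = 0) :
      Nonempty (pair P (𝟙_ T) α ⊗ pair P (𝟙_ T) β ≅ 𝟙_ (Loc P)) :=
    ⟨isoOf (x := pair P (𝟙_ T) α ⊗ pair P (𝟙_ T) β) (y := 𝟙_ (Loc P)) hαβ (λ_ _)⟩
  exact .of_iso (F.mapIso e.symm)
    (.map F (h _ _ (add_neg_cancel _)).some (h _ _ (neg_add_cancel _)).some)

section Extension

variable {P} {F G' : Loc P ⥤ T'} [F.Monoidal] [G'.Monoidal]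
  (l : functor P ⋙ F ≅ functor P ⋙ G') [NatTrans.IsMonoidal l.hom]

open Compat

/-- The component of an isomorphism at an object of `T`. -/
abbrev comp' (X : T) : F.obj ((functor P).obj X) ⟶ G'.obj ((functor P).obj X) := l.hom.app X

instance (X : T) : IsIso (comp' l X) := inferInstanceAs (IsIso (l.hom.app X))

lemma compat_map {X Y : T} (f : X ⟶ Y) : Compat (comp' l X) (comp' l Y) ((functor P).map f) :=
  (l.hom.naturality f).symm

lemma compat_μ (X Y : T) :
    Compat (hat (comp' l X) (comp' l Y)) (comp' l (X ⊗ Y)) (μ (functor P) X Y) := by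
  have h := NatTrans.IsMonoidal.tensor (τ := l.hom) X Y
  rw [Functor.LaxMonoidal.comp_μ, Functor.LaxMonoidal.comp_μ, Category.assoc] at h
  rw [Compat, hat, Category.assoc, Category.assoc, ← h, Functor.Monoidal.δ_μ_assoc]

instance (a : M) : (tensorLeft (G'.obj ((functor P).obj (P.C a)))).IsEquivalence :=
  (isInvertibleObj_map_functor_obj P G' a).2

/-- Such a `u` need not come from `T`, but `exists_map_eq` relates its tensor product with some
`C^a` to morphisms that do; then `C^a` is cancelled. -/
lemma compat_of_functor_obj {X Y : T} (u : (functor P).obj X ⟶ (functor P).obj Y) :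
    Compat (comp' l X) (comp' l Y) u := by
  obtain ⟨a, f, e⟩ := exists_map_eq P u
  have h := (compat_μ l (P.C a) X).comp (compat_map l f)
  rw [e] at h
  exact (h.of_comp ((compat_μ l (P.C a) Y).comp (compat_map l (P.r a Y)))).of_whiskerLeft

/-- `ψ` is compatible with all morphisms to objects of `T`. -/
def IsGood {z : Loc P} (ψ : F.obj z ⟶ G'.obj z) : Prop :=
  ∀ (B X : T) (u : (functor P).obj B ⊗ z ⟶ (functor P).obj X),
    Compat (hat (comp' l B) ψ) (comp' l X) u

variable {l}

/-- One isomorphism suffices for the test. Given `u` from `B ⊗ z`, tensor with `C^a`, move `C^a`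
past `B` by the braiding, which is invertible, and apply `u₀`: the source becomes an object of `T`,
where compatibility is known. -/
lemma IsGood.of_iso {z : Loc P} {ψ : F.obj z ⟶ G'.obj z} {a : M} {Y : T}
    (u₀ : (functor P).obj (P.C a) ⊗ z ⟶ (functor P).obj Y) [IsIso u₀]
    (h : Compat (hat (comp' l (P.C a)) ψ) (comp' l Y) u₀) : IsGood l ψ := by
  intro B X u
  let s : (functor P).obj (P.C a) ⊗ (functor P).obj B ⟶ (functor P).obj B ⊗ (functor P).obj (P.C a) :=
    μ (functor P) _ _ ≫ (functor P).map (P.r a B) ≫ inv (μ (functor P) _ _)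
  have hs : Compat (hat (comp' l (P.C a)) (comp' l B)) (hat (comp' l B) (comp' l (P.C a))) s :=
    (compat_μ l _ _).comp ((compat_map l _).comp (compat_μ l _ _).inv)
  let q := (α_ _ _ _).inv ≫ s ▷ z ≫ (α_ _ _ _).hom ≫ (functor P).obj B ◁ u₀ ≫ μ (functor P) _ _
  have hq : Compat (hat (comp' l (P.C a)) (hat (comp' l B) ψ)) (comp' l (B ⊗ Y)) q := by
    have hα := (Compat.associator (comp' l (P.C a)) (comp' l B) ψ).inv
    rw [IsIso.Iso.inv_hom] at hα
    exact hα.comp ((hs.whiskerRight ψ).comp ((Compat.associator _ _ _).comp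
      ((h.whiskerLeft _).comp (compat_μ l _ _))))
  have hu : Compat (hat (comp' l (P.C a)) (hat (comp' l B) ψ)) (comp' l (P.C a ⊗ X))
      ((functor P).obj (P.C a) ◁ u ≫ μ (functor P) _ _) := by
    -- The morphism is `q` followed by a morphism between objects of `T`, because `q` is an
    -- isomorphism.
    simpa using hq.comp (compat_of_functor_obj l
      (inv q ≫ (functor P).obj (P.C a) ◁ u ≫ μ (functor P) _ _))
  exact (hu.of_comp (compat_μ l _ _)).of_whiskerLeft

/-- After tensoring with a `C^b` that carries `z'` into `T`, goodness of `ψ` handles the composite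
into `T` and goodness of `ψ'` the isomorphism that ends it. -/
lemma IsGood.naturality {z z' : Loc P} {ψ : F.obj z ⟶ G'.obj z} {ψ' : F.obj z' ⟶ G'.obj z'}
    (h : IsGood l ψ) (h' : IsGood l ψ') (f : z ⟶ z') : Compat ψ ψ' f := by
  obtain ⟨b, X, ⟨e⟩⟩ := exists_iso_functor_obj P z'
  exact ((h _ _ ((functor P).obj (P.C b) ◁ f ≫ e.hom)).of_comp (h' _ _ e.hom)).of_whiskerLeft

lemma IsGood.unique {z : Loc P} {ψ ψ' : F.obj z ⟶ G'.obj z} (h : IsGood l ψ) (h' : IsGood l ψ') :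
    ψ = ψ' :=
  (h.naturality h' (𝟙 z)).eq

lemma IsGood.tensor {z z' : Loc P} {ψ : F.obj z ⟶ G'.obj z} {ψ' : F.obj z' ⟶ G'.obj z'}
    {ω : F.obj (z ⊗ z') ⟶ G'.obj (z ⊗ z')}
    (h : IsGood l ψ) (h' : IsGood l ψ') (h'' : IsGood l ω) : hat ψ ψ' = ω := by
  obtain ⟨b, X, ⟨e⟩⟩ := exists_iso_functor_obj P z
  obtain ⟨b', X', ⟨e'⟩⟩ := exists_iso_functor_obj P z'
  let D := (functor P).obj (P.C b)
  let D' := (functor P).obj (P.C b')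
  let s : D' ⊗ (functor P).obj X ⟶ (functor P).obj X ⊗ D' :=
    μ (functor P) _ _ ≫ (functor P).map (P.r b' X) ≫ inv (μ (functor P) _ _)
  have hs : Compat (hat (comp' l (P.C b')) (comp' l X)) (hat (comp' l X) (comp' l (P.C b'))) s :=
    (compat_μ l _ _).comp ((compat_map l _).comp (compat_μ l _ _).inv)
  -- An isomorphism assembled from `e`, `e'` and the passage of `D'` across `X`. It is compatible
  -- both with the components built from `hat ψ ψ'` and with those built from `ω`, so the two agree
  -- after cancelling `D'` and `D`.
  let m : D' ⊗ (D ⊗ (z ⊗ z')) ⟶ (functor P).obj (X ⊗ X') :=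
    D' ◁ (α_ _ _ _).inv ≫ D' ◁ e.hom ▷ z' ≫ (α_ _ _ _).inv ≫ s ▷ z' ≫ (α_ _ _ _).hom ≫
      (functor P).obj X ◁ e'.hom ≫ μ (functor P) _ _
  have inv_assoc {x y z : Loc P} (ψ : F.obj x ⟶ G'.obj x) (χ : F.obj y ⟶ G'.obj y)
      (ω : F.obj z ⟶ G'.obj z) : Compat (hat ψ (hat χ ω)) (hat (hat ψ χ) ω) (α_ x y z).inv := by
    simpa using (Compat.associator ψ χ ω).inv
  have hm : Compat (hat (comp' l (P.C b')) (hat (comp' l (P.C b)) (hat ψ ψ')))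
      (comp' l (X ⊗ X')) m :=
    ((inv_assoc _ _ _).whiskerLeft _).comp ((((h _ _ e.hom).whiskerRight _).whiskerLeft _).comp
      ((inv_assoc _ _ _).comp ((hs.whiskerRight _).comp ((Compat.associator _ _ _).comp
        (((h' _ _ e'.hom).whiskerLeft _).comp (compat_μ l _ _))))))
  have hm' : Compat (hat (comp' l (P.C b')) (hat (comp' l (P.C b)) ω)) (comp' l (X ⊗ X')) m := by
    exact ((inv_assoc (comp' l (P.C b')) (comp' l (P.C b)) ω).comp
      ((compat_μ l _ _).whiskerRight ω)).inv_comp (h'' _ _ _)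
  have := hm.comp hm'.inv
  rw [IsIso.hom_inv_id, ← MonoidalCategory.whiskerLeft_id, ← MonoidalCategory.whiskerLeft_id] at this
  exact this.of_whiskerLeft.of_whiskerLeft.eq

variable (l)

lemma isGood_comp' (X : T) : IsGood l (comp' l X) := by
  intro B Y u
  simpa using (compat_μ l B X).comp (compat_of_functor_obj l (inv (μ (functor P) _ _) ≫ u))

/-- Compatibility with one isomorphism `C^b ⊗ z ≅ X` prescribes the tensor product of `ψ` with the
image of `C^b`; the equation is solvable because tensoring with that image is full. -/
lemma exists_isGood (z : Loc P) : ∃ ψ : F.obj z ⟶ G'.obj z, IsIso ψ ∧ IsGood l ψ := by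
  obtain ⟨b, X, ⟨e⟩⟩ := exists_iso_functor_obj P z
  let g : G'.obj ((functor P).obj (P.C b)) ⊗ F.obj z ⟶ G'.obj ((functor P).obj (P.C b)) ⊗ G'.obj z :=
    inv (comp' l (P.C b)) ▷ F.obj z ≫ μ F _ _ ≫ F.map e.hom ≫ comp' l X ≫ G'.map e.inv ≫ δ G' _ _
  obtain ⟨ψ, hψ⟩ := (tensorLeft (G'.obj ((functor P).obj (P.C b)))).map_surjective g
  change G'.obj ((functor P).obj (P.C b)) ◁ ψ = g at hψ
  have : IsIso ((tensorLeft (G'.obj ((functor P).obj (P.C b)))).map ψ) := by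
    change IsIso (G'.obj ((functor P).obj (P.C b)) ◁ ψ)
    rw [hψ]
    infer_instance
  have : IsIso ψ := isIso_of_reflects_iso ψ (tensorLeft (G'.obj ((functor P).obj (P.C b))))
  refine ⟨ψ, this, IsGood.of_iso e.hom ?_⟩
  rw [Compat, hat, MonoidalCategory.tensorHom_def]
  simp only [Category.assoc]
  rw [reassoc_of% hψ]
  simp [g]

/-- The extension to the localization of a monoidal isomorphism. -/
noncomputable def extend : F ≅ G' :=
  NatIso.ofComponents
    (fun z => have := (exists_isGood l z).choose_spec.1; asIso (exists_isGood l z).choose)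
    (fun {z z'} f => ((exists_isGood l z).choose_spec.2.naturality
      (exists_isGood l z').choose_spec.2 f).symm)

lemma isGood_extend (z : Loc P) : IsGood l ((extend l).hom.app z) :=
  (exists_isGood l z).choose_spec.2

lemma extend_app_functor_obj (X : T) : (extend l).hom.app ((functor P).obj X) = l.hom.app X :=
  (isGood_extend l _).unique (isGood_comp' l X)

instance : NatTrans.IsMonoidal (extend l).hom where
  unit := by
    have h := NatTrans.IsMonoidal.unit (τ := l.hom)
    rw [Functor.LaxMonoidal.comp_ε, Functor.LaxMonoidal.comp_ε, Category.assoc,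
      ← extend_app_functor_obj] at h
    have n := (extend l).hom.naturality (ε (functor P))
    rw [n, ← Category.assoc, cancel_mono] at h
    exact h
  tensor z z' := by
    rw [← (isGood_extend l z).tensor (isGood_extend l z') (isGood_extend l _), hat,
      Functor.Monoidal.μ_δ_assoc]

/-- A natural monoidal transformation extending `l` has good components, and good components are
unique. -/
lemma eq_extend (φ : F ≅ G') [NatTrans.IsMonoidal φ.hom]
    (h : ∀ X, φ.hom.app ((functor P).obj X) = l.hom.app X) : φ = extend l := by
  ext z
  refine IsGood.unique (l := l) (fun B X u => ?_) (isGood_extend l z)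
  rw [Compat, comp', comp', ← h, ← h, Compat.hat_app_app]
  exact (φ.hom.naturality u).symm

end Extension

end Loc

end BraiderLocalization

/-! ### Linearity of functors out of the localization -/

namespace BraiderLocalization

open Functor.LaxMonoidal Functor.OplaxMonoidal

namespace Loc

section

variable {K : Type x} [CommGroup K] {T : Type u} [Category.{v} T] [MonoidalCategory T]
  [∀ X Y : T, MulAction K (X ⟶ Y)] [ScalarCat K T] {M : Type w} [AddCommMonoid M]
  {G : Type w} [AddCommGroup G] {P : CentralPowers K T M G}

lemma deg_shift {x y : Loc P} {a b : M} (h : P.deg a + y.wt = P.deg b + x.wt) :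
    P.deg b + (x.wt - P.deg a) = y.wt := by
  rw [add_sub, ← h, add_sub_cancel_left]

/-- Between fixed shift isomorphisms, every morphism is a morphism of `T` placed in some weight,
that is, up to isomorphism, tensored with `(1, α)`. Hence a monoidal functor is linear as soon as it
is so on `T`. -/
lemma mk_eq_shift {x y : Loc P} {a b : M} (h : P.deg a + y.wt = P.deg b + x.wt)
    (f : P.Rep x.pt a y.pt b) :
    mk h f = (isoShiftLeft P a x.pt (add_sub_cancel (P.deg a) x.wt)).inv ≫
      of (x := pair P (P.C a ⊗ x.pt) (x.wt - P.deg a))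
        (y := pair P (y.pt ⊗ P.C b) (x.wt - P.deg a)) rfl f ≫
      (isoShiftRight P b y.pt (deg_shift h)).hom := by
  rw [isoShiftRight, of_comp_mk, isoShiftLeft]
  have e : P.C 0 ◁ f ≫ P.repRight (𝟙 (y.pt ⊗ P.C b)) = P.repRight f := by
    simp only [CentralPowers.repRight]
    rw [whisker_exchange_assoc, leftUnitor_naturality_assoc, Category.comp_id]
  rw [e]
  refine Eq.symm ((mk_comp _ _ (zero_add a) (add_zero b) h _ _).trans ?_)
  rw [P.repLeft_comp_repRight, map_zero, P.κ_zero_left, one_smul, Category.id_comp]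

/-- The isomorphism `(X, 0) ⊗ (1, α) ≅ (X, α)`. -/
def isoTensorUnit (P : CentralPowers K T M G) (X : T) (α : G) :
    (functor P).obj X ⊗ pair P (𝟙_ T) α ≅ pair P X α :=
  isoOf (x := pair P X 0 ⊗ pair P (𝟙_ T) α) (y := pair P X α) (zero_add α) (ρ_ X)

lemma of_eq {X Y : T} (α : G) (f : X ⟶ Y) :
    of (x := pair P X α) (y := pair P Y α) rfl f = (isoTensorUnit P X α).inv ≫
      (functor P).map f ▷ pair P (𝟙_ T) α ≫ (isoTensorUnit P Y α).hom := by
  rw [Iso.eq_inv_comp]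
  change of (x := pair P X 0 ⊗ pair P (𝟙_ T) α) (y := pair P X α) (zero_add α) (ρ_ X).hom ≫ _ =
    of (x := pair P X 0) (y := pair P Y 0) rfl f ▷ pair P (𝟙_ T) α ≫
    of (x := pair P Y 0 ⊗ pair P (𝟙_ T) α) (y := pair P Y α) (zero_add α) (ρ_ Y).hom
  rw [of_whiskerRight, of_comp_of, of_comp_of]
  exact of_congr _ (rightUnitor_naturality f).symm

end

section Linear

variable {k : Type x} [CommRing k] {T : Type u} [Category.{v} T] [MonoidalCategory T]
  [Preadditive T] [Linear k T] [MonoidalPreadditive T] [MonoidalLinear k T]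
  {M : Type w} [AddCommMonoid M] {G : Type w} [AddCommGroup G]
  {P : CentralPowers kˣ T M G}
  {T' : Type u'} [Category.{v'} T'] [MonoidalCategory T'] [Preadditive T'] [Linear k T']
  [MonoidalPreadditive T'] [MonoidalLinear k T'] (F : Loc P ⥤ T') [F.Monoidal]

lemma map_of_add [(functor P ⋙ F).Additive] {X Y : T} (α : G) (f g : X ⟶ Y) :
    F.map (of (x := pair P X α) (y := pair P Y α) rfl (f + g)) =
      F.map (of (x := pair P X α) (y := pair P Y α) rfl f) +
        F.map (of (x := pair P X α) (y := pair P Y α) rfl g) := by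
  have h : F.map ((functor P).map (f + g)) =
      F.map ((functor P).map f) + F.map ((functor P).map g) := (functor P ⋙ F).map_add
  simp only [of_eq, F.map_comp, Functor.Monoidal.map_whiskerRight, h,
    MonoidalPreadditive.add_whiskerRight, Preadditive.add_comp, Preadditive.comp_add]

lemma map_of_smul [(functor P ⋙ F).Additive] [(functor P ⋙ F).Linear k] {X Y : T} (α : G) (r : k)
    (f : X ⟶ Y) : F.map (of (x := pair P X α) (y := pair P Y α) rfl (r • f)) =
      r • F.map (of (x := pair P X α) (y := pair P Y α) rfl f) := by
  have h : F.map ((functor P).map (r • f)) =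
      r • F.map ((functor P).map f) := Functor.Linear.map_smul (F := functor P ⋙ F) f r
  simp only [of_eq, F.map_comp, Functor.Monoidal.map_whiskerRight, h,
    MonoidalLinear.smul_whiskerRight, Linear.smul_comp, Linear.comp_smul]

/-- A monoidal functor out of the localization is additive if it is so on `T`. -/
theorem additive_of_comp [(functor P ⋙ F).Additive] : F.Additive where
  map_add {x y φ ψ} := by
    obtain ⟨a, b, h, f, g, rfl, rfl⟩ := exists_common φ ψ
    rw [mk_add, mk_eq_shift, mk_eq_shift h f, mk_eq_shift h g]
    simp only [F.map_comp, map_of_add, Preadditive.add_comp, Preadditive.comp_add]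

/-- A monoidal functor out of the localization is linear if it is so on `T`. -/
theorem linear_of_comp [(functor P ⋙ F).Additive] [(functor P ⋙ F).Linear k] [F.Additive] :
    F.Linear k where
  map_smul {x y} φ r := by
    induction φ using ind with | @h a b h f =>
    rw [smul_mk, mk_eq_shift, mk_eq_shift h f]
    simp only [F.map_comp, map_of_smul F, Linear.smul_comp, Linear.comp_smul]

end Linear

end Loc

/-! ### Images of representatives under a monoidal functor -/

/-- The compatibility of systems of powers with a monoidal functor. -/
structure MapPowers {K : Type x} [CommGroup K] {T : Type u} [Category.{v} T] [MonoidalCategory T]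
    [∀ X Y : T, MulAction K (X ⟶ Y)] {M : Type w} [AddCommMonoid M]
    {G : Type w} [AddCommGroup G] (P : CentralPowers K T M G)
    {S : Type u'} [Category.{v'} S] [MonoidalCategory S] [∀ X Y : S, MulAction K (X ⟶ Y)]
    (Q : CentralPowers K S M G) (H : T ⥤ S) [H.Monoidal] where
  map_smul : ∀ {X Y : T} (r : K) (f : X ⟶ Y), H.map (r • f) = r • H.map f
  deg_eq : Q.deg = P.deg
  κ_eq : Q.κ = P.κ
  iso : ∀ a, H.obj (P.C a) ≅ Q.C a
  ξ_iso : ∀ {a b c : M} (h : a + b = c),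
    μ H _ _ ≫ H.map (P.ξ h).hom ≫ (iso c).hom = ((iso a).hom ⊗ₘ (iso b).hom) ≫ (Q.ξ h).hom
  zero_iso : H.map P.zeroIso.hom = (iso 0).hom ≫ Q.zeroIso.hom ≫ ε H
  R_iso : ∀ (a : M) (X : T), μ H _ _ ≫ H.map ((P.pow a).R X) ≫ δ H _ _ ≫ H.obj X ◁ (iso a).hom =
    (iso a).hom ▷ H.obj X ≫ (Q.pow a).R (H.obj X)

namespace MapPowers

variable {K : Type x} [CommGroup K] {T : Type u} [Category.{v} T] [MonoidalCategory T]
  [∀ X Y : T, MulAction K (X ⟶ Y)] {M : Type w} [AddCommMonoid M]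
  {G : Type w} [AddCommGroup G] {P : CentralPowers K T M G}
  {S : Type u'} [Category.{v'} S] [MonoidalCategory S] [∀ X Y : S, MulAction K (X ⟶ Y)]
  {Q : CentralPowers K S M G} {H : T ⥤ S} [H.Monoidal] (E : MapPowers P Q H)

/-- The image of a representative. -/
def mapRep {X Y : T} {a b : M} (f : P.Rep X a Y b) : Q.Rep (H.obj X) a (H.obj Y) b :=
  (E.iso a).inv ▷ H.obj X ≫ μ H _ _ ≫ H.map f ≫ δ H _ _ ≫ H.obj Y ◁ (E.iso b).hom

lemma mapRep_smul [ScalarCat K S] {X Y : T} {a b : M} (r : K) (f : P.Rep X a Y b) :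
    E.mapRep (r • f) = r • E.mapRep f := by
  simp only [mapRep, E.map_smul, ScalarCat.comp_smul, ScalarCat.smul_comp]

lemma map_zeroIso_inv : H.map P.zeroIso.inv = η H ≫ Q.zeroIso.inv ≫ (E.iso 0).inv := by
  rw [← cancel_mono (H.map P.zeroIso.hom), ← H.map_comp, E.zero_iso]
  simp

lemma mapRep_ofHom {X Y : T} (f : X ⟶ Y) : E.mapRep (P.ofHom f) = Q.ofHom (H.map f) := by
  rw [mapRep, CentralPowers.ofHom, CentralPowers.ofHom]
  simp only [H.map_comp, Functor.Monoidal.map_whiskerLeft, Functor.Monoidal.map_whiskerRight,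
    Functor.Monoidal.map_leftUnitor, Functor.Monoidal.map_rightUnitor_inv, E.zero_iso,
    E.map_zeroIso_inv, Category.assoc, Functor.Monoidal.μ_δ_assoc, comp_whiskerRight,
    MonoidalCategory.whiskerLeft_comp, Functor.Monoidal.whiskerLeft_ε_η_assoc,
    Functor.Monoidal.whiskerRight_ε_η_assoc, inv_hom_whiskerRight_assoc, whiskerLeft_inv_hom,
    Category.comp_id]

lemma mapRep_r (a : M) (X : T) : E.mapRep (P.r a X) = Q.r a (H.obj X) := by
  rw [mapRep, CentralPowers.r, E.R_iso, inv_hom_whiskerRight_assoc]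

lemma μ_map_ξ {a b c : M} (h : a + b = c) : μ H _ _ ≫ H.map (P.ξ h).hom =
    ((E.iso a).hom ⊗ₘ (E.iso b).hom) ≫ (Q.ξ h).hom ≫ (E.iso c).inv := by
  rw [← reassoc_of% E.ξ_iso h, Iso.hom_inv_id, Category.comp_id]

lemma map_ξ_inv_δ {a b c : M} (h : a + b = c) : H.map (P.ξ h).inv ≫ δ H _ _ =
    (E.iso c).hom ≫ (Q.ξ h).inv ≫ ((E.iso a).inv ⊗ₘ (E.iso b).inv) := by
  rw [← cancel_mono (μ H _ _), ← cancel_mono (H.map (P.ξ h).hom), Category.assoc, Category.assoc,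
    Functor.Monoidal.δ_μ_assoc, Category.assoc, E.μ_map_ξ, ← H.map_comp,
    Iso.inv_hom_id]
  simp [tensorHom_comp_tensorHom_assoc]

lemma mapRep_comp {X Y Z : T} {a b c d s t : M} (hs : c + a = s) (ht : d + b = t)
    (f : P.Rep X a Y b) (g : P.Rep Y c Z d) :
    E.mapRep (P.comp hs ht f g) = Q.comp hs ht (E.mapRep f) (E.mapRep g) := by
  have e : P.comp hs ht f g = (P.ξ hs).inv ▷ X ≫ (α_ _ _ _).hom ≫ P.C c ◁ f ≫ (α_ _ _ _).inv ≫
      g ▷ P.C b ≫ (α_ _ _ _).hom ≫ Z ◁ (P.ξ ht).hom := by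
    rw [CentralPowers.comp]; monoidal
  calc E.mapRep (P.comp hs ht f g) = (E.iso s).inv ▷ H.obj X ≫
        (H.map (P.ξ hs).inv ≫ δ H _ _) ▷ H.obj X ≫ (α_ _ _ _).hom ≫
          H.obj (P.C c) ◁ (μ H _ _ ≫ H.map f ≫ δ H _ _) ≫ (α_ _ _ _).inv ≫
          (μ H _ _ ≫ H.map g ≫ δ H _ _) ▷ H.obj (P.C b) ≫ (α_ _ _ _).hom ≫
          H.obj Z ◁ ((μ H _ _ ≫ H.map (P.ξ ht).hom) ≫ (E.iso t).hom) := by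
        rw [e, mapRep]
        simp only [H.map_comp, Functor.Monoidal.map_whiskerLeft, Functor.Monoidal.map_whiskerRight,
          Functor.Monoidal.map_associator, Functor.Monoidal.map_associator_inv, Category.assoc,
          Functor.Monoidal.μ_δ_assoc, comp_whiskerRight, MonoidalCategory.whiskerLeft_comp]
    _ = 𝟙 _ ⊗≫ (Q.ξ hs).inv ▷ H.obj X ⊗≫ ((E.iso c).inv ▷ _ ≫ _ ◁ (E.iso a).inv) ▷ H.obj X ⊗≫
          H.obj (P.C c) ◁ (μ H _ _ ≫ H.map f ≫ δ H _ _) ⊗≫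
          ((μ H _ _ ≫ H.map g ≫ δ H _ _) ▷ H.obj (P.C b) ≫ _ ◁ (E.iso b).hom) ⊗≫
          H.obj Z ◁ (E.iso d).hom ▷ Q.C b ⊗≫ H.obj Z ◁ (Q.ξ ht).hom ⊗≫ 𝟙 _ := by
        rw [E.μ_map_ξ, E.map_ξ_inv_δ, MonoidalCategory.tensorHom_def,
          MonoidalCategory.tensorHom_def']
        simp only [Category.assoc, Iso.inv_hom_id, Category.comp_id, comp_whiskerRight,
          inv_hom_whiskerRight_assoc]
        monoidal
    _ = 𝟙 _ ⊗≫ (Q.ξ hs).inv ▷ H.obj X ⊗≫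
          ((E.iso c).inv ▷ (Q.C a ⊗ H.obj X) ≫ H.obj (P.C c) ◁ ((E.iso a).inv ▷ H.obj X ≫
            μ H _ _ ≫ H.map f ≫ δ H _ _ ≫ H.obj Y ◁ (E.iso b).hom)) ⊗≫
          (μ H _ _ ≫ H.map g ≫ δ H _ _ ≫ H.obj Z ◁ (E.iso d).hom) ▷ Q.C b ⊗≫
          H.obj Z ◁ (Q.ξ ht).hom ⊗≫ 𝟙 _ := by
        rw [← whisker_exchange _ (E.iso b).hom]; monoidal
    _ = _ := by
        rw [← whisker_exchange, CentralPowers.comp, mapRep, mapRep]; monoidal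

lemma mapRep_zeta {X Y : T} {a b a' b' c : M} (ha : c + a = a') (hb : c + b = b')
    (f : P.Rep X a Y b) : E.mapRep (P.zeta ha hb f) = Q.zeta ha hb (E.mapRep f) := by
  rw [CentralPowers.zeta, E.mapRep_comp, E.mapRep_r]
  rfl

lemma mapRep_whiskerL (X : T) {Y Y' : T} {b b' : M} (g : P.Rep Y b Y' b') :
    Q.whiskerL (H.obj X) (E.mapRep g) ≫ μ H X Y' ▷ Q.C b' =
      Q.C b ◁ μ H X Y ≫ E.mapRep (P.whiskerL X g) := by
  calc Q.whiskerL (H.obj X) (E.mapRep g) ≫ μ H X Y' ▷ Q.C b'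
      = 𝟙 _ ⊗≫ ((E.iso b).inv ▷ H.obj X ≫ μ H _ _ ≫ H.map (P.r b X) ≫ δ H _ _) ▷ H.obj Y ⊗≫
          H.obj X ◁ ((E.iso b).hom ≫ (E.iso b).inv) ▷ H.obj Y ⊗≫
          H.obj X ◁ (μ H _ _ ≫ H.map g ≫ δ H _ _) ⊗≫ ((_ ⊗ _) ◁ (E.iso b').hom ≫
          μ H X Y' ▷ Q.C b') := by
        rw [CentralPowers.whiskerL, ← E.mapRep_r, mapRep, mapRep]; monoidal
    _ = (α_ _ _ _).inv ≫ ((E.iso b).inv ▷ H.obj X) ▷ H.obj Y ≫ (μ H _ _ ≫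
          H.map (P.r b X) ≫ δ H _ _) ▷ H.obj Y ≫ (α_ _ _ _).hom ≫
          H.obj X ◁ (μ H _ _ ≫ H.map g ≫ δ H _ _) ≫ (α_ _ _ _).inv ≫
          μ H X Y' ▷ _ ≫ _ ◁ (E.iso b').hom := by
        rw [Iso.hom_inv_id, whisker_exchange]; monoidal
    _ = _ := by
        rw [mapRep, CentralPowers.whiskerL]
        simp only [H.map_comp, Functor.Monoidal.map_whiskerLeft, Functor.Monoidal.map_whiskerRight,
          Functor.Monoidal.map_associator, Functor.Monoidal.map_associator_inv, Category.assoc,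
          Functor.Monoidal.μ_δ_assoc, comp_whiskerRight, MonoidalCategory.whiskerLeft_comp]
        rw [whisker_exchange_assoc]
        simp

lemma mapRep_whiskerR {X X' : T} {a a' : M} (f : P.Rep X a X' a') (Y : T) :
    Q.whiskerR (E.mapRep f) (H.obj Y) ≫ μ H X' Y ▷ Q.C a' =
      Q.C a ◁ μ H X Y ≫ E.mapRep (P.whiskerR f Y) := by
  calc Q.whiskerR (E.mapRep f) (H.obj Y) ≫ μ H X' Y ▷ Q.C a'
      = 𝟙 _ ⊗≫ ((E.iso a).inv ▷ H.obj X ≫ μ H _ _ ≫ H.map f ≫ δ H _ _) ▷ H.obj Y ⊗≫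
          H.obj X' ◁ ((E.iso a').hom ≫ (E.iso a').inv) ▷ H.obj Y ⊗≫
          H.obj X' ◁ (μ H _ _ ≫ H.map (P.r a' Y) ≫ δ H _ _) ⊗≫ ((_ ⊗ _) ◁ (E.iso a').hom ≫
          μ H X' Y ▷ Q.C a') := by
        rw [CentralPowers.whiskerR, ← E.mapRep_r, mapRep, mapRep]; monoidal
    _ = (α_ _ _ _).inv ≫ ((E.iso a).inv ▷ H.obj X) ▷ H.obj Y ≫ (μ H _ _ ≫
          H.map f ≫ δ H _ _) ▷ H.obj Y ≫ (α_ _ _ _).hom ≫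
          H.obj X' ◁ (μ H _ _ ≫ H.map (P.r a' Y) ≫ δ H _ _) ≫ (α_ _ _ _).inv ≫
          μ H X' Y ▷ _ ≫ _ ◁ (E.iso a').hom := by
        rw [Iso.hom_inv_id, whisker_exchange]; monoidal
    _ = _ := by
        rw [mapRep, CentralPowers.whiskerR]
        simp only [H.map_comp, Functor.Monoidal.map_whiskerLeft, Functor.Monoidal.map_whiskerRight,
          Functor.Monoidal.map_associator, Functor.Monoidal.map_associator_inv, Category.assoc,
          Functor.Monoidal.μ_δ_assoc, comp_whiskerRight, MonoidalCategory.whiskerLeft_comp]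
        rw [whisker_exchange_assoc]
        simp

end MapPowers

end BraiderLocalization

/-! ### Functoriality of the localization -/

namespace BraiderLocalization

open Functor.LaxMonoidal Functor.OplaxMonoidal

namespace Loc

variable {K : Type x} [CommGroup K] {T : Type u} [Category.{v} T] [MonoidalCategory T]
  [∀ X Y : T, MulAction K (X ⟶ Y)] [ScalarCat K T] {M : Type w} [AddCommMonoid M]
  {G : Type w} [AddCommGroup G] {P : CentralPowers K T M G}
  {S : Type u'} [Category.{v'} S] [MonoidalCategory S] [∀ X Y : S, MulAction K (X ⟶ Y)]
  [ScalarCat K S] {Q : CentralPowers K S M G} {H : T ⥤ S} [H.Monoidal] (E : MapPowers P Q H)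

/-- The image of an object under the functor induced between localizations. -/
abbrev mapObj (_ : MapPowers P Q H) (x : Loc P) : Loc Q := pair Q (H.obj x.pt) x.wt

lemma deg_map {x y : Loc P} {a b : M} (h : P.deg a + y.wt = P.deg b + x.wt) :
    Q.deg a + (mapObj E y).wt = Q.deg b + (mapObj E x).wt := by
  rw [E.deg_eq]; exact h

/-- The image of a morphism under the functor induced between localizations. -/
def mapHom {x y : Loc P} (φ : x ⟶ y) : mapObj E x ⟶ mapObj E y :=
  Hom.lift (fun {a b} h f => mk (x := mapObj E x) (y := mapObj E y) (a := a) (b := b)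
    (deg_map E h) (E.mapRep f)) (by
      intro a b a' b' c h h' ha hb f
      rw [E.mapRep_zeta, mk_zeta (deg_map E h)]) φ

lemma mapHom_mk {x y : Loc P} {a b : M} (h : P.deg a + y.wt = P.deg b + x.wt)
    (f : P.Rep x.pt a y.pt b) : mapHom E (mk h f) =
      mk (x := mapObj E x) (y := mapObj E y) (deg_map E h) (E.mapRep f) := rfl

lemma mapHom_of {x y : Loc P} (h : x.wt = y.wt) (f : x.pt ⟶ y.pt) :
    mapHom E (of h f) = of (x := mapObj E x) (y := mapObj E y) h (H.map f) := by
  rw [of, mapHom_mk, E.mapRep_ofHom, of]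

/-- The functor induced between localizations. -/
def map : Loc P ⥤ Loc Q where
  obj := mapObj E
  map φ := mapHom E φ
  map_id x := by
    rw [id_eq_of, mapHom_of, H.map_id]; rfl
  map_comp {x y z} φ ψ := by
    induction φ using ind with | @h a b h f =>
    induction ψ using ind with | @h c d h' g =>
    have e := deg_comp h h' rfl rfl
    rw [mk_comp h h' rfl rfl e, mapHom_mk, mapHom_mk, mapHom_mk,
      mk_comp (deg_map E h) (deg_map E h') rfl rfl (deg_map E e), ← E.mapRep_comp, E.mapRep_smul,
      E.κ_eq, E.deg_eq]

lemma map_map {x y : Loc P} (φ : x ⟶ y) : (map E).map φ = mapHom E φ := rfl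

lemma map_obj (x : Loc P) : (map E).obj x = mapObj E x := rfl

instance : (map E).Monoidal := Functor.CoreMonoidal.toMonoidal
  { εIso := isoOf (x := 𝟙_ (Loc Q)) (y := mapObj E (𝟙_ (Loc P))) rfl (Functor.Monoidal.εIso H)
    μIso x y := isoOf (x := mapObj E x ⊗ mapObj E y) (y := mapObj E (x ⊗ y)) rfl
      (Functor.Monoidal.μIso H x.pt y.pt)
    μIso_hom_natural_left {x x'} φ y := by
      induction φ using ind with | @h a b h f =>
      simp only [map_map, map_obj]
      rw [mapHom_mk, mk_whiskerRight _ h (deg_whiskerRight _ h), mapHom_mk,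
        mk_whiskerRight _ (deg_map E h) (deg_whiskerRight _ (deg_map E h)), isoOf_hom, isoOf_hom,
        mk_comp_of, of_comp_mk]
      congr 1
      rw [E.mapRep_smul, ScalarCat.smul_comp, ScalarCat.comp_smul, E.κ_eq]
      congr 1
      exact E.mapRep_whiskerR f y.pt
    μIso_hom_natural_right {y y'} x φ := by
      induction φ using ind with | @h a b h f =>
      simp only [map_map, map_obj]
      rw [mapHom_mk, whiskerLeft_mk _ h (deg_whiskerLeft _ h), mapHom_mk,
        whiskerLeft_mk _ (deg_map E h) (deg_whiskerLeft _ (deg_map E h)), isoOf_hom, isoOf_hom,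
        mk_comp_of, of_comp_mk]
      congr 1
      exact E.mapRep_whiskerL x.pt f
    associativity x y z := by
      simp only [map_map, map_obj, associator_eq, isoOf_hom, mapHom_of, whiskerLeft_of,
        of_whiskerRight, of_comp_of]
      apply of_congr
      exact Functor.LaxMonoidal.associativity H x.pt y.pt z.pt
    left_unitality x := by
      simp only [map_map, map_obj, leftUnitor_eq, isoOf_hom, mapHom_of,
        of_whiskerRight, of_comp_of]
      apply of_congr
      exact Functor.LaxMonoidal.left_unitality H x.pt
    right_unitality x := by
      simp only [map_map, map_obj, rightUnitor_eq, isoOf_hom, mapHom_of,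
        whiskerLeft_of, of_comp_of]
      apply of_congr
      exact Functor.LaxMonoidal.right_unitality H x.pt }

/-- The functor induced between localizations extends the given one. -/
def functorCompMap : functor P ⋙ map E ≅ H ⋙ functor Q :=
  NatIso.ofComponents (fun X => isoOf (x := mapObj E (pair P X 0)) (y := pair Q (H.obj X) 0) rfl
    (Iso.refl _)) (fun {X Y} f => by
      change mapHom E (of (x := pair P X 0) (y := pair P Y 0) rfl f) ≫ _ =
        _ ≫ of (x := pair Q (H.obj X) 0) (y := pair Q (H.obj Y) 0) rfl (H.map f)
      rw [mapHom_of, isoOf_hom, isoOf_hom, of_comp_of, of_comp_of]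
      apply of_congr
      simp [mapObj])

instance : NatTrans.IsMonoidal (functorCompMap E).hom where
  unit := by
    rw [Functor.LaxMonoidal.comp_ε, Functor.LaxMonoidal.comp_ε, functor_ε, functor_ε]
    change (of (x := 𝟙_ (Loc Q)) (y := mapObj E (𝟙_ (Loc P))) rfl (ε H) ≫ mapHom E (of (x := 𝟙_ (Loc P)) (y := 𝟙_ (Loc P)) rfl (𝟙 _))) ≫
      of (x := mapObj E (𝟙_ (Loc P))) (y := pair Q (H.obj (𝟙_ T)) 0) rfl (𝟙 _) =
      𝟙 _ ≫ of (x := 𝟙_ (Loc Q)) (y := pair Q (H.obj (𝟙_ T)) 0) rfl (ε H)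
    rw [mapHom_of, Category.id_comp, of_comp_of, of_comp_of]
    apply of_congr
    simp [unit_pt]
  tensor X Y := by
    rw [Functor.LaxMonoidal.comp_μ, Functor.LaxMonoidal.comp_μ, functor_μ, functor_μ]
    change (of (x := pair Q (H.obj X) 0 ⊗ pair Q (H.obj Y) 0)
        (y := mapObj E (pair P X 0 ⊗ pair P Y 0)) rfl (μ H X Y) ≫ mapHom E (of
          (x := pair P X 0 ⊗ pair P Y 0) (y := pair P (X ⊗ Y) 0) (add_zero _) (𝟙 (X ⊗ Y)))) ≫
      of (x := mapObj E (pair P (X ⊗ Y) 0)) (y := pair Q (H.obj (X ⊗ Y)) 0) rfl (𝟙 _) =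
      (of (x := pair Q (H.obj X) 0) (y := pair Q (H.obj X) 0) rfl (𝟙 _) ▷ _ ≫
        _ ◁ of (x := pair Q (H.obj Y) 0) (y := pair Q (H.obj Y) 0) rfl (𝟙 _)) ≫
      of (x := pair Q (H.obj X) 0 ⊗ pair Q (H.obj Y) 0) (y := pair Q (H.obj X ⊗ H.obj Y) 0)
        (add_zero _) (𝟙 _) ≫ of (x := pair Q (H.obj X ⊗ H.obj Y) 0)
          (y := pair Q (H.obj (X ⊗ Y)) 0) rfl (μ H X Y)
    rw [mapHom_of, of_whiskerRight, whiskerLeft_of, of_comp_of, of_comp_of, of_comp_of,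
      of_comp_of, of_comp_of]
    apply of_congr
    simp [tensor_pt]

end Loc

end BraiderLocalization

/-! ### Scalars from the unit object, and the centralizer of a system of objects -/

namespace BraiderLocalization

section Scal

variable {S : Type u} [Category.{v} S] [MonoidalCategory S]

/-- The action of the endomorphisms of the unit on the endomorphisms of an object. -/
def scal (t : 𝟙_ S ⟶ 𝟙_ S) (X : S) : X ⟶ X := (λ_ X).inv ≫ t ▷ X ≫ (λ_ X).hom

lemma scal_naturality (t : 𝟙_ S ⟶ 𝟙_ S) {X Y : S} (f : X ⟶ Y) :
    f ≫ scal t Y = scal t X ≫ f := by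
  simp only [scal, Category.assoc, ← leftUnitor_naturality]
  rw [← whisker_exchange_assoc, leftUnitor_inv_naturality_assoc]

lemma scal_id (X : S) : scal (𝟙 (𝟙_ S)) X = 𝟙 X := by simp [scal]

lemma scal_comp (t t' : 𝟙_ S ⟶ 𝟙_ S) (X : S) : scal (t ≫ t') X = scal t X ≫ scal t' X := by
  simp [scal]

lemma scal_unit (t : 𝟙_ S ⟶ 𝟙_ S) : scal t (𝟙_ S) = t := by
  rw [scal, unitors_equal, rightUnitor_naturality, unitors_inv_equal, Iso.inv_hom_id_assoc]

lemma scal_whiskerRight (t : 𝟙_ S ⟶ 𝟙_ S) (X Y : S) : scal t X ▷ Y = scal t (X ⊗ Y) := by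
  simp only [scal]; monoidal

/-- The object `X` is central with respect to the endomorphism `t` of the unit. -/
def ScalCentral (t : 𝟙_ S ⟶ 𝟙_ S) (X : S) : Prop := X ◁ t ≫ (ρ_ X).hom = (ρ_ X).hom ≫ scal t X

/-- The scalar acts from the left, so it reaches a left factor freely (`scal_whiskerRight`); to
reach the right factor it must cross `X`, which is what centrality permits. -/
lemma ScalCentral.whiskerLeft {t : 𝟙_ S ⟶ 𝟙_ S} {X : S} (h : ScalCentral t X) (Y : S) :
    X ◁ scal t Y = scal t (X ⊗ Y) := by
  have h' : scal t X = (ρ_ X).inv ≫ X ◁ t ≫ (ρ_ X).hom := by rw [h]; simp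
  rw [← scal_whiskerRight, h', scal]
  monoidal

lemma ScalCentral.tensor {t : 𝟙_ S ⟶ 𝟙_ S} {X Y : S} (hX : ScalCentral t X)
    (hY : ScalCentral t Y) : ScalCentral t (X ⊗ Y) := by
  have e : (X ⊗ Y) ◁ t ≫ (ρ_ (X ⊗ Y)).hom = (α_ _ _ _).hom ≫ X ◁ (Y ◁ t ≫ (ρ_ Y).hom) := by
    monoidal
  rw [ScalCentral, e, hY, MonoidalCategory.whiskerLeft_comp, hX.whiskerLeft]
  monoidal

lemma ScalCentral.unit (t : 𝟙_ S ⟶ 𝟙_ S) : ScalCentral t (𝟙_ S) := by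
  rw [ScalCentral, scal_unit, ← unitors_equal, leftUnitor_naturality]

end Scal

/-- A multiplicative system of objects of a monoidal category, with endomorphisms of the unit. -/
structure ObjPowers (K : Type x) [CommGroup K] (M : Type w) [AddCommMonoid M]
    (S : Type u) [Category.{v} S] [MonoidalCategory S] where
  D : M → S
  mul : ∀ {a b c : M}, a + b = c → (D a ⊗ D b ≅ D c)
  zero : D 0 ≅ 𝟙_ S
  s : K → (𝟙_ S ⟶ 𝟙_ S)
  s_one : s 1 = 𝟙 _
  s_mul : ∀ r t, s (r * t) = s r ≫ s t
  scalCentral : ∀ r a, ScalCentral (s r) (D a)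

variable {K : Type x} [CommGroup K] {M : Type w} [AddCommMonoid M]
  {S : Type u} [Category.{v} S] [MonoidalCategory S]

/-- The objects of the centralizer of a multiplicative system of objects. -/
structure Centralizer (Q : ObjPowers K M S) where
  pt : S
  σ : ∀ a, Q.D a ⊗ pt ≅ pt ⊗ Q.D a
  σ_mul : ∀ {a b c : M} (h : a + b = c), (Q.mul h).hom ▷ pt ≫ (σ c).hom =
    (α_ _ _ _).hom ≫ Q.D a ◁ (σ b).hom ≫ (α_ _ _ _).inv ≫ (σ a).hom ▷ Q.D b ≫ (α_ _ _ _).hom ≫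
      pt ◁ (Q.mul h).hom
  σ_zero : (σ 0).hom ≫ pt ◁ Q.zero.hom = Q.zero.hom ▷ pt ≫ (λ_ _).hom ≫ (ρ_ _).inv
  scalCentral : ∀ r, ScalCentral (Q.s r) pt

namespace Centralizer

variable {Q : ObjPowers K M S}

/-- The morphisms of the centralizer. -/
@[ext]
structure Hom (A B : Centralizer Q) where
  f : A.pt ⟶ B.pt
  comm : ∀ a, Q.D a ◁ f ≫ (B.σ a).hom = (A.σ a).hom ≫ f ▷ Q.D a

@[simps id_f comp_f]
instance : Category (Centralizer Q) where
  Hom := Hom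
  id A := ⟨𝟙 _, fun a => by simp⟩
  comp φ ψ := ⟨φ.f ≫ ψ.f, fun a => by
    rw [MonoidalCategory.whiskerLeft_comp, Category.assoc, ψ.comm, ← Category.assoc, φ.comm,
      comp_whiskerRight, Category.assoc]⟩

@[ext]
lemma hom_ext {A B : Centralizer Q} {φ ψ : A ⟶ B} (h : φ.f = ψ.f) : φ = ψ := Hom.ext h

variable (Q) in
/-- The forgetful functor from the centralizer. -/
@[simps]
def forget : Centralizer Q ⥤ S where
  obj A := A.pt
  map φ := φ.f

/-- Isomorphisms of the centralizer. -/
@[simps]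
def isoMk {A B : Centralizer Q} (e : A.pt ≅ B.pt)
    (h : ∀ a, Q.D a ◁ e.hom ≫ (B.σ a).hom = (A.σ a).hom ≫ e.hom ▷ Q.D a) : A ≅ B where
  hom := ⟨e.hom, h⟩
  inv := ⟨e.inv, fun a => by
    rw [← cancel_epi (Q.D a ◁ e.hom), reassoc_of% h a]; simp⟩
  hom_inv_id := by ext; simp
  inv_hom_id := by ext; simp

instance : (forget Q).ReflectsIsomorphisms where
  reflects {A B} φ _ := by
    have : IsIso φ.f := inferInstanceAs (IsIso ((forget Q).map φ))
    exact (isoMk (asIso φ.f) φ.comm).isIso_hom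

/-- An equivalence, because it has two uses: one direction constructs tensor products, the other
divides by an invertible `A` in `exists_tensor_iso`. It holds because the half braidings of `A`
split off as an isomorphism. -/
lemma tensor_mul_iff (A : Centralizer Q) {B : S} (τ : ∀ a, Q.D a ⊗ B ⟶ B ⊗ Q.D a)
    {a b c : M} (h : a + b = c) :
    ((Q.mul h).hom ▷ (A.pt ⊗ B) ≫ (α_ _ _ _).inv ≫ (A.σ c).hom ▷ B ≫ (α_ _ _ _).hom ≫
        A.pt ◁ τ c ≫ (α_ _ _ _).inv =
      (α_ _ _ _).hom ≫
        Q.D a ◁ ((α_ _ _ _).inv ≫ (A.σ b).hom ▷ B ≫ (α_ _ _ _).hom ≫ A.pt ◁ τ b ≫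
          (α_ _ _ _).inv) ≫ (α_ _ _ _).inv ≫
        ((α_ _ _ _).inv ≫ (A.σ a).hom ▷ B ≫ (α_ _ _ _).hom ≫ A.pt ◁ τ a ≫
          (α_ _ _ _).inv) ▷ Q.D b ≫ (α_ _ _ _).hom ≫ (A.pt ⊗ B) ◁ (Q.mul h).hom) ↔
      A.pt ◁ ((Q.mul h).hom ▷ B ≫ τ c) = A.pt ◁ ((α_ _ _ _).hom ≫ Q.D a ◁ τ b ≫
        (α_ _ _ _).inv ≫ τ a ▷ Q.D b ≫ (α_ _ _ _).hom ≫ B ◁ (Q.mul h).hom) := by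
  have e₁ : (Q.mul h).hom ▷ (A.pt ⊗ B) ≫ (α_ _ _ _).inv ≫ (A.σ c).hom ▷ B ≫ (α_ _ _ _).hom ≫
        A.pt ◁ τ c ≫ (α_ _ _ _).inv =
      (𝟙 _ ⊗≫ Q.D a ◁ (A.σ b).hom ▷ B ⊗≫ (A.σ a).hom ▷ Q.D b ▷ B ⊗≫ 𝟙 _) ≫
        A.pt ◁ ((Q.mul h).hom ▷ B ≫ τ c) ≫ (α_ _ _ _).inv := by
    calc _ = (α_ _ _ _).inv ≫ ((Q.mul h).hom ▷ A.pt ≫ (A.σ c).hom) ▷ B ≫ (α_ _ _ _).hom ≫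
          A.pt ◁ τ c ≫ (α_ _ _ _).inv := by monoidal
      _ = _ := by rw [A.σ_mul]; monoidal
  have e₂ : (α_ _ _ _).hom ≫
        Q.D a ◁ ((α_ _ _ _).inv ≫ (A.σ b).hom ▷ B ≫ (α_ _ _ _).hom ≫ A.pt ◁ τ b ≫
          (α_ _ _ _).inv) ≫ (α_ _ _ _).inv ≫
        ((α_ _ _ _).inv ≫ (A.σ a).hom ▷ B ≫ (α_ _ _ _).hom ≫ A.pt ◁ τ a ≫
          (α_ _ _ _).inv) ▷ Q.D b ≫ (α_ _ _ _).hom ≫ (A.pt ⊗ B) ◁ (Q.mul h).hom =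
      (𝟙 _ ⊗≫ Q.D a ◁ (A.σ b).hom ▷ B ⊗≫ (A.σ a).hom ▷ Q.D b ▷ B ⊗≫ 𝟙 _) ≫
        A.pt ◁ ((α_ _ _ _).hom ≫ Q.D a ◁ τ b ≫
        (α_ _ _ _).inv ≫ τ a ▷ Q.D b ≫ (α_ _ _ _).hom ≫ B ◁ (Q.mul h).hom) ≫
        (α_ _ _ _).inv := by
    calc _ = 𝟙 _ ⊗≫ Q.D a ◁ (A.σ b).hom ▷ B ⊗≫ ((Q.D a ⊗ A.pt) ◁ τ b ≫
          (A.σ a).hom ▷ (B ⊗ Q.D b)) ⊗≫ A.pt ◁ τ a ▷ Q.D b ⊗≫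
          A.pt ◁ B ◁ (Q.mul h).hom ⊗≫ 𝟙 _ := by monoidal
      _ = _ := by rw [whisker_exchange]; monoidal
  rw [e₁, e₂]
  simp only [monoidalComp, cancel_epi, cancel_mono]

lemma tensor_zero_iff (A : Centralizer Q) {B : S} (τ : Q.D 0 ⊗ B ⟶ B ⊗ Q.D 0) :
    (((α_ _ _ _).inv ≫ (A.σ 0).hom ▷ B ≫ (α_ _ _ _).hom ≫ A.pt ◁ τ ≫ (α_ _ _ _).inv) ≫
        (A.pt ⊗ B) ◁ Q.zero.hom =
      Q.zero.hom ▷ (A.pt ⊗ B) ≫ (λ_ _).hom ≫ (ρ_ _).inv) ↔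
      A.pt ◁ (τ ≫ B ◁ Q.zero.hom) = A.pt ◁ (Q.zero.hom ▷ B ≫ (λ_ _).hom ≫ (ρ_ _).inv) := by
  have e₁ : ((α_ _ _ _).inv ≫ (A.σ 0).hom ▷ B ≫ (α_ _ _ _).hom ≫ A.pt ◁ τ ≫ (α_ _ _ _).inv) ≫
        (A.pt ⊗ B) ◁ Q.zero.hom = ((α_ _ _ _).inv ≫ (A.σ 0).hom ▷ B ≫ (α_ _ _ _).hom) ≫
        A.pt ◁ (τ ≫ B ◁ Q.zero.hom) ≫ (α_ _ _ _).inv := by monoidal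
  have e₂ : Q.zero.hom ▷ (A.pt ⊗ B) ≫ (λ_ _).hom ≫ (ρ_ _).inv =
      ((α_ _ _ _).inv ≫ (A.σ 0).hom ▷ B ≫ (α_ _ _ _).hom) ≫
        A.pt ◁ (Q.zero.hom ▷ B ≫ (λ_ _).hom ≫ (ρ_ _).inv) ≫ (α_ _ _ _).inv := by
    calc _ = (α_ _ _ _).inv ≫ (Q.zero.hom ▷ A.pt ≫ (λ_ _).hom ≫ (ρ_ _).inv) ▷ B ≫
          (α_ _ _ _).hom ≫ A.pt ◁ ((λ_ _).hom ≫ (ρ_ _).inv) ≫ (α_ _ _ _).inv := by monoidal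
      _ = _ := by rw [← A.σ_zero]; monoidal
  rw [e₁, e₂, cancel_epi, cancel_mono]

lemma whiskerLeft_comm_iff (A : Centralizer Q) {B B' : S} (φ : B ⟶ B') {a : M}
    (τ : Q.D a ⊗ B ⟶ B ⊗ Q.D a) (τ' : Q.D a ⊗ B' ⟶ B' ⊗ Q.D a) :
    (Q.D a ◁ A.pt ◁ φ ≫ (α_ _ _ _).inv ≫ (A.σ a).hom ▷ B' ≫ (α_ _ _ _).hom ≫ A.pt ◁ τ' ≫
        (α_ _ _ _).inv =
      ((α_ _ _ _).inv ≫ (A.σ a).hom ▷ B ≫ (α_ _ _ _).hom ≫ A.pt ◁ τ ≫ (α_ _ _ _).inv) ≫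
        (A.pt ◁ φ) ▷ Q.D a) ↔ A.pt ◁ (Q.D a ◁ φ ≫ τ') = A.pt ◁ (τ ≫ φ ▷ Q.D a) := by
  have e₁ : Q.D a ◁ A.pt ◁ φ ≫ (α_ _ _ _).inv ≫ (A.σ a).hom ▷ B' ≫ (α_ _ _ _).hom ≫ A.pt ◁ τ' ≫
        (α_ _ _ _).inv = ((α_ _ _ _).inv ≫ (A.σ a).hom ▷ B ≫ (α_ _ _ _).hom) ≫
        A.pt ◁ (Q.D a ◁ φ ≫ τ') ≫ (α_ _ _ _).inv := by
    calc _ = (α_ _ _ _).inv ≫ ((Q.D a ⊗ A.pt) ◁ φ ≫ (A.σ a).hom ▷ B') ≫ (α_ _ _ _).hom ≫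
          A.pt ◁ τ' ≫ (α_ _ _ _).inv := by monoidal
      _ = _ := by rw [whisker_exchange]; monoidal
  have e₂ : ((α_ _ _ _).inv ≫ (A.σ a).hom ▷ B ≫ (α_ _ _ _).hom ≫ A.pt ◁ τ ≫ (α_ _ _ _).inv) ≫
        (A.pt ◁ φ) ▷ Q.D a = ((α_ _ _ _).inv ≫ (A.σ a).hom ▷ B ≫ (α_ _ _ _).hom) ≫
        A.pt ◁ (τ ≫ φ ▷ Q.D a) ≫ (α_ _ _ _).inv := by monoidal
  rw [e₁, e₂, cancel_epi, cancel_mono]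

/-- The tensor product of the centralizer. -/
def tensor (A B : Centralizer Q) : Centralizer Q where
  pt := A.pt ⊗ B.pt
  σ a := (α_ _ _ _).symm ≪≫ whiskerRightIso (A.σ a) _ ≪≫ α_ _ _ _ ≪≫ whiskerLeftIso _ (B.σ a) ≪≫
    (α_ _ _ _).symm
  σ_mul {a b c} h := (A.tensor_mul_iff (fun a => (B.σ a).hom) h).2 (by rw [B.σ_mul])
  σ_zero := (A.tensor_zero_iff _).2 (by rw [B.σ_zero])
  scalCentral r := (A.scalCentral r).tensor (B.scalCentral r)

instance : MonoidalCategoryStruct (Centralizer Q) where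
  tensorObj := tensor
  tensorUnit :=
    { pt := 𝟙_ S
      σ a := ρ_ _ ≪≫ (λ_ _).symm
      σ_mul h := by simp only [Iso.trans_hom, Iso.symm_hom]; monoidal
      σ_zero := by simp only [Iso.trans_hom, Iso.symm_hom]; monoidal
      scalCentral r := .unit _ }
  whiskerLeft A {B B'} φ := ⟨A.pt ◁ φ.f, fun a =>
    (A.whiskerLeft_comm_iff φ.f (B.σ a).hom (B'.σ a).hom).2 (by rw [φ.comm])⟩
  whiskerRight {A A'} φ B := ⟨φ.f ▷ B.pt, fun a => by
    simp only [tensor, Iso.trans_hom, Iso.symm_hom, whiskerRightIso_hom, whiskerLeftIso_hom]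
    calc _ = 𝟙 _ ⊗≫ (Q.D a ◁ φ.f ≫ (A'.σ a).hom) ▷ B.pt ⊗≫ A'.pt ◁ (B.σ a).hom ⊗≫
          𝟙 _ := by monoidal
      _ = 𝟙 _ ⊗≫ (A.σ a).hom ▷ B.pt ⊗≫ (φ.f ▷ (Q.D a ⊗ B.pt) ≫ A'.pt ◁ (B.σ a).hom) ⊗≫
          𝟙 _ := by rw [φ.comm]; monoidal
      _ = _ := by rw [← whisker_exchange]; monoidal⟩
  associator A B C := isoMk (α_ _ _ _) fun a => by
    simp only [tensor, Iso.trans_hom, Iso.symm_hom, whiskerRightIso_hom, whiskerLeftIso_hom]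
    monoidal
  leftUnitor A := isoMk (λ_ _) fun a => by
    simp only [tensor, Iso.trans_hom, Iso.symm_hom, whiskerRightIso_hom, whiskerLeftIso_hom]
    monoidal
  rightUnitor A := isoMk (ρ_ _) fun a => by
    simp only [tensor, Iso.trans_hom, Iso.symm_hom, whiskerRightIso_hom, whiskerLeftIso_hom]
    monoidal

@[simp]
lemma whiskerLeft_f (A : Centralizer Q) {B B' : Centralizer Q} (φ : B ⟶ B') :
    (A ◁ φ).f = A.pt ◁ φ.f := rfl

@[simp]
lemma whiskerRight_f {A A' : Centralizer Q} (φ : A ⟶ A') (B : Centralizer Q) :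
    (φ ▷ B).f = φ.f ▷ B.pt := rfl

lemma tensorHom_f {A A' B B' : Centralizer Q} (φ : A ⟶ A') (ψ : B ⟶ B') :
    (φ ⊗ₘ ψ).f = φ.f ⊗ₘ ψ.f := (MonoidalCategory.tensorHom_def _ _).symm

instance : MonoidalCategory (Centralizer Q) where
  whiskerLeft_id A B := hom_ext (MonoidalCategory.whiskerLeft_id A.pt B.pt)
  id_whiskerRight A B := hom_ext (MonoidalCategory.id_whiskerRight A.pt B.pt)
  tensorHom_comp_tensorHom f₁ f₂ g₁ g₂ := hom_ext (by
    simp only [tensorHom_f, comp_f]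
    exact MonoidalCategory.tensorHom_comp_tensorHom f₁.f f₂.f g₁.f g₂.f)
  id_tensorHom_id A B := hom_ext (by rw [tensorHom_f]; exact id_tensorHom_id A.pt B.pt)
  associator_naturality {A₁ A₂ A₃ B₁ B₂ B₃} f g h := hom_ext (by
    simp only [tensorHom_f, comp_f]
    exact associator_naturality f.f g.f h.f)
  leftUnitor_naturality {A B} f := hom_ext (leftUnitor_naturality f.f)
  rightUnitor_naturality {A B} f := hom_ext (rightUnitor_naturality f.f)
  pentagon A B C D := hom_ext (pentagon A.pt B.pt C.pt D.pt)
  triangle A B := hom_ext (triangle A.pt B.pt)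

instance : (forget Q).Monoidal := Functor.CoreMonoidal.toMonoidal
  { εIso := Iso.refl _
    μIso A B := Iso.refl (A.pt ⊗ B.pt)
    μIso_hom_natural_left {A A'} f B :=
      (Category.comp_id (f.f ▷ B.pt)).trans (Category.id_comp (f.f ▷ B.pt)).symm
    μIso_hom_natural_right {B B'} A f :=
      (Category.comp_id (A.pt ◁ f.f)).trans (Category.id_comp (A.pt ◁ f.f)).symm
    associativity A B C := by
      change 𝟙 (A.pt ⊗ B.pt) ▷ C.pt ≫ 𝟙 ((A.pt ⊗ B.pt) ⊗ C.pt) ≫ (α_ A.pt B.pt C.pt).hom =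
        (α_ A.pt B.pt C.pt).hom ≫ A.pt ◁ 𝟙 (B.pt ⊗ C.pt) ≫ 𝟙 (A.pt ⊗ (B.pt ⊗ C.pt))
      simp
    left_unitality A := by
      change (λ_ A.pt).hom = 𝟙 (𝟙_ S) ▷ A.pt ≫ 𝟙 (𝟙_ S ⊗ A.pt) ≫ (λ_ A.pt).hom
      simp
    right_unitality A := by
      change (ρ_ A.pt).hom = A.pt ◁ 𝟙 (𝟙_ S) ≫ 𝟙 (A.pt ⊗ 𝟙_ S) ≫ (ρ_ A.pt).hom
      simp }

/-- The substitute for linearity. Centrality of the `D a` makes scalar multiples morphisms of the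
centralizer; centrality of its objects makes the action compatible with left whiskering. -/
instance (A B : Centralizer Q) : MulAction K (A ⟶ B) where
  smul r φ := ⟨scal (Q.s r) A.pt ≫ φ.f, fun a => by
    rw [MonoidalCategory.whiskerLeft_comp, (Q.scalCentral r a).whiskerLeft, Category.assoc, φ.comm,
      ← reassoc_of% scal_naturality, comp_whiskerRight, scal_whiskerRight]⟩
  one_smul φ := hom_ext (by
    change scal (Q.s 1) A.pt ≫ φ.f = φ.f
    rw [Q.s_one, scal_id, Category.id_comp])
  mul_smul r t φ := hom_ext (by
    change scal (Q.s (r * t)) A.pt ≫ φ.f = scal (Q.s r) A.pt ≫ scal (Q.s t) A.pt ≫ φ.f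
    rw [Q.s_mul, scal_comp, Category.assoc])

lemma smul_f {A B : Centralizer Q} (r : K) (φ : A ⟶ B) :
    (r • φ).f = scal (Q.s r) A.pt ≫ φ.f := rfl

instance : ScalarCat K (Centralizer Q) where
  smul_comp r f g := hom_ext (by simp only [comp_f, smul_f, Category.assoc])
  comp_smul f r g := hom_ext (by
    simp only [comp_f, smul_f]
    rw [← Category.assoc, scal_naturality, Category.assoc])
  whiskerLeft_smul A {B C} r f := hom_ext (by
    rw [whiskerLeft_f, smul_f, smul_f, MonoidalCategory.whiskerLeft_comp,
      (A.scalCentral r).whiskerLeft]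
    rfl)
  smul_whiskerRight A {B C} r f := hom_ext (by
    rw [whiskerRight_f, smul_f, smul_f, comp_whiskerRight, scal_whiskerRight]
    rfl)

end Centralizer
end BraiderLocalization

/-! ### Lifting a monoidal functor to the centralizer -/

namespace BraiderLocalization

open Functor.LaxMonoidal Functor.OplaxMonoidal

namespace CentralPowers

variable {K : Type x} [CommGroup K] {T : Type u} [Category.{v} T] [MonoidalCategory T]
  [∀ X Y : T, MulAction K (X ⟶ Y)] [ScalarCat K T] {M : Type w} [AddCommMonoid M]
  {G : Type w} [AddCommGroup G] (P : CentralPowers K T M G)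
  {S : Type u'} [Category.{v'} S] [MonoidalCategory S] (H : T ⥤ S) [H.Monoidal]

lemma scal_map_smul (r : K) (X : T) :
    scal (ε H ≫ H.map (r • 𝟙 (𝟙_ T)) ≫ η H) (H.obj X) = H.map (r • 𝟙 X) := by
  have e : (λ_ X).hom ≫ (r • 𝟙 X) = (r • 𝟙 (𝟙_ T)) ▷ X ≫ (λ_ X).hom := by
    simp [ScalarCat.smul_comp, ScalarCat.comp_smul, ScalarCat.smul_whiskerRight]
  have e' := congrArg H.map e
  rw [H.map_comp, H.map_comp, Functor.Monoidal.map_whiskerRight,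
    Functor.Monoidal.map_leftUnitor] at e'
  simp only [Category.assoc, Functor.Monoidal.μ_δ_assoc] at e'
  rw [cancel_epi] at e'
  rw [scal, Iso.inv_comp_eq, comp_whiskerRight, comp_whiskerRight, Category.assoc, Category.assoc,
    ← e']
  simp

/-- With `scal_map_smul`: the left and right actions on `H(X)` of the unit endomorphism attached to
`r` are both the image of `r • 𝟙 X`, so every `H(X)` is central for these scalars. -/
lemma whiskerLeft_map_smul (r : K) (X : T) :
    H.obj X ◁ (ε H ≫ H.map (r • 𝟙 (𝟙_ T)) ≫ η H) ≫ (ρ_ _).hom =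
      (ρ_ _).hom ≫ H.map (r • 𝟙 X) := by
  have e : (ρ_ X).hom ≫ (r • 𝟙 X) = X ◁ (r • 𝟙 (𝟙_ T)) ≫ (ρ_ X).hom := by
    simp [ScalarCat.smul_comp, ScalarCat.comp_smul, ScalarCat.whiskerLeft_smul]
  have e' := congrArg H.map e
  rw [H.map_comp, H.map_comp, Functor.Monoidal.map_whiskerLeft,
    Functor.Monoidal.map_rightUnitor] at e'
  simp only [Category.assoc, Functor.Monoidal.μ_δ_assoc] at e'
  rw [cancel_epi] at e'
  rw [MonoidalCategory.whiskerLeft_comp, MonoidalCategory.whiskerLeft_comp, Category.assoc,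
    Category.assoc, ← e']
  simp

/-- The image of a system of powers under a monoidal functor. -/
@[simps]
def image : ObjPowers K M S where
  D a := H.obj (P.C a)
  mul h := Functor.Monoidal.μIso H _ _ ≪≫ H.mapIso (P.ξ h)
  zero := H.mapIso P.zeroIso ≪≫ (Functor.Monoidal.εIso H).symm
  s r := ε H ≫ H.map (r • 𝟙 (𝟙_ T)) ≫ η H
  s_one := by simp
  s_mul r t := by
    have e : (r * t) • 𝟙 (𝟙_ T) = (r • 𝟙 (𝟙_ T)) ≫ (t • 𝟙 (𝟙_ T)) := by
      rw [ScalarCat.smul_comp, ScalarCat.comp_smul, Category.comp_id, mul_smul]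
    rw [e, H.map_comp]
    simp
  scalCentral r a := by
    rw [ScalCentral, whiskerLeft_map_smul, scal_map_smul]

variable [hR : ∀ (a : M) (X : T), IsIso (H.map ((P.pow a).R X))]

/-- The functor to the centralizer of the image of a system of powers. -/
noncomputable def toCentralizer : T ⥤ Centralizer (P.image H) where
  obj X :=
    { pt := H.obj X
      σ a := Functor.Monoidal.μIso H _ _ ≪≫ asIso (H.map ((P.pow a).R X)) ≪≫
        (Functor.Monoidal.μIso H _ _).symm
      σ_mul {a b c} h := by
        have e := congrArg H.map (P.ξ_braider h X)
        simp only [H.map_comp, Functor.Monoidal.map_whiskerLeft, Functor.Monoidal.map_whiskerRight,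
          Functor.Monoidal.map_associator, Functor.Monoidal.map_associator_inv, Category.assoc,
          Functor.Monoidal.μ_δ_assoc] at e
        simp only [image, Iso.trans_hom, Functor.Monoidal.μIso_hom, Functor.mapIso_hom,
          asIso_hom, Iso.symm_hom, Functor.Monoidal.μIso_inv, comp_whiskerRight, Category.assoc,
          MonoidalCategory.whiskerLeft_comp]
        have e' := congrArg (μ H _ _ ≫ ·) e
        simp only [Functor.Monoidal.μ_δ_assoc] at e'
        rw [reassoc_of% e']
        simp
      σ_zero := by
        have e := congrArg H.map (P.zeroIso_braider X)
        simp only [H.map_comp, Functor.Monoidal.map_whiskerLeft, Functor.Monoidal.map_whiskerRight,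
          Functor.Monoidal.map_leftUnitor, Functor.Monoidal.map_rightUnitor_inv, Category.assoc,
          Functor.Monoidal.μ_δ_assoc] at e
        have e' := congrArg (μ H _ _ ≫ ·) e
        simp only [Functor.Monoidal.μ_δ_assoc] at e'
        simp only [image, Iso.trans_hom, Functor.Monoidal.μIso_hom, Functor.mapIso_hom,
          asIso_hom, Iso.symm_hom, Functor.Monoidal.μIso_inv, comp_whiskerRight, Category.assoc,
          MonoidalCategory.whiskerLeft_comp, Functor.Monoidal.εIso_inv]
        have e'' := congrArg (· ≫ δ H _ _ ≫ _ ◁ η H) e'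
        simpa only [Category.assoc, Functor.Monoidal.μ_δ_assoc,
          Functor.Monoidal.whiskerLeft_ε_η, Category.comp_id] using e''
      scalCentral r := by
        rw [ScalCentral, image_s, whiskerLeft_map_smul, scal_map_smul] }
  map f := ⟨H.map f, fun a => by
    have e := congrArg H.map ((P.pow a).naturality f)
    simp only [H.map_comp, Functor.Monoidal.map_whiskerLeft, Functor.Monoidal.map_whiskerRight,
      Category.assoc] at e
    have e' := congrArg (μ H _ _ ≫ · ≫ δ H _ _) e
    simp only [Functor.Monoidal.μ_δ_assoc, Category.assoc, Functor.Monoidal.μ_δ,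
      Category.comp_id] at e'
    change H.obj (P.C a) ◁ H.map f ≫ μ H _ _ ≫ H.map ((P.pow a).R _) ≫ δ H _ _ =
      (μ H _ _ ≫ H.map ((P.pow a).R _) ≫ δ H _ _) ≫ H.map f ▷ H.obj (P.C a)
    simp only [Category.assoc]
    exact e'⟩
  map_id X := by ext; exact H.map_id X
  map_comp f g := by ext; exact H.map_comp f g

noncomputable instance : (P.toCentralizer H).Monoidal := Functor.CoreMonoidal.toMonoidal
  { εIso := Centralizer.isoMk (Functor.Monoidal.εIso H) (fun a => by
      change H.obj (P.C a) ◁ ε H ≫ μ H _ _ ≫ H.map ((P.pow a).R (𝟙_ T)) ≫ δ H _ _ =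
        ((ρ_ _).hom ≫ (λ_ _).inv) ≫ ε H ▷ _
      rw [show (P.pow a).R (𝟙_ T) = (ρ_ _).hom ≫ (λ_ _).inv from P.r_unit a, H.map_comp,
        Functor.Monoidal.map_rightUnitor, Functor.Monoidal.map_leftUnitor_inv]
      simp)
    μIso X Y := Centralizer.isoMk (Functor.Monoidal.μIso H X Y) (fun a => by
      change H.obj (P.C a) ◁ μ H X Y ≫ μ H _ _ ≫ H.map ((P.pow a).R (X ⊗ Y)) ≫ δ H _ _ =
        ((α_ _ _ _).inv ≫ (μ H _ _ ≫ H.map ((P.pow a).R X) ≫ δ H _ _) ▷ _ ≫ (α_ _ _ _).hom ≫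
          _ ◁ (μ H _ _ ≫ H.map ((P.pow a).R Y) ≫ δ H _ _) ≫ (α_ _ _ _).inv) ≫ μ H X Y ▷ _
      rw [(P.pow a).tensor]
      simp only [H.map_comp, Functor.Monoidal.map_whiskerLeft, Functor.Monoidal.map_whiskerRight,
        Functor.Monoidal.map_associator, Functor.Monoidal.map_associator_inv, Category.assoc,
        Functor.Monoidal.μ_δ_assoc, comp_whiskerRight, MonoidalCategory.whiskerLeft_comp]
      simp)
    μIso_hom_natural_left {X X'} f Y := Centralizer.hom_ext (μ_natural_left H f Y)
    μIso_hom_natural_right {Y Y'} X f := Centralizer.hom_ext (μ_natural_right H X f)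
    associativity X Y Z := Centralizer.hom_ext (Functor.LaxMonoidal.associativity H X Y Z)
    left_unitality X := Centralizer.hom_ext (Functor.LaxMonoidal.left_unitality H X)
    right_unitality X := Centralizer.hom_ext (Functor.LaxMonoidal.right_unitality H X) }

/-- The functor to the centralizer followed by the forgetful functor. -/
noncomputable def toCentralizerCompForget :
    P.toCentralizer H ⋙ Centralizer.forget (P.image H) ≅ H :=
  NatIso.ofComponents (fun X => Iso.refl (H.obj X)) (fun f =>
    (Category.comp_id (H.map f)).trans (Category.id_comp (H.map f)).symm)

instance : NatTrans.IsMonoidal (P.toCentralizerCompForget H).hom where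
  unit := by
    rw [Functor.LaxMonoidal.comp_ε]
    change (𝟙 (𝟙_ S) ≫ ε H) ≫ 𝟙 (H.obj (𝟙_ T)) = ε H
    simp
  tensor X Y := by
    rw [Functor.LaxMonoidal.comp_μ]
    change (𝟙 (H.obj X ⊗ H.obj Y) ≫ μ H X Y) ≫ 𝟙 (H.obj (X ⊗ Y)) =
      (𝟙 (H.obj X) ⊗ₘ 𝟙 (H.obj Y)) ≫ μ H X Y
    simp

end CentralPowers
end BraiderLocalization

/-! ### The system of powers in the centralizer -/

namespace BraiderLocalization

open Functor.LaxMonoidal Functor.OplaxMonoidal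

/-- The half braidings on an object of the centralizer commute. -/
lemma Centralizer.yangBaxter {K : Type x} [CommGroup K] {M : Type w} [AddCommMonoid M]
    {S : Type u} [Category.{v} S] [MonoidalCategory S] {Q : ObjPowers K M S} (A : Centralizer Q)
    {a b c : M} (h : a + b = c) (h' : b + a = c) (t : Q.D b ⊗ Q.D a ⟶ Q.D a ⊗ Q.D b) (r : K)
    (ht : t ≫ (Q.mul h).hom = scal (Q.s r) _ ≫ (Q.mul h').hom) :
    Q.D b ◁ (A.σ a).hom ≫ (α_ _ _ _).inv ≫ (A.σ b).hom ▷ Q.D a ≫ (α_ _ _ _).hom ≫ A.pt ◁ t ≫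
        (α_ _ _ _).inv =
      ((α_ _ _ _).inv ≫ t ▷ A.pt ≫ (α_ _ _ _).hom ≫ Q.D a ◁ (A.σ b).hom ≫ (α_ _ _ _).inv) ≫
        (A.σ a).hom ▷ Q.D b := by
  rw [← cancel_mono ((α_ _ _ _).hom ≫ A.pt ◁ (Q.mul h).hom)]
  calc _ = Q.D b ◁ (A.σ a).hom ≫ (α_ _ _ _).inv ≫ (A.σ b).hom ▷ Q.D a ≫ (α_ _ _ _).hom ≫
          A.pt ◁ (t ≫ (Q.mul h).hom) := by monoidal
    _ = (Q.D b ◁ (A.σ a).hom ≫ (α_ _ _ _).inv ≫ (A.σ b).hom ▷ Q.D a ≫ (α_ _ _ _).hom) ≫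
          scal (Q.s r) _ ≫ A.pt ◁ (Q.mul h').hom := by
        rw [ht, MonoidalCategory.whiskerLeft_comp, (A.scalCentral r).whiskerLeft]
        simp only [Category.assoc]
    _ = scal (Q.s r) _ ≫ (α_ _ _ _).inv ≫ (α_ _ _ _).hom ≫ Q.D b ◁ (A.σ a).hom ≫
          (α_ _ _ _).inv ≫ (A.σ b).hom ▷ Q.D a ≫ (α_ _ _ _).hom ≫ A.pt ◁ (Q.mul h').hom := by
        rw [← Category.assoc, scal_naturality]
        simp only [Category.assoc, Iso.inv_hom_id_assoc]
    -- Crossing `D a` and then `D b` amounts to crossing `D c`. The same `σ c` factors through the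
    -- other order as well, and the two orders are related by `t` and the scalar.
    _ = (α_ _ _ _).inv ≫ scal (Q.s r) _ ▷ A.pt ≫ (Q.mul h').hom ▷ A.pt ≫ (A.σ c).hom := by
        rw [← A.σ_mul h', ← Category.assoc, ← scal_naturality, scal_whiskerRight, Category.assoc]
    _ = (α_ _ _ _).inv ≫ t ▷ A.pt ≫ (Q.mul h).hom ▷ A.pt ≫ (A.σ c).hom := by
        rw [← comp_whiskerRight_assoc, ← ht, comp_whiskerRight_assoc]
    _ = _ := by
        rw [A.σ_mul h]; simp only [Category.assoc]

namespace CentralPowers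

variable {K : Type x} [CommGroup K] {T : Type u} [Category.{v} T] [MonoidalCategory T]
  [∀ X Y : T, MulAction K (X ⟶ Y)] [ScalarCat K T] {M : Type w} [AddCommMonoid M]
  {G : Type w} [AddCommGroup G] (P : CentralPowers K T M G)
  {S : Type u'} [Category.{v'} S] [MonoidalCategory S] (H : T ⥤ S) [H.Monoidal]

lemma map_R_comp_mul {a b c : M} (h : a + b = c) (h' : b + a = c) :
    (μ H _ _ ≫ H.map ((P.pow a).R (P.C b)) ≫ δ H _ _) ≫ ((P.image H).mul h').hom =
      scal ((P.image H).s (P.k a b)) _ ≫ ((P.image H).mul h).hom := by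
  change (μ H _ _ ≫ H.map ((P.pow a).R (P.C b)) ≫ δ H _ _) ≫ μ H _ _ ≫ H.map (P.ξ h').hom =
    scal _ (H.obj (P.C a) ⊗ H.obj (P.C b)) ≫ μ H _ _ ≫ H.map (P.ξ h).hom
  rw [← reassoc_of% scal_naturality _ (μ H (P.C a) (P.C b)), image_s, scal_map_smul]
  simp only [Category.assoc, Functor.Monoidal.δ_μ_assoc, ← H.map_comp, P.comm h h',
    ScalarCat.smul_comp, Category.id_comp, k]

lemma map_ξ_assoc {a b c ab bc abc : M} (h₁ : a + b = ab) (h₂ : ab + c = abc)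
    (h₃ : b + c = bc) (h₄ : a + bc = abc) :
    (μ H _ _ ≫ H.map (P.ξ h₁).hom) ▷ H.obj (P.C c) ≫ μ H _ _ ≫ H.map (P.ξ h₂).hom =
      (α_ _ _ _).hom ≫ H.obj (P.C a) ◁ (μ H _ _ ≫ H.map (P.ξ h₃).hom) ≫
        μ H _ _ ≫ H.map (P.ξ h₄).hom := by
  have e := congrArg (μ H _ _ ▷ _ ≫ μ H _ _ ≫ H.map ·) (P.ξ_assoc h₁ h₂ h₃ h₄)
  simp only [H.map_comp, Functor.Monoidal.map_whiskerLeft, Functor.Monoidal.map_whiskerRight,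
    Functor.Monoidal.map_associator, Category.assoc, Functor.Monoidal.μ_δ_assoc] at e
  simp only [comp_whiskerRight, MonoidalCategory.whiskerLeft_comp, Category.assoc, e]
  simp

lemma map_ξ_zero : (μ H _ _ ≫ H.map (P.ξ (add_zero (0 : M))).hom) ≫ H.map P.zeroIso.hom ≫ η H =
    ((H.map P.zeroIso.hom ≫ η H) ⊗ₘ (H.map P.zeroIso.hom ≫ η H)) ≫ (λ_ (𝟙_ S)).hom := by
  rw [Category.assoc, ← H.map_comp_assoc, P.ξ_zero, H.map_comp, Functor.Monoidal.map_tensor,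
    Functor.Monoidal.map_leftUnitor]
  simp only [Category.assoc, Functor.Monoidal.μ_δ_assoc]
  rw [← tensorHom_comp_tensorHom_assoc, MonoidalCategory.tensorHom_def (η H), Category.assoc,
    leftUnitor_naturality]

variable [hR : ∀ (a : M) (X : T), IsIso (H.map ((P.pow a).R X))]

/-- The objects of a system of powers as braiders of the centralizer. -/
noncomputable def centralizerPow (a : M) : Braider (Centralizer (P.image H)) where
  pt := (P.toCentralizer H).obj (P.C a)
  R A := ⟨(A.σ a).hom, fun b => A.yangBaxter rfl (add_comm b a) _ _ (P.map_R_comp_mul H (add_comm b a) rfl)⟩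
  naturality f := Centralizer.hom_ext (f.comm a)
  tensor A B := Centralizer.hom_ext rfl
  unit := Centralizer.hom_ext (by
    change ((ρ_ (H.obj (P.C a))).hom ≫ (λ_ _).inv) ≫ (λ_ _).hom = (ρ_ _).hom
    simp)

/-- The induced system of powers in the centralizer. -/
noncomputable def centralizerPowers : CentralPowers K (Centralizer (P.image H)) M G where
  deg := P.deg
  deg_injective := P.deg_injective
  exists_deg_eq := P.exists_deg_eq
  κ := P.κ
  κ_add_left := P.κ_add_left
  κ_add_right := P.κ_add_right
  pow := P.centralizerPow H
  ξ h := Functor.Monoidal.μIso (P.toCentralizer H) _ _ ≪≫ (P.toCentralizer H).mapIso (P.ξ h)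
  zeroIso := (P.toCentralizer H).mapIso P.zeroIso ≪≫
    (Functor.Monoidal.εIso (P.toCentralizer H)).symm
  zeroIso_braider A := Centralizer.hom_ext A.σ_zero
  ξ_braider h A := Centralizer.hom_ext (A.σ_mul h)
  ξ_assoc h₁ h₂ h₃ h₄ := P.map_ξ_assoc (P.toCentralizer H) h₁ h₂ h₃ h₄
  ξ_zero := P.map_ξ_zero (P.toCentralizer H)
  comm h h' := Centralizer.hom_ext (P.map_R_comp_mul H h h')

/-- The compatibility of the induced system of powers with the given one. -/
noncomputable def mapCentralizerPowers :
    MapPowers P (P.centralizerPowers H) (P.toCentralizer H) where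
  map_smul r f := Centralizer.hom_ext (by
    rw [Centralizer.smul_f]
    change H.map (r • f) = scal (ε H ≫ H.map (r • 𝟙 (𝟙_ T)) ≫ η H) (H.obj _) ≫ H.map f
    rw [scal_map_smul, ← H.map_comp, ScalarCat.smul_comp, Category.id_comp])
  deg_eq := rfl
  κ_eq := rfl
  iso a := Iso.refl _
  ξ_iso {a b c} h := by
    change μ (P.toCentralizer H) _ _ ≫ (P.toCentralizer H).map (P.ξ h).hom ≫ 𝟙 _ =
      (𝟙 ((P.toCentralizer H).obj (P.C a)) ⊗ₘ 𝟙 ((P.toCentralizer H).obj (P.C b))) ≫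
        μ (P.toCentralizer H) _ _ ≫ (P.toCentralizer H).map (P.ξ h).hom
    simp
  zero_iso := by
    rw [Iso.refl_hom]
    refine Eq.trans ?_ (Category.id_comp _).symm
    change (P.toCentralizer H).map P.zeroIso.hom = ((P.toCentralizer H).map P.zeroIso.hom ≫
      η (P.toCentralizer H)) ≫ ε (P.toCentralizer H)
    simp
  R_iso a X := Centralizer.hom_ext (by
    change μ H _ _ ≫ H.map ((P.pow a).R X) ≫ δ H _ _ ≫ H.obj X ◁ 𝟙 _ =
      𝟙 _ ▷ H.obj X ≫ μ H _ _ ≫ H.map ((P.pow a).R X) ≫ δ H _ _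
    simp)

end CentralPowers
end BraiderLocalization

/-! ### Localization at powers that are already invertible -/

namespace BraiderLocalization

open Functor.LaxMonoidal Functor.OplaxMonoidal

section

variable {S : Type u} [Category.{v} S] [MonoidalCategory S]

lemma ScalCentral.of_iso {t : 𝟙_ S ⟶ 𝟙_ S} {X Y : S} (e : X ≅ Y) (h : ScalCentral t Y) :
    ScalCentral t X := by
  rw [ScalCentral] at h ⊢
  rw [← cancel_mono e.hom, Category.assoc, Category.assoc, ← scal_naturality,
    ← rightUnitor_naturality, whisker_exchange_assoc, h, rightUnitor_naturality_assoc]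

lemma ScalCentral.of_tensor {t : 𝟙_ S ⟶ 𝟙_ S} {X Y : S} [(tensorLeft X).Faithful]
    (hX : ScalCentral t X) (h : ScalCentral t (X ⊗ Y)) : ScalCentral t Y := by
  apply (tensorLeft X).map_injective
  have e : X ◁ (Y ◁ t ≫ (ρ_ Y).hom) = (α_ _ _ _).inv ≫ (X ⊗ Y) ◁ t ≫ (ρ_ (X ⊗ Y)).hom := by
    monoidal
  change X ◁ (Y ◁ t ≫ (ρ_ Y).hom) = X ◁ ((ρ_ Y).hom ≫ scal t Y)
  rw [e, h, MonoidalCategory.whiskerLeft_comp, hX.whiskerLeft]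
  monoidal

end

namespace Centralizer

variable {K : Type x} [CommGroup K] {M : Type w} [AddCommMonoid M]
  {S : Type u} [Category.{v} S] [MonoidalCategory S] {Q : ObjPowers K M S}

/-- The transport of half braidings along an isomorphism. -/
def ofIso (B : Centralizer Q) {W : S} (e : W ≅ B.pt) : Centralizer Q where
  pt := W
  σ a := whiskerLeftIso _ e ≪≫ B.σ a ≪≫ (whiskerRightIso e _).symm
  σ_mul {a b c} h := by
    simp only [Iso.trans_hom, Iso.symm_hom, whiskerRightIso_inv, whiskerLeftIso_hom]
    calc _ = (_ ◁ e.hom ≫ (Q.mul h).hom ▷ B.pt) ≫ (B.σ c).hom ≫ e.inv ▷ Q.D c := by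
          rw [whisker_exchange]; simp only [Category.assoc]
      _ = 𝟙 _ ⊗≫ Q.D a ◁ Q.D b ◁ e.hom ⊗≫ Q.D a ◁ (B.σ b).hom ⊗≫
            (B.σ a).hom ▷ Q.D b ⊗≫ (B.pt ◁ (Q.mul h).hom ≫ e.inv ▷ Q.D c) := by
          rw [Category.assoc, reassoc_of% B.σ_mul h]; monoidal
      _ = 𝟙 _ ⊗≫ Q.D a ◁ Q.D b ◁ e.hom ⊗≫ Q.D a ◁ (B.σ b).hom ⊗≫
            Q.D a ◁ (e.inv ≫ e.hom) ▷ Q.D b ⊗≫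
            (B.σ a).hom ▷ Q.D b ⊗≫ e.inv ▷ Q.D a ▷ Q.D b ⊗≫ W ◁ (Q.mul h).hom := by
          rw [whisker_exchange, e.inv_hom_id]; monoidal
      _ = _ := by monoidal
  σ_zero := by
    simp only [Iso.trans_hom, Iso.symm_hom, whiskerRightIso_inv, whiskerLeftIso_hom,
      Category.assoc]
    rw [← whisker_exchange, reassoc_of% B.σ_zero, whisker_exchange_assoc]
    simp
  scalCentral r := .of_iso e (B.scalCentral r)

/-- Divide `B` by `A` first in `S`. The half braiding of `B`, transported to `A.pt ⊗ W`, is composed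
with the inverse of that of `A`; what remains descends to `W` by full faithfulness, and so do the
axioms. -/
lemma exists_tensor_iso (A B : Centralizer Q) [(tensorLeft A.pt).IsEquivalence] :
    ∃ C : Centralizer Q, Nonempty (A ⊗ C ≅ B) := by
  obtain ⟨W, ⟨e⟩⟩ : ∃ W, Nonempty (A.pt ⊗ W ≅ B.pt) :=
    ⟨_, ⟨(tensorLeft A.pt).objObjPreimageIso B.pt⟩⟩
  obtain ⟨θ, θ_mul, θ_zero, θ_comm⟩ :
      ∃ θ : ∀ a, Q.D a ⊗ (A.pt ⊗ W) ≅ (A.pt ⊗ W) ⊗ Q.D a,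
      (∀ {a b c : M} (h : a + b = c), (Q.mul h).hom ▷ (A.pt ⊗ W) ≫ (θ c).hom =
        (α_ _ _ _).hom ≫ Q.D a ◁ (θ b).hom ≫ (α_ _ _ _).inv ≫ (θ a).hom ▷ Q.D b ≫
          (α_ _ _ _).hom ≫ (A.pt ⊗ W) ◁ (Q.mul h).hom) ∧
      (θ 0).hom ≫ (A.pt ⊗ W) ◁ Q.zero.hom =
        Q.zero.hom ▷ (A.pt ⊗ W) ≫ (λ_ _).hom ≫ (ρ_ _).inv ∧
      ∀ a, Q.D a ◁ e.hom ≫ (B.σ a).hom = (θ a).hom ≫ e.hom ▷ Q.D a :=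
    ⟨(B.ofIso e).σ, (B.ofIso e).σ_mul, (B.ofIso e).σ_zero, fun a => by simp [ofIso]⟩
  let τ (a : M) : Q.D a ⊗ W ≅ W ⊗ Q.D a := (tensorLeft A.pt).preimageIso
    ((α_ _ _ _).symm ≪≫ (whiskerRightIso (A.σ a) W).symm ≪≫ α_ _ _ _ ≪≫ θ a ≪≫ α_ _ _ _)
  have hτ (a : M) : (α_ _ _ _).inv ≫ (A.σ a).hom ▷ W ≫ (α_ _ _ _).hom ≫ A.pt ◁ (τ a).hom ≫
      (α_ _ _ _).inv = (θ a).hom := by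
    have : A.pt ◁ (τ a).hom = (α_ _ _ _).inv ≫ (A.σ a).inv ▷ W ≫ (α_ _ _ _).hom ≫
        (θ a).hom ≫ (α_ _ _ _).hom :=
      (tensorLeft A.pt).map_preimage _
    rw [this]; simp
  refine ⟨⟨W, τ, fun {a b c} h => (tensorLeft A.pt).map_injective
    ((A.tensor_mul_iff (fun a => (τ a).hom) h).1 ?_),
    (tensorLeft A.pt).map_injective ((A.tensor_zero_iff (τ 0).hom).1 ?_), fun r =>
      (A.scalCentral r).of_tensor (.of_iso e (B.scalCentral r))⟩, ⟨isoMk e fun a => ?_⟩⟩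
  · simp only [hτ]
    exact θ_mul h
  · rw [hτ]
    exact θ_zero
  · exact (θ_comm a).trans (congrArg (· ≫ e.hom ▷ Q.D a) (hτ a).symm)

/-- Tensoring with an object of the centralizer is an equivalence if it is so after forgetting the
half braidings. -/
lemma isEquivalence_tensorLeft (A : Centralizer Q) [(tensorLeft A.pt).IsEquivalence] :
    (tensorLeft A).IsEquivalence where
  faithful := ⟨fun {B C φ ψ} h => hom_ext ((tensorLeft A.pt).map_injective (congrArg Hom.f h))⟩
  full := ⟨fun {B C} φ => by
    obtain ⟨g, hg⟩ := (tensorLeft A.pt).map_surjective φ.f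
    refine ⟨⟨g, fun a => (tensorLeft A.pt).map_injective
      ((A.whiskerLeft_comm_iff g (B.σ a).hom (C.σ a).hom).1 ?_)⟩, hom_ext hg⟩
    have := φ.comm a
    rw [← hg] at this
    exact this⟩
  essSurj := ⟨fun B => by
    obtain ⟨C, h⟩ := A.exists_tensor_iso B
    exact ⟨C, h⟩⟩

end Centralizer

namespace Loc

variable {K : Type x} [CommGroup K] {T : Type u} [Category.{v} T] [MonoidalCategory T]
  [∀ X Y : T, MulAction K (X ⟶ Y)] [ScalarCat K T] {M : Type w} [AddCommMonoid M]
  {G : Type w} [AddCommGroup G] (P : CentralPowers K T M G)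

/-- Localizing does nothing if the objects `C^a` are already invertible and central. -/
theorem isEquivalence_functor (hR : ∀ a X, IsIso (P.r a X))
    (hC : ∀ a, (tensorLeft (P.C a)).IsEquivalence) : (functor P).IsEquivalence where
  faithful := ⟨fun {X Y f g} h => by
    -- Equality of classes gives `f = g` after tensoring with some `C^c` and composing with the
    -- braiding; the braiding is invertible and tensoring is faithful.
    obtain ⟨c, c', a, b, h₁, h₁', h₂, h₂', e⟩ := (mk_eq_iff _ _ _ _).1 h
    obtain rfl : c = a := by simpa using h₁
    obtain rfl : c = b := by simpa using h₁'
    obtain rfl : c' = c := by simpa using h₂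
    rw [CentralPowers.zeta, CentralPowers.zeta, P.ofHom_comp_rep, P.ofHom_comp_rep] at e
    exact (tensorLeft (P.C c')).map_injective ((cancel_mono (P.r c' Y)).1 e)⟩
  full := ⟨fun {X Y} φ => by
    obtain ⟨a, f, h, rfl⟩ := exists_rep P φ
    -- A morphism `g` of `T` is represented in degree `(a,a)` by `C^a ◁ g` followed by the braiding,
    -- which dictates the equation for `g`.
    obtain ⟨g, hg⟩ := (tensorLeft (P.C a)).map_surjective (f ≫ inv (P.r a Y))
    have hg' : P.C a ◁ g = f ≫ inv (P.r a Y) := hg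
    refine ⟨g, ?_⟩
    rw [functor_map, ← Category.comp_id (of _ _), ← mk_r _ a rfl, of_comp_mk]
    congr 1
    rw [hg', Category.assoc, IsIso.inv_hom_id, Category.comp_id]⟩
  essSurj := ⟨fun z => by
    obtain ⟨b, X, ⟨e⟩⟩ := exists_iso_functor_obj P z
    have := (isInvertibleObj_functor_obj P b).2
    -- Write `X` as `C^b ⊗ W` already in `T`, then cancel `C^b` in the localization.
    let W := (tensorLeft (P.C b)).objPreimage X
    let i : P.C b ⊗ W ≅ X := (tensorLeft (P.C b)).objObjPreimageIso X
    exact ⟨W, ⟨(tensorLeft ((functor P).obj (P.C b))).preimageIso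
      (Functor.Monoidal.μIso (functor P) _ _ ≪≫ (functor P).mapIso i ≪≫ e.symm)⟩⟩⟩

end Loc

end BraiderLocalization

/-! ### Existence and uniqueness of the factorization -/

namespace BraiderLocalization

open Functor.LaxMonoidal Functor.OplaxMonoidal

section

variable {C : Type u} [Category.{v} C] [MonoidalCategory C] {D : Type u'} [Category.{v'} D]
  [MonoidalCategory D]

lemma isMonoidal_inverseMonoidal (e : C ≌ D) [e.functor.Monoidal] :
    letI := e.inverseMonoidal
    e.IsMonoidal :=
  letI := e.inverseMonoidal
  { leftAdjoint_ε := rfl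
    leftAdjoint_μ _ _ := rfl }

lemma isMonoidal_unitIso (e : C ≌ D) [e.functor.Monoidal] :
    letI := e.inverseMonoidal
    NatTrans.IsMonoidal e.unitIso.hom :=
  letI := e.inverseMonoidal
  have : e.IsMonoidal := isMonoidal_inverseMonoidal e
  inferInstanceAs (NatTrans.IsMonoidal e.unit)

lemma exists_monoidal_inverse_of_equivalence (e : C ≌ D) [he : e.functor.Monoidal] :
    ∃ (V : D ⥤ C) (_ : V.Monoidal) (i : 𝟭 C ≅ e.functor ⋙ V), NatTrans.IsMonoidal i.hom :=
  ⟨e.inverse, e.inverseMonoidal, e.unitIso, isMonoidal_unitIso e⟩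

/-- A monoidal functor which is an equivalence has a monoidal inverse. -/
lemma exists_monoidal_inverse (U : C ⥤ D) [hU : U.Monoidal] [U.IsEquivalence] :
    ∃ (V : D ⥤ C) (_ : V.Monoidal) (i : 𝟭 C ≅ U ⋙ V), NatTrans.IsMonoidal i.hom :=
  exists_monoidal_inverse_of_equivalence U.asEquivalence (he := hU)

end

namespace Loc

variable {K : Type x} [CommGroup K] {T : Type u} [Category.{v} T] [MonoidalCategory T]
  [∀ X Y : T, MulAction K (X ⟶ Y)] [ScalarCat K T] {M : Type w} [AddCommMonoid M]
  {G : Type w} [AddCommGroup G] (P : CentralPowers K T M G)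
  {S : Type u'} [Category.{v'} S] [MonoidalCategory S] (H : T ⥤ S) [H.Monoidal]

lemma isEquivalence_functor_centralizerPowers
    [hR : ∀ (a : M) (X : T), IsIso (H.map ((P.pow a).R X))]
    (hC : ∀ a, IsInvertibleObj (H.obj (P.C a))) :
    (functor (P.centralizerPowers H)).IsEquivalence := by
  refine isEquivalence_functor _ (fun a A => ?_) fun a => ?_
  · have : IsIso ((Centralizer.forget _).map ((P.centralizerPowers H).r a A)) :=
      (A.σ a).isIso_hom
    exact isIso_of_reflects_iso _ (Centralizer.forget (P.image H))
  · have : (tensorLeft ((P.toCentralizer H).obj (P.C a)).pt).IsEquivalence := (hC a).2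
    exact Centralizer.isEquivalence_tensorLeft ((P.toCentralizer H).obj (P.C a))

/-- A monoidal functor under which the `C^a` become invertible and central factors through the
localization. -/
theorem exists_factorization (hR : ∀ (a : M) (X : T), IsIso (H.map ((P.pow a).R X)))
    (hC : ∀ a, IsInvertibleObj (H.obj (P.C a))) :
    ∃ (F : Loc P ⥤ S) (_ : F.Monoidal) (θ : functor P ⋙ F ≅ H), NatTrans.IsMonoidal θ.hom := by
  have := isEquivalence_functor_centralizerPowers P H hC
  obtain ⟨V, _, i, _⟩ := exists_monoidal_inverse (functor (P.centralizerPowers H))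
  let E := P.mapCentralizerPowers H
  let U := Centralizer.forget (P.image H)
  let Φ := P.toCentralizer H
  let Q := functor (P.centralizerPowers H)
  -- The route is from `Loc P` to the localization of the centralizer, back to the centralizer by
  -- the inverse `V`, then to `S` by forgetting. On `T` it restricts to the lift of `H` followed by
  -- the forgetful functor.
  exact ⟨map E ⋙ V ⋙ U, inferInstance,
    (Functor.associator (functor P) (map E) (V ⋙ U)).symm ≪≫
      Functor.isoWhiskerRight (functorCompMap E) (V ⋙ U) ≪≫ Functor.associator Φ Q (V ⋙ U) ≪≫
      Functor.isoWhiskerLeft Φ ((Functor.associator Q V U).symm ≪≫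
        Functor.isoWhiskerRight i.symm U ≪≫ U.leftUnitor) ≪≫ P.toCentralizerCompForget H,
    inferInstanceAs (NatTrans.IsMonoidal
      ((Functor.associator (functor P) (map E) (V ⋙ U)).inv ≫
        Functor.whiskerRight (functorCompMap E).hom (V ⋙ U) ≫
        (Functor.associator Φ Q (V ⋙ U)).hom ≫
        Functor.whiskerLeft Φ ((Functor.associator Q V U).inv ≫
          Functor.whiskerRight i.inv U ≫ U.leftUnitor.hom) ≫ (P.toCentralizerCompForget H).hom))⟩

/-- Monoidal functors out of the localization are determined up to a unique isomorphism. -/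
theorem existsUnique_iso (F F' : Loc P ⥤ S) [F.Monoidal] [F'.Monoidal] (θ : functor P ⋙ F ≅ H)
    (θ' : functor P ⋙ F' ≅ H) [NatTrans.IsMonoidal θ.hom] [NatTrans.IsMonoidal θ'.hom] :
    ∃! φ : F ≅ F', NatTrans.IsMonoidal φ.hom ∧
      Functor.isoWhiskerLeft (functor P) φ ≪≫ θ' = θ := by
  -- The required compatibility says exactly that `φ` restricts to `l` on `T`.
  let l : functor P ⋙ F ≅ functor P ⋙ F' := θ ≪≫ θ'.symm
  have : NatTrans.IsMonoidal l.hom :=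
    inferInstanceAs (NatTrans.IsMonoidal (θ.hom ≫ θ'.inv))
  refine ⟨extend l, ⟨inferInstance, ?_⟩, fun φ ⟨_, h⟩ => eq_extend l φ fun X => ?_⟩
  · ext X
    change (extend l).hom.app ((functor P).obj X) ≫ θ'.hom.app X = _
    rw [extend_app_functor_obj]
    simp [l]
  · have h' : φ.hom.app ((functor P).obj X) ≫ θ'.hom.app X = θ.hom.app X := by rw [← h]; rfl
    change _ = θ.hom.app X ≫ θ'.inv.app X
    rw [← h', Category.assoc, Iso.hom_inv_id_app]
    exact (Category.comp_id _).symm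

end Loc

section Words

variable {T : Type u} [Category.{v} T] [MonoidalCategory T] {I : Type w}
  {C : I → Braider T} {S : Type u'} [Category.{v'} S] [MonoidalCategory S] {H : T ⥤ S}
  [H.Monoidal]

lemma InvertsFamily.isInvertibleObj_word (h : InvertsFamily C H) (l : List I) :
    IsInvertibleObj (H.obj (word C l).pt) := by
  induction l with
  | nil => exact .of_iso (Functor.Monoidal.εIso H) .unit
  | cons i l ih => exact .of_iso (Functor.Monoidal.μIso H _ _) ((h.1 i).tensor ih)

lemma InvertsFamily.isIso_map_word_R (h : InvertsFamily C H) (l : List I) (X : T) :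
    IsIso (H.map ((word C l).R X)) := by
  induction l with
  | nil =>
    change IsIso (H.map ((λ_ X).hom ≫ (ρ_ X).inv))
    infer_instance
  | cons i l ih =>
    have := h.2 i X
    change IsIso (H.map ((α_ _ _ _).hom ≫ ((C i).pt ◁ (word C l).R X) ≫ (α_ _ _ _).inv ≫
      ((C i).R X ▷ (word C l).pt) ≫ (α_ _ _ _).hom))
    simp only [Functor.map_comp, Functor.Monoidal.map_whiskerLeft,
      Functor.Monoidal.map_whiskerRight]
    infer_instance

end Words

end BraiderLocalization

/-! ### The main theorem -/

theorem theorem2p6 (k : Type x) [CommRing k]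
    (T : Type u) [Category.{v} T] [MonoidalCategory T] [Preadditive T] [Linear k T]
    [MonoidalPreadditive T] [MonoidalLinear k T]
    (I : Type w) (C : I → BraiderLocalization.Braider T)
    (hC : BraiderLocalization.IsRealCommutingFamily k C) :
    ∃ (L : Type (max u w)) (_ : Category.{max v w} L) (_ : MonoidalCategory L)
      (_ : Preadditive L) (_ : Linear k L) (_ : MonoidalPreadditive L) (_ : MonoidalLinear k L)
      (Υ : T ⥤ L) (_ : Υ.Monoidal) (_ : Υ.Additive) (_ : Υ.Linear k),
      -- `Υ(C_i)` is invertible and `Υ(R_{C_i}(X))` is an isomorphism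
      BraiderLocalization.InvertsFamily C Υ ∧
      -- universal property
      (∀ (T' : Type u') [Category.{v'} T'] [MonoidalCategory T'] (Υ' : T ⥤ T') [Υ'.Monoidal],
        BraiderLocalization.InvertsFamily C Υ' →
        -- existence of the factorization
        (∃ (F : L ⥤ T') (_ : F.Monoidal) (θ : Υ ⋙ F ≅ Υ'), NatTrans.IsMonoidal θ.hom) ∧
        -- uniqueness up to a unique isomorphism
        (∀ (F G : L ⥤ T') [F.Monoidal] [G.Monoidal] (θ : Υ ⋙ F ≅ Υ') (κ : Υ ⋙ G ≅ Υ'),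
          NatTrans.IsMonoidal θ.hom → NatTrans.IsMonoidal κ.hom →
          ∃! φ : F ≅ G, NatTrans.IsMonoidal φ.hom ∧ Functor.isoWhiskerLeft Υ φ ≪≫ κ = θ) ∧
        -- if the target is `k`-linear then so is the factorization
        (∀ [Preadditive T'] [Linear k T'] [MonoidalPreadditive T'] [MonoidalLinear k T']
          [Υ'.Additive] [Υ'.Linear k] (F : L ⥤ T') [F.Monoidal] (θ : Υ ⋙ F ≅ Υ'),
          NatTrans.IsMonoidal θ.hom → F.Additive ∧ F.Linear k)) ∧
      -- explicit form of the localization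
      (∃ (η : I → I → kˣ) (P : BraiderLocalization.Powers C η) (obj : T → (I →₀ ℤ) → L)
        (ι : ∀ {X Y : T} {α β : I →₀ ℤ} (δ : I →₀ ℤ) {a b : I →₀ ℕ},
          BraiderLocalization.toInt a = δ + α → BraiderLocalization.toInt b = δ + β →
          P.Rep X a Y b → (obj X α ⟶ obj Y β)),
        BraiderLocalization.IsExplicitModel P Υ obj ι) := by
  obtain ⟨η, hη⟩ := hC.exists_isCommutationMatrix
  refine ⟨BraiderLocalization.Loc hη.powers, inferInstance, inferInstance, inferInstance,
    inferInstance, inferInstance, inferInstance, BraiderLocalization.Loc.functor hη.powers,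
    inferInstance, inferInstance, inferInstance, hη.invertsFamily, ?_,
    η, hη.tensorPowers, BraiderLocalization.Loc.pair hη.powers, hη.toHom, hη.isExplicitModel⟩
  intro T' _ _ Υ' _ h'
  refine ⟨BraiderLocalization.Loc.exists_factorization hη.powers Υ'
      (fun a X => h'.isIso_map_word_R _ X) (fun a => h'.isInvertibleObj_word _),
    fun F G _ _ θ κ hθ hκ => BraiderLocalization.Loc.existsUnique_iso hη.powers Υ' F G θ κ,
    fun {_ _ _ _ _ _} F _ θ _ => ?_⟩
  -- On `T`, additivity and linearity are transported from `Υ'` along `θ`; they extend to the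
  -- localization because `F` is monoidal.
  have : (BraiderLocalization.Loc.functor hη.powers ⋙ F).Additive :=
    Functor.additive_of_iso θ.symm
  have : (BraiderLocalization.Loc.functor hη.powers ⋙ F).Linear k :=
    Functor.linear_of_iso k θ.symm
  have : F.Additive := BraiderLocalization.Loc.additive_of_comp F
  exact ⟨this, BraiderLocalization.Loc.linear_of_comp F⟩
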